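/- Let $k$ be a field of characteristic $0$ and let $P=k((x_1))((x_2))((\partial_1^{-1}))((\partial_2^{-1}))$ be the ring of formal pseudo-differential operators in two variables, with multiplication given by the Leibniz rule. Write $L=L_++L_-$, where $L_+$ contains the nonnegative and $L_-$ the negative powers of $\partial_2$. Let $\mathrm{res}(L)$ be the coefficient of $L$ at $x_1^{-1}x_2^{-1}\partial_1^{-1}\partial_2^{-1}$, and for $L=(L_1,L_2)$, $M=(M_1,M_2)\in P^2$ put $\langle L,M\rangle=\mathrm{res}(L_1M_1)+\mathrm{res}(L_2M_2)$. Let $P'=\{L\in P^2:[L_1,L_2]=0\}$; a vector $X\in P^2$ is tangent to $P'$ at $L\in P'$ if $[L_1+\epsilon X_1,L_2+\epsilon X_2]=0$ modulo $\epsilon^2$. Let $\mathcal F(P^2)$ be the space of functions $F:P^2\to k$ that are polynomials of bounded degree in any (possibly infinite) number of coefficients of $L_1,L_2$, with only finitely many nonzero terms at each point. The gradient $\nabla_F(L)\in P^2$ is determined by $\langle M,\nabla_F(L)\rangle=\frac{d}{d\epsilon}F(L+\epsilon M)|_{\epsilon=0}$ for all $M\in P^2$, and $$\{F,G\}_R(L)=\langle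 L,[\nabla_F(L),\nabla_G(L)]_R\rangle,\qquad [X,Y]_R=[X_+,Y_+]-[X_-,Y_-]\ \text{(componentwise)}.$$ For $m\ge 1$ put $$H_m(L)=\frac1m\sum_{a+b=m,\ a,b\ge 0}\binom ma\,\mathrm{res}(L_1^aL_2^b).$$ Then every $F\in\mathcal F(P^2)$ has exactly one gradient at every point, $H_m\in\mathcal F(P^2)$ for all $m\geq 1$, and the Hamiltonian systems $$\frac{\partial F}{\partial t_m}=\{F,H_m\}_R,\quad F\in\mathcal F(P^2),$$ have the following properties. (i) $P'$ is invariant, and on $P'$ the system has the form $$\frac{\partial L_i}{\partial t_m}=\big[\big((L_1+L_2)^{m-1}\big)_+,L_i\big],\qquad i=1,2.$$ That is: at each $L\in P'$ the vector $X=\big([((L_1+L_2)^{m-1})_+,L_i]\big)_{i=1,2}$ is the only $X\in P^2$ such that, for all $F\in\mathcal F(P^2)$, the derivative of $F$ at $L$ in the direction $X$ is $\{F,H_m\}_R(L)$, and it is tangent to $P'$. Moreover let $T$ be any set of positive integers and let $L(t)$ be a pair of formal power series in the times $t_m$, $m\in T$, with coefficients in $P$. If $L(t)$ satisfies the Hamiltonian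 systems for all $m\in T$ and $L(0)\in P'$, then $[L_1(t),L_2(t)]=0$; and if $[L_1(t),L_2(t)]=0$, then for each $m\in T$ the series $L(t)$ satisfies the Hamiltonian system for $m$ if and only if it satisfies the displayed equations for $m$. (ii) The $H_m$ are integrals of motion on $P'$: for every formal solution $L(t)$, as in (i), of the Hamiltonian systems for $m\in T$ with $L(0)\in P'$, and for every $m'\ge 1$, all the derivatives $\partial H_{m'}(L(t))/\partial t_m$, $m\in T$, vanish. Moreover $\{H_m,H_{m'}\}_R=0$ on $P'$ for all $m,m'\ge 1$. -/

import Mathlib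

namespace PDO

/-- A derivation of an associative, not necessarily commutative, ring. -/
structure RingDeriv (A : Type*) [Ring A] extends A →+ A where
  leibniz' : ∀ a b : A, toFun (a * b) = toFun a * b + a * toFun b

namespace RingDeriv

instance {A : Type*} [Ring A] : FunLike (RingDeriv A) A A where
  coe d := d.toFun
  coe_injective d e h := by
    cases d; cases e
    congr
    exact DFunLike.coe_injective h

instance {A : Type*} [Ring A] : AddMonoidHomClass (RingDeriv A) A A where
  map_add d := d.map_add'
  map_zero d := d.map_zero'

theorem leibniz {A : Type*} [Ring A] (d : RingDeriv A) (a b : A) :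
    d (a * b) = d a * b + a * d b := d.leibniz' a b

theorem map_one' {A : Type*} [Ring A] (d : RingDeriv A) : d 1 = 0 := by
  have h := d.leibniz 1 1
  simpa using h

theorem iter_zero {A : Type*} [Ring A] (d : RingDeriv A) (n : ℕ) : d^[n] 0 = 0 := by
  induction n with
  | zero => rfl
  | succ n ih => rw [Function.iterate_succ_apply', ih, map_zero]

theorem iter_add {A : Type*} [Ring A] (d : RingDeriv A) (n : ℕ) (a b : A) :
    d^[n] (a + b) = d^[n] a + d^[n] b := by
  induction n with
  | zero => rfl
  | succ n ih => simp only [Function.iterate_succ_apply', ih, map_add]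

theorem iter_zsmul {A : Type*} [Ring A] (d : RingDeriv A) (n : ℕ) (z : ℤ) (a : A) :
    d^[n] (z • a) = z • d^[n] a := by
  induction n with
  | zero => rfl
  | succ n ih => simp only [Function.iterate_succ_apply', ih, map_zsmul]

theorem iter_one {A : Type*} [Ring A] (d : RingDeriv A) {n : ℕ} (hn : n ≠ 0) : d^[n] 1 = 0 := by
  obtain ⟨m, rfl⟩ := Nat.exists_eq_succ_of_ne_zero hn
  rw [Function.iterate_succ_apply, map_one', iter_zero]

theorem iter_mul {A : Type*} [Ring A] (d : RingDeriv A) (n : ℕ) (a b : A) :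
    d^[n] (a * b) =
      ∑ ij ∈ Finset.HasAntidiagonal.antidiagonal n, n.choose ij.1 • (d^[ij.1] a * d^[ij.2] b) := by
  induction n with
  | zero => simp
  | succ n ih =>
    rw [Finset.sum_antidiagonal_choose_succ_nsmul (fun i j => d^[i] a * d^[j] b) n]
    simp only [Function.iterate_succ_apply', ih, map_sum, map_nsmul, leibniz, smul_add,
      Finset.sum_add_distrib]
    rw [add_comm]
    congr 1
    refine Finset.sum_congr rfl fun ⟨i, j⟩ hij => ?_
    rw [n.choose_symm_of_eq_add (Finset.HasAntidiagonal.mem_antidiagonal.1 hij).symm]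

theorem iter_sum {A ι : Type*} [Ring A] (d : RingDeriv A) (n : ℕ) (s : Finset ι) (f : ι → A) :
    d^[n] (∑ i ∈ s, f i) = ∑ i ∈ s, d^[n] (f i) := by
  classical
  induction s using Finset.induction_on with
  | empty => simp
  | insert i s hi ih => rw [Finset.sum_insert hi, Finset.sum_insert hi, iter_add, ih]

theorem iter_comm {A : Type*} [Ring A] (d e : RingDeriv A) (h : ∀ a, d (e a) = e (d a)) (n : ℕ)
    (a : A) : e (d^[n] a) = d^[n] (e a) := by
  induction n with
  | zero => rfl
  | succ n ih => rw [Function.iterate_succ_apply', Function.iterate_succ_apply', ← h, ih]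

end RingDeriv

/-- The ring `A((∂⁻¹))` of formal pseudo-differential operators `∑ aₙ ∂ⁿ` (coefficients on the
left, only finitely many positive powers of `∂`) over a ring `A` with a derivation `d`. -/
structure PseudoDiff (A : Type*) [Ring A] (d : RingDeriv A) where
  /-- The coefficient at `∂ⁿ`. -/
  coeff : ℤ → A
  bdd : ∃ N : ℤ, ∀ n, N < n → coeff n = 0

namespace PseudoDiff

variable {A : Type*} [Ring A] {d : RingDeriv A}

@[ext] theorem ext {f g : PseudoDiff A d} (h : ∀ n, f.coeff n = g.coeff n) : f = g := by
  cases f; cases g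
  congr
  exact funext h

theorem coeff_injective : Function.Injective (coeff : PseudoDiff A d → ℤ → A) :=
  fun _ _ h => ext fun n => congrFun h n

instance : Zero (PseudoDiff A d) := ⟨⟨0, 0, fun _ _ => rfl⟩⟩

instance : Add (PseudoDiff A d) := ⟨fun f g => ⟨f.coeff + g.coeff, by
  obtain ⟨a, ha⟩ := f.bdd
  obtain ⟨b, hb⟩ := g.bdd
  refine ⟨max a b, fun n hn => ?_⟩
  rw [Pi.add_apply, ha n (lt_of_le_of_lt (le_max_left a b) hn),
    hb n (lt_of_le_of_lt (le_max_right a b) hn), add_zero]⟩⟩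

instance : Neg (PseudoDiff A d) := ⟨fun f => ⟨-f.coeff, by
  obtain ⟨a, ha⟩ := f.bdd
  exact ⟨a, fun n hn => by rw [Pi.neg_apply, ha n hn, neg_zero]⟩⟩⟩

instance : Sub (PseudoDiff A d) := ⟨fun f g => ⟨f.coeff - g.coeff, by
  obtain ⟨a, ha⟩ := f.bdd
  obtain ⟨b, hb⟩ := g.bdd
  refine ⟨max a b, fun n hn => ?_⟩
  rw [Pi.sub_apply, ha n (lt_of_le_of_lt (le_max_left a b) hn),
    hb n (lt_of_le_of_lt (le_max_right a b) hn), sub_zero]⟩⟩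

instance {k : Type*} [SMulZeroClass k A] : SMul k (PseudoDiff A d) := ⟨fun c f => ⟨c • f.coeff, by
  obtain ⟨a, ha⟩ := f.bdd
  exact ⟨a, fun n hn => by rw [Pi.smul_apply, ha n hn, smul_zero]⟩⟩⟩

@[simp] theorem coeff_zero (n : ℤ) : (0 : PseudoDiff A d).coeff n = 0 := rfl

@[simp] theorem coeff_add (f g : PseudoDiff A d) (n : ℤ) :
    (f + g).coeff n = f.coeff n + g.coeff n := rfl

@[simp] theorem coeff_neg (f : PseudoDiff A d) (n : ℤ) : (-f).coeff n = -f.coeff n := rfl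

@[simp] theorem coeff_sub (f g : PseudoDiff A d) (n : ℤ) :
    (f - g).coeff n = f.coeff n - g.coeff n := rfl

@[simp] theorem coeff_smul {k : Type*} [SMulZeroClass k A] (c : k) (f : PseudoDiff A d) (n : ℤ) :
    (c • f).coeff n = c • f.coeff n := rfl

instance : AddCommGroup (PseudoDiff A d) :=
  coeff_injective.addCommGroup coeff rfl (fun _ _ => rfl) (fun _ => rfl) (fun _ _ => rfl)
    (fun _ _ => rfl) (fun _ _ => rfl)

instance {k : Type*} [Semiring k] [Module k A] : Module k (PseudoDiff A d) :=
  coeff_injective.module k ⟨⟨coeff, rfl⟩, fun _ _ => rfl⟩ (fun _ _ => rfl)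

/-- The coefficient at `∂ⁿ` of the product of the monomials `x ∂ⁱ` and `y ∂ʲ`, which is
`binom(i, r) x dʳ(y)` with `r = i + j - n` if `r ≥ 0`, and zero otherwise. -/
def mulTerm (d : RingDeriv A) (n i j : ℤ) (x y : A) : A :=
  if n ≤ i + j then Ring.choose i (i + j - n).toNat • (x * d^[(i + j - n).toNat] y) else 0

theorem mulTerm_of_lt {n i j : ℤ} (h : i + j < n) (x y : A) : mulTerm d n i j x y = 0 :=
  if_neg (not_le.2 h)

theorem mulTerm_zero_left (n i j : ℤ) (y : A) : mulTerm d n i j 0 y = 0 := by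
  simp [mulTerm]

theorem mulTerm_zero_right (n i j : ℤ) (x : A) : mulTerm d n i j x 0 = 0 := by
  simp [mulTerm]

theorem mulTerm_add_left (n i j : ℤ) (x x' y : A) :
    mulTerm d n i j (x + x') y = mulTerm d n i j x y + mulTerm d n i j x' y := by
  unfold mulTerm
  split_ifs
  · rw [add_mul, smul_add]
  · rw [add_zero]

theorem mulTerm_add_right (n i j : ℤ) (x y y' : A) :
    mulTerm d n i j x (y + y') = mulTerm d n i j x y + mulTerm d n i j x y' := by
  unfold mulTerm
  split_ifs
  · rw [RingDeriv.iter_add, mul_add, smul_add]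
  · rw [add_zero]

theorem mulTerm_sum_left {ι : Type*} (s : Finset ι) (n i j : ℤ) (x : ι → A) (y : A) :
    mulTerm d n i j (∑ a ∈ s, x a) y = ∑ a ∈ s, mulTerm d n i j (x a) y := by
  unfold mulTerm
  split_ifs
  · rw [Finset.sum_mul, Finset.smul_sum]
  · rw [Finset.sum_const_zero]

theorem mulTerm_sum_right {ι : Type*} (s : Finset ι) (n i j : ℤ) (x : A) (y : ι → A) :
    mulTerm d n i j x (∑ a ∈ s, y a) = ∑ a ∈ s, mulTerm d n i j x (y a) := by
  unfold mulTerm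
  split_ifs
  · rw [RingDeriv.iter_sum, Finset.mul_sum, Finset.smul_sum]
  · rw [Finset.sum_const_zero]

/-- Multiplication of pseudo-differential operators by the Leibniz rule
`(∑ aᵢ ∂ⁱ) (∑ bⱼ ∂ʲ) = ∑ binom(i, r) aᵢ dʳ(bⱼ) ∂ⁱ⁺ʲ⁻ʳ`. -/
noncomputable instance : Mul (PseudoDiff A d) := ⟨fun f g =>
  ⟨fun n => ∑ᶠ p : ℤ × ℤ, mulTerm d n p.1 p.2 (f.coeff p.1) (g.coeff p.2), by
    obtain ⟨a, ha⟩ := f.bdd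
    obtain ⟨b, hb⟩ := g.bdd
    refine ⟨a + b, fun n hn => finsum_eq_zero_of_forall_eq_zero fun p => ?_⟩
    by_cases h1 : a < p.1
    · rw [ha _ h1, mulTerm_zero_left]
    by_cases h2 : b < p.2
    · rw [hb _ h2, mulTerm_zero_right]
    exact mulTerm_of_lt (by omega) _ _⟩⟩

theorem coeff_mul (f g : PseudoDiff A d) (n : ℤ) : (f * g).coeff n =
    ∑ᶠ p : ℤ × ℤ, mulTerm d n p.1 p.2 (f.coeff p.1) (g.coeff p.2) := rfl

theorem coeff_mul_eq_sum {f g : PseudoDiff A d} {a b n : ℤ} (ha : ∀ i, a < i → f.coeff i = 0)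
    (hb : ∀ j, b < j → g.coeff j = 0) {M : ℤ} (h1 : a ≤ M) (h2 : b ≤ M) (h3 : -M ≤ n - b)
    (h4 : -M ≤ n - a) :
    (f * g).coeff n = ∑ i ∈ Finset.Icc (-M) M, ∑ j ∈ Finset.Icc (-M) M,
      mulTerm d n i j (f.coeff i) (g.coeff j) := by
  rw [coeff_mul, ← Finset.sum_product', finsum_eq_sum_of_support_subset]
  rintro ⟨i, j⟩ hp
  rw [Function.mem_support] at hp
  have hi : i ≤ a := by
    by_contra h
    exact hp (by rw [ha i (not_le.1 h), mulTerm_zero_left])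
  have hj : j ≤ b := by
    by_contra h
    exact hp (by rw [hb j (not_le.1 h), mulTerm_zero_right])
  have hn : n ≤ i + j := by
    by_contra h
    exact hp (mulTerm_of_lt (not_le.1 h) _ _)
  simp only [Finset.coe_product, Finset.coe_Icc, Set.mem_prod, Set.mem_Icc]
  omega

theorem coeff_mul_of_lt {f g : PseudoDiff A d} {a b n : ℤ} (ha : ∀ i, a < i → f.coeff i = 0)
    (hb : ∀ j, b < j → g.coeff j = 0) (hn : a + b < n) : (f * g).coeff n = 0 := by
  rw [coeff_mul]
  refine finsum_eq_zero_of_forall_eq_zero fun p => ?_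
  by_cases h1 : a < p.1
  · rw [ha _ h1, mulTerm_zero_left]
  by_cases h2 : b < p.2
  · rw [hb _ h2, mulTerm_zero_right]
  exact mulTerm_of_lt (by omega) _ _

theorem bdd₂ (f g : PseudoDiff A d) : ∃ a : ℤ, (∀ i, a < i → f.coeff i = 0) ∧
    ∀ i, a < i → g.coeff i = 0 := by
  obtain ⟨a, ha⟩ := f.bdd
  obtain ⟨b, hb⟩ := g.bdd
  exact ⟨max a b, fun i hi => ha i (by omega), fun i hi => hb i (by omega)⟩

/-- The sum over the middle exponent in a triple product, bracketed to the left. -/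
theorem sum_left (x y z : A) (i j l n M : ℤ) (N : ℕ) (hN : i + j + l - n = N)
    (h1 : -M ≤ n - l) (h2 : i + j ≤ M) :
    ∑ p ∈ Finset.Icc (-M) M, mulTerm d n p l (mulTerm d p i j x y) z =
      ∑ kr ∈ Finset.HasAntidiagonal.antidiagonal N,
        (Ring.choose i kr.1 * Ring.choose (i + j - kr.1) kr.2) •
          (x * d^[kr.1] y * d^[kr.2] z) := by
  symm
  refine Finset.sum_of_injOn (fun kr : ℕ × ℕ => i + j - kr.1) ?_ ?_ ?_ ?_
  · rintro ⟨k, r⟩ hk ⟨k', r'⟩ hk' h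
    simp only [Finset.mem_coe,
      Finset.HasAntidiagonal.mem_antidiagonal] at hk hk'
    simp only at h
    ext <;> simp <;> omega
  · rintro ⟨k, r⟩ hk
    simp only [Finset.mem_coe, Finset.HasAntidiagonal.mem_antidiagonal] at hk
    simp only [Finset.coe_Icc, Set.mem_Icc]
    omega
  · intro p hp hp'
    by_cases hij : i + j < p
    · rw [mulTerm_of_lt hij, mulTerm_zero_left]
    by_cases hpl : p + l < n
    · rw [mulTerm_of_lt hpl]
    refine absurd ⟨((i + j - p).toNat, (p + l - n).toNat), ?_, ?_⟩ hp'
    · simp only [Finset.mem_coe, Finset.HasAntidiagonal.mem_antidiagonal]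
      omega
    · dsimp only
      omega
  · rintro ⟨k, r⟩ hk
    simp only [Finset.HasAntidiagonal.mem_antidiagonal] at hk
    have e1 : (i + j - (i + j - (k : ℤ))).toNat = k := by omega
    have e2 : (i + j - (k : ℤ) + l - n).toNat = r := by omega
    simp only [mulTerm]
    rw [if_pos (by omega), if_pos (by omega), e1, e2, smul_mul_assoc, smul_smul, mul_comm]

/-- The sum over the middle exponent in a triple product, bracketed to the right. -/
theorem sum_right (x y z : A) (i j l n M : ℤ) (N : ℕ) (hN : i + j + l - n = N)
    (h1 : -M ≤ n - i) (h2 : j + l ≤ M) :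
    ∑ q ∈ Finset.Icc (-M) M, mulTerm d n i q x (mulTerm d q j l y z) =
      ∑ ts ∈ Finset.HasAntidiagonal.antidiagonal N,
        (Ring.choose i ts.1 * Ring.choose j ts.2) •
          (x * d^[ts.1] (y * d^[ts.2] z)) := by
  symm
  refine Finset.sum_of_injOn (fun ts : ℕ × ℕ => j + l - ts.2) ?_ ?_ ?_ ?_
  · rintro ⟨k, r⟩ hk ⟨k', r'⟩ hk' h
    simp only [Finset.mem_coe,
      Finset.HasAntidiagonal.mem_antidiagonal] at hk hk'
    simp only at h
    ext <;> simp <;> omega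
  · rintro ⟨k, r⟩ hk
    simp only [Finset.mem_coe, Finset.HasAntidiagonal.mem_antidiagonal] at hk
    simp only [Finset.coe_Icc, Set.mem_Icc]
    omega
  · intro q hq hq'
    by_cases hjl : j + l < q
    · rw [mulTerm_of_lt hjl, mulTerm_zero_right]
    by_cases hiq : i + q < n
    · rw [mulTerm_of_lt hiq]
    refine absurd ⟨((i + q - n).toNat, (j + l - q).toNat), ?_, ?_⟩ hq'
    · simp only [Finset.mem_coe, Finset.HasAntidiagonal.mem_antidiagonal]
      omega
    · dsimp only
      omega
  · rintro ⟨t, s⟩ hk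
    simp only [Finset.HasAntidiagonal.mem_antidiagonal] at hk
    have e1 : (j + l - (j + l - (s : ℤ))).toNat = s := by omega
    have e2 : (i + (j + l - (s : ℤ)) - n).toNat = t := by omega
    simp only [mulTerm]
    rw [if_pos (by omega), if_pos (by omega), e1, e2, RingDeriv.iter_zsmul, mul_smul_comm,
      smul_smul]

theorem sum_triple (x y z : A) (i j : ℤ) (N : ℕ) :
    ∑ kr ∈ Finset.HasAntidiagonal.antidiagonal N, (Ring.choose i kr.1 * Ring.choose (i + j - kr.1) kr.2) •
          (x * d^[kr.1] y * d^[kr.2] z) =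
      ∑ ts ∈ Finset.HasAntidiagonal.antidiagonal N, (Ring.choose i ts.1 * Ring.choose j ts.2) •
          (x * d^[ts.1] (y * d^[ts.2] z)) := by
  have hL : ∀ kr ∈ Finset.HasAntidiagonal.antidiagonal N,
      (Ring.choose i kr.1 * Ring.choose (i + j - kr.1) kr.2) • (x * d^[kr.1] y * d^[kr.2] z) =
      ∑ vs ∈ Finset.HasAntidiagonal.antidiagonal kr.2, (Ring.choose i kr.1 * (Ring.choose (i - kr.1) vs.1 *
        Ring.choose j vs.2)) • (x * (d^[kr.1] y * d^[kr.2] z)) := by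
    rintro ⟨k, r⟩ -
    have := Ring.add_choose_eq (r := i - (k : ℤ)) (s := j) r (Commute.all _ _)
    simp only
    rw [show i + j - (k : ℤ) = i - k + j by ring, this, Finset.mul_sum, Finset.sum_smul, mul_assoc]
  have hR : ∀ ts ∈ Finset.HasAntidiagonal.antidiagonal N,
      (Ring.choose i ts.1 * Ring.choose j ts.2) • (x * d^[ts.1] (y * d^[ts.2] z)) =
      ∑ uv ∈ Finset.HasAntidiagonal.antidiagonal ts.1, (Ring.choose i uv.1 * (Ring.choose (i - uv.1) uv.2 *
        Ring.choose j ts.2)) • (x * (d^[uv.1] y * d^[uv.2 + ts.2] z)) := by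
    rintro ⟨t, s⟩ -
    simp only
    rw [RingDeriv.iter_mul, Finset.mul_sum, Finset.smul_sum]
    refine Finset.sum_congr rfl ?_
    rintro ⟨u, v⟩ huv
    rw [Finset.HasAntidiagonal.mem_antidiagonal] at huv
    simp only at huv ⊢
    have hc := Ring.choose_smul_choose i (n := t) (k := u) (by omega)
    rw [show t - u = v by omega, nsmul_eq_mul] at hc
    rw [mul_smul_comm, ← Function.iterate_add_apply, ← natCast_zsmul, smul_smul]
    congr 1
    linear_combination Ring.choose j s * hc
  rw [Finset.sum_congr rfl hL, Finset.sum_congr rfl hR, Finset.sum_sigma', Finset.sum_sigma']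
  refine Finset.sum_nbij' (fun w => ⟨(w.1.1 + w.2.1, w.2.2), (w.1.1, w.2.1)⟩)
    (fun w => ⟨(w.2.1, w.2.2 + w.1.2), (w.2.2, w.1.2)⟩) ?_ ?_ ?_ ?_ ?_
  · rintro ⟨⟨a, b⟩, ⟨c, e⟩⟩ h
    simp only [Finset.mem_sigma, Finset.HasAntidiagonal.mem_antidiagonal] at h ⊢
    exact ⟨by omega, trivial⟩
  · rintro ⟨⟨a, b⟩, ⟨c, e⟩⟩ h
    simp only [Finset.mem_sigma, Finset.HasAntidiagonal.mem_antidiagonal] at h ⊢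
    exact ⟨by omega, trivial⟩
  · rintro ⟨⟨a, b⟩, ⟨c, e⟩⟩ h
    simp only [Finset.mem_sigma, Finset.HasAntidiagonal.mem_antidiagonal] at h ⊢
    obtain ⟨h1, rfl⟩ := h
    rfl
  · rintro ⟨⟨a, b⟩, ⟨c, e⟩⟩ h
    simp only [Finset.mem_sigma, Finset.HasAntidiagonal.mem_antidiagonal] at h ⊢
    obtain ⟨h1, rfl⟩ := h
    rfl
  · rintro ⟨⟨a, b⟩, ⟨c, e⟩⟩ h
    simp only [Finset.mem_sigma, Finset.HasAntidiagonal.mem_antidiagonal] at h ⊢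
    obtain ⟨h1, rfl⟩ := h
    rfl

theorem mulTerm_assoc (x y z : A) (i j l n M : ℤ) (h1 : -M ≤ n - l) (h2 : i + j ≤ M)
    (h3 : -M ≤ n - i) (h4 : j + l ≤ M) :
    ∑ p ∈ Finset.Icc (-M) M, mulTerm d n p l (mulTerm d p i j x y) z =
      ∑ q ∈ Finset.Icc (-M) M, mulTerm d n i q x (mulTerm d q j l y z) := by
  by_cases h : i + j + l < n
  · rw [Finset.sum_eq_zero, Finset.sum_eq_zero]
    · intro q _
      by_cases hq : i + q < n
      · exact mulTerm_of_lt hq _ _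
      · rw [mulTerm_of_lt (by omega : j + l < q), mulTerm_zero_right]
    · intro p _
      by_cases hp : p + l < n
      · exact mulTerm_of_lt hp _ _
      · rw [mulTerm_of_lt (by omega : i + j < p), mulTerm_zero_left]
  · obtain ⟨N, hN⟩ := Int.eq_ofNat_of_zero_le (show 0 ≤ i + j + l - n by omega)
    rw [sum_left x y z i j l n M N hN h1 h2, sum_right x y z i j l n M N hN h3 h4, sum_triple]

protected theorem mul_assoc (f g h : PseudoDiff A d) : f * g * h = f * (g * h) := by
  ext n
  obtain ⟨a, ha⟩ := f.bdd
  obtain ⟨b, hb⟩ := g.bdd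
  obtain ⟨c, hc⟩ := h.bdd
  obtain ⟨M, hM⟩ : ∃ M : ℤ, M = |a| + |b| + |c| + |n| := ⟨_, rfl⟩
  have a1 := le_abs_self a
  have a2 := abs_nonneg a
  have b1 := le_abs_self b
  have b2 := abs_nonneg b
  have c1 := le_abs_self c
  have c2 := abs_nonneg c
  have n1 := neg_abs_le n
  have n2 := abs_nonneg n
  rw [coeff_mul_eq_sum (a := a + b) (b := c) (M := M)
      (fun p hp => coeff_mul_of_lt ha hb hp) hc (by omega) (by omega) (by omega) (by omega),
    coeff_mul_eq_sum (a := a) (b := b + c) (M := M) ha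
      (fun p hp => coeff_mul_of_lt hb hc hp) (by omega) (by omega) (by omega) (by omega)]
  have hL : ∀ p ∈ Finset.Icc (-M) M, ∀ l ∈ Finset.Icc (-M) M,
      mulTerm d n p l ((f * g).coeff p) (h.coeff l) =
      ∑ i ∈ Finset.Icc (-M) M, ∑ j ∈ Finset.Icc (-M) M,
        mulTerm d n p l (mulTerm d p i j (f.coeff i) (g.coeff j)) (h.coeff l) := by
    intro p _ l _
    by_cases hpl : p + l < n
    · simp only [mulTerm_of_lt hpl, Finset.sum_const_zero]
    by_cases hl : c < l
    · simp only [hc l hl, mulTerm_zero_right, Finset.sum_const_zero]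
    rw [coeff_mul_eq_sum (M := M) ha hb (by omega) (by omega) (by omega) (by omega),
      mulTerm_sum_left]
    simp only [mulTerm_sum_left]
  have hR : ∀ i ∈ Finset.Icc (-M) M, ∀ q ∈ Finset.Icc (-M) M,
      mulTerm d n i q (f.coeff i) ((g * h).coeff q) =
      ∑ j ∈ Finset.Icc (-M) M, ∑ l ∈ Finset.Icc (-M) M,
        mulTerm d n i q (f.coeff i) (mulTerm d q j l (g.coeff j) (h.coeff l)) := by
    intro i _ q _
    by_cases hiq : i + q < n
    · simp only [mulTerm_of_lt hiq, Finset.sum_const_zero]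
    by_cases hi : a < i
    · simp only [ha i hi, mulTerm_zero_left, Finset.sum_const_zero]
    rw [coeff_mul_eq_sum (M := M) hb hc (by omega) (by omega) (by omega) (by omega),
      mulTerm_sum_right]
    simp only [mulTerm_sum_right]
  rw [Finset.sum_congr rfl fun p hp => Finset.sum_congr rfl (hL p hp),
    Finset.sum_congr rfl fun i hi => Finset.sum_congr rfl (hR i hi)]
  have e1 : ∀ (s : Finset ℤ) (F : ℤ → ℤ → ℤ → ℤ → A),
      ∑ p ∈ s, ∑ l ∈ s, ∑ i ∈ s, ∑ j ∈ s, F p l i j =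
      ∑ i ∈ s, ∑ j ∈ s, ∑ l ∈ s, ∑ p ∈ s, F p l i j := by
    intro s F
    calc _ = ∑ p ∈ s, ∑ i ∈ s, ∑ j ∈ s, ∑ l ∈ s, F p l i j := by
          refine Finset.sum_congr rfl fun p _ => ?_
          rw [Finset.sum_comm]
          exact Finset.sum_congr rfl fun i _ => Finset.sum_comm
      _ = ∑ i ∈ s, ∑ j ∈ s, ∑ p ∈ s, ∑ l ∈ s, F p l i j := by
          rw [Finset.sum_comm]
          exact Finset.sum_congr rfl fun i _ => Finset.sum_comm
      _ = _ := Finset.sum_congr rfl fun i _ => Finset.sum_congr rfl fun j _ => Finset.sum_comm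
  have e2 : ∀ (s : Finset ℤ) (F : ℤ → ℤ → ℤ → ℤ → A),
      ∑ i ∈ s, ∑ q ∈ s, ∑ j ∈ s, ∑ l ∈ s, F i q j l =
      ∑ i ∈ s, ∑ j ∈ s, ∑ l ∈ s, ∑ q ∈ s, F i q j l := by
    intro s F
    refine Finset.sum_congr rfl fun i _ => ?_
    rw [Finset.sum_comm]
    exact Finset.sum_congr rfl fun j _ => Finset.sum_comm
  refine (e1 _ (fun p l i j => mulTerm d n p l (mulTerm d p i j (f.coeff i) (g.coeff j))
    (h.coeff l))).trans (Eq.trans ?_ (e2 _ (fun i q j l => mulTerm d n i q (f.coeff i)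
    (mulTerm d q j l (g.coeff j) (h.coeff l)))).symm)
  refine Finset.sum_congr rfl fun i _ => Finset.sum_congr rfl fun j _ =>
    Finset.sum_congr rfl fun l _ => ?_
  by_cases hi : a < i
  · simp only [ha i hi, mulTerm_zero_left]
  by_cases hj : b < j
  · simp only [hb j hj, mulTerm_zero_left, mulTerm_zero_right]
  by_cases hl : c < l
  · simp only [hc l hl, mulTerm_zero_right]
  exact mulTerm_assoc _ _ _ i j l n M (by omega) (by omega) (by omega) (by omega)

instance : One (PseudoDiff A d) :=
  ⟨⟨fun n => if n = 0 then 1 else 0, 0, fun _ hn => if_neg (ne_of_gt hn)⟩⟩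

theorem coeff_one (n : ℤ) : (1 : PseudoDiff A d).coeff n = if n = 0 then 1 else 0 := rfl

protected theorem one_mul (f : PseudoDiff A d) : 1 * f = f := by
  ext n
  rw [coeff_mul, finsum_eq_single _ (0, n)]
  · simp [mulTerm, coeff_one]
  · rintro ⟨i, j⟩ hp
    by_cases hi : i = 0
    · subst hi
      have hj : j ≠ n := fun h => hp (by rw [h])
      by_cases hn : 0 + j < n
      · exact mulTerm_of_lt hn _ _
      · simp only [mulTerm]
        rw [if_pos (by omega), Ring.choose_zero_pos ℤ (by omega), zero_smul]
    · simp only [coeff_one, if_neg hi, mulTerm_zero_left]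

protected theorem mul_one (f : PseudoDiff A d) : f * 1 = f := by
  ext n
  rw [coeff_mul, finsum_eq_single _ (n, 0)]
  · simp [mulTerm, coeff_one]
  · rintro ⟨i, j⟩ hp
    by_cases hj : j = 0
    · subst hj
      have hi : i ≠ n := fun h => hp (by rw [h])
      by_cases hn : i + 0 < n
      · exact mulTerm_of_lt hn _ _
      · simp only [mulTerm]
        rw [if_pos (by omega), coeff_one, if_pos rfl, RingDeriv.iter_one d (by omega), mul_zero,
          smul_zero]
    · simp only [coeff_one, if_neg hj, mulTerm_zero_right]

protected theorem left_distrib (f g h : PseudoDiff A d) : f * (g + h) = f * g + f * h := by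
  ext n
  obtain ⟨a, ha⟩ := f.bdd
  obtain ⟨b, hb, hc⟩ := bdd₂ g h
  have hbc : ∀ j, b < j → (g + h).coeff j = 0 := fun j hj => by
    rw [coeff_add, hb j hj, hc j hj, add_zero]
  obtain ⟨M, hM⟩ : ∃ M : ℤ, M = |a| + |b| + |n| := ⟨_, rfl⟩
  have a1 := le_abs_self a
  have a2 := abs_nonneg a
  have b1 := le_abs_self b
  have b2 := abs_nonneg b
  have n1 := neg_abs_le n
  have n2 := abs_nonneg n
  rw [coeff_add, coeff_mul_eq_sum (M := M) ha hbc, coeff_mul_eq_sum (M := M) ha hb,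
    coeff_mul_eq_sum (M := M) ha hc]
  · simp only [coeff_add, mulTerm_add_right, Finset.sum_add_distrib]
  all_goals omega

protected theorem right_distrib (f g h : PseudoDiff A d) : (f + g) * h = f * h + g * h := by
  ext n
  obtain ⟨a, ha⟩ := h.bdd
  obtain ⟨b, hb, hc⟩ := bdd₂ f g
  have hbc : ∀ j, b < j → (f + g).coeff j = 0 := fun j hj => by
    rw [coeff_add, hb j hj, hc j hj, add_zero]
  obtain ⟨M, hM⟩ : ∃ M : ℤ, M = |a| + |b| + |n| := ⟨_, rfl⟩
  have a1 := le_abs_self a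
  have a2 := abs_nonneg a
  have b1 := le_abs_self b
  have b2 := abs_nonneg b
  have n1 := neg_abs_le n
  have n2 := abs_nonneg n
  rw [coeff_add, coeff_mul_eq_sum (M := M) hbc ha, coeff_mul_eq_sum (M := M) hb ha,
    coeff_mul_eq_sum (M := M) hc ha]
  · simp only [coeff_add, mulTerm_add_left, Finset.sum_add_distrib]
  all_goals omega

protected theorem zero_mul (f : PseudoDiff A d) : 0 * f = 0 := by
  have h := PseudoDiff.right_distrib 0 0 f
  rw [add_zero] at h
  exact left_eq_add.1 h

protected theorem mul_zero (f : PseudoDiff A d) : f * 0 = 0 := by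
  have h := PseudoDiff.left_distrib f 0 0
  rw [add_zero] at h
  exact left_eq_add.1 h

noncomputable instance : Ring (PseudoDiff A d) where
  __ := (inferInstance : AddCommGroup (PseudoDiff A d))
  mul_assoc := PseudoDiff.mul_assoc
  one_mul := PseudoDiff.one_mul
  mul_one := PseudoDiff.mul_one
  left_distrib := PseudoDiff.left_distrib
  right_distrib := PseudoDiff.right_distrib
  zero_mul := PseudoDiff.zero_mul
  mul_zero := PseudoDiff.mul_zero
  zsmul_neg' := SubNegMonoid.zsmul_neg'
  neg_add_cancel := neg_add_cancel

/-- A derivation `e` of `A` that commutes with `d` acts on `A((∂⁻¹))` coefficientwise. -/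
def mapDeriv (d e : RingDeriv A) (h : ∀ a, d (e a) = e (d a)) : RingDeriv (PseudoDiff A d) where
  toFun f := ⟨fun n => e (f.coeff n), by
    obtain ⟨a, ha⟩ := f.bdd
    exact ⟨a, fun n hn => by rw [ha n hn, map_zero]⟩⟩
  map_zero' := by
    ext n
    exact map_zero e
  map_add' f g := by
    ext n
    exact map_add e _ _
  leibniz' f g := by
    ext n
    obtain ⟨a, ha⟩ := f.bdd
    obtain ⟨b, hb⟩ := g.bdd
    obtain ⟨M, hM⟩ : ∃ M : ℤ, M = |a| + |b| + |n| := ⟨_, rfl⟩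
    have a1 := le_abs_self a
    have a2 := abs_nonneg a
    have b1 := le_abs_self b
    have b2 := abs_nonneg b
    have n1 := neg_abs_le n
    have n2 := abs_nonneg n
    rw [coeff_add, coeff_mul_eq_sum (M := M) (a := a) (b := b),
      coeff_mul_eq_sum (M := M) (a := a) (b := b), ← Finset.sum_add_distrib]
    rotate_left
    · exact ha
    · intro j hj
      simp only [hb j hj, map_zero]
    iterate 4 omega
    · intro j hj
      simp only [ha j hj, map_zero]
    · exact hb
    iterate 4 omega
    simp only
    rw [coeff_mul_eq_sum (M := M) ha hb (by omega) (by omega) (by omega) (by omega), map_sum]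
    refine Finset.sum_congr rfl fun i _ => ?_
    rw [map_sum, ← Finset.sum_add_distrib]
    refine Finset.sum_congr rfl fun j _ => ?_
    unfold mulTerm
    split_ifs
    · rw [map_zsmul, RingDeriv.leibniz, smul_add, RingDeriv.iter_comm d e h]
    · rw [map_zero, add_zero]

end PseudoDiff

section Laurent

variable {R : Type*} [CommRing R]

theorem laurent_coeff_mul (f g : LaurentSeries R) (n : ℤ) (s : Finset ℤ)
    (hs : ∀ i, f.coeff i ≠ 0 → g.coeff (n - i) ≠ 0 → i ∈ s) :
    (f * g).coeff n = ∑ i ∈ s, f.coeff i * g.coeff (n - i) := by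
  rw [HahnSeries.coeff_mul]
  refine Finset.sum_of_injOn (fun p : ℤ × ℤ => p.1) ?_ ?_ ?_ ?_
  · rintro ⟨i, j⟩ h ⟨i', j'⟩ h' e
    simp only [Finset.mem_coe, Finset.mem_antidiagonal] at h h'
    simp only at e
    ext <;> simp <;> omega
  · rintro ⟨i, j⟩ h
    simp only [Finset.mem_coe, Finset.mem_antidiagonal, HahnSeries.mem_support] at h
    obtain ⟨h1, h2, h3⟩ := h
    exact hs i h1 (by rwa [show n - i = j by omega])
  · intro i _ hi
    by_contra h
    have h1 : f.coeff i ≠ 0 := left_ne_zero_of_mul h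
    have h2 : g.coeff (n - i) ≠ 0 := right_ne_zero_of_mul h
    refine hi ⟨(i, n - i), ?_, rfl⟩
    simp only [Finset.mem_coe, Finset.mem_antidiagonal, HahnSeries.mem_support]
    exact ⟨h1, h2, by omega⟩
  · rintro ⟨i, j⟩ h
    simp only [Finset.mem_antidiagonal] at h
    simp only
    rw [show n - i = j by omega]

theorem laurent_exists_finset (f g : LaurentSeries R) (n : ℤ) : ∃ s : Finset ℤ,
    ∀ i, f.coeff i ≠ 0 → g.coeff (n - i) ≠ 0 → i ∈ s := by
  refine ⟨Finset.Icc f.order (n - g.order), fun i h1 h2 => Finset.mem_Icc.2 ⟨?_, ?_⟩⟩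
  · exact HahnSeries.order_le_of_coeff_ne_zero h1
  · have := HahnSeries.order_le_of_coeff_ne_zero h2
    omega

/-- The derivation `d/dx` of `R((x))`. -/
noncomputable def laurentDeriv (R : Type*) [CommRing R] : RingDeriv (LaurentSeries R) where
  toFun f := LaurentSeries.derivative R f
  map_zero' := map_zero _
  map_add' := map_add _
  leibniz' f g := by
    ext n
    obtain ⟨s, hs⟩ := laurent_exists_finset f g (n + 1)
    have h1 : (LaurentSeries.derivative R f * g).coeff n =
        ∑ i ∈ s, ((i : ℤ) • f.coeff i) * g.coeff (n + 1 - i) := by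
      rw [laurent_coeff_mul _ _ n (s.map (Equiv.subRight (1 : ℤ)).toEmbedding), Finset.sum_map]
      · refine Finset.sum_congr rfl fun i _ => ?_
        simp [show n - (i - 1) = n + 1 - i by ring]
      · intro i hi hg
        refine Finset.mem_map.2 ⟨i + 1, hs (i + 1) ?_ ?_, by simp⟩
        · intro h
          exact hi (by simp [h])
        · rwa [show n + 1 - (i + 1) = n - i by ring]
    have h2 : (f * LaurentSeries.derivative R g).coeff n =
        ∑ i ∈ s, f.coeff i * ((n + 1 - i : ℤ) • g.coeff (n + 1 - i)) := by
      rw [laurent_coeff_mul _ _ n s]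
      · refine Finset.sum_congr rfl fun i _ => ?_
        simp [show n - i + 1 = n + 1 - i by ring]
      · intro i hi hg
        refine hs i hi fun h => hg ?_
        simp [show n - i + 1 = n + 1 - i by ring, h]
    rw [HahnSeries.coeff_add, h1, h2, ← Finset.sum_add_distrib]
    have h3 : (LaurentSeries.derivative R (f * g)).coeff n = (n + 1) • (f * g).coeff (n + 1) := by
      simp
    rw [h3, laurent_coeff_mul f g (n + 1) s hs, Finset.smul_sum]
    refine Finset.sum_congr rfl fun i _ => ?_
    simp only [zsmul_eq_mul]
    push_cast
    ring

/-- A derivation of `R` acts on `R((x))` coefficientwise. -/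
noncomputable def laurentMap (e : RingDeriv R) : RingDeriv (LaurentSeries R) where
  toFun f := HahnSeries.map f e
  map_zero' := by
    ext n
    simp
  map_add' f g := by
    ext n
    simp
  leibniz' f g := by
    ext n
    obtain ⟨s, hs⟩ := laurent_exists_finset f g n
    rw [HahnSeries.coeff_add, laurent_coeff_mul _ _ n s, laurent_coeff_mul _ _ n s,
      HahnSeries.map_coeff, laurent_coeff_mul f g n s hs, map_sum, ← Finset.sum_add_distrib]
    · exact Finset.sum_congr rfl fun i _ => e.leibniz _ _
    · intro i h1 h2
      refine hs i h1 fun h => h2 ?_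
      simp [h]
    · intro i h1 h2
      refine hs i (fun h => h1 ?_) h2
      simp [h]

theorem laurent_comm (e : RingDeriv R) (f : LaurentSeries R) :
    laurentMap e (laurentDeriv R f) = laurentDeriv R (laurentMap e f) := by
  ext n
  change e ((LaurentSeries.derivative R f).coeff n) =
    (LaurentSeries.derivative R (HahnSeries.map f e)).coeff n
  simp only [LaurentSeries.derivative_apply, LaurentSeries.hasseDeriv_coeff, HahnSeries.map_coeff,
    map_zsmul]

end Laurent

section Two

variable (k : Type*) [Field k]

/-- The field `k((x₁))((x₂))`. -/
abbrev K : Type _ := LaurentSeries (LaurentSeries k)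

/-- The derivation `∂/∂x₁` of `k((x₁))((x₂))`. -/
noncomputable def d₁ : RingDeriv (K k) := laurentMap (laurentDeriv k)

/-- The derivation `∂/∂x₂` of `k((x₁))((x₂))`. -/
noncomputable def d₂ : RingDeriv (K k) := laurentDeriv (LaurentSeries k)

/-- The ring `k((x₁))((x₂))((∂₁⁻¹))`. -/
abbrev Q : Type _ := PseudoDiff (K k) (d₁ k)

/-- The derivation `∂/∂x₂` of `k((x₁))((x₂))((∂₁⁻¹))`; it kills `∂₁`. -/
noncomputable def d₂Q : RingDeriv (Q k) :=
  PseudoDiff.mapDeriv (d₁ k) (d₂ k) (laurent_comm (laurentDeriv k))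

/-- The ring `P = k((x₁))((x₂))((∂₁⁻¹))((∂₂⁻¹))` of formal pseudo-differential operators in two
variables. -/
abbrev P : Type _ := PseudoDiff (Q k) (d₂Q k)

end Two

variable {k : Type*} [Field k]

/-- The index of a coefficient of an operator: the monomial `x₁^i₁ x₂^i₂ ∂₁^j₁ ∂₂^j₂`. -/
structure Expo where
  i₁ : ℤ
  i₂ : ℤ
  j₁ : ℤ
  j₂ : ℤ

/-- The coefficient of `L` at the monomial `x₁^i₁ x₂^i₂ ∂₁^j₁ ∂₂^j₂`. -/
noncomputable def P.entry (L : P k) (e : Expo) : k :=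
  (((L.coeff e.j₂).coeff e.j₁).coeff e.i₂).coeff e.i₁

/-- The residue of an operator: its coefficient at `x₁⁻¹ x₂⁻¹ ∂₁⁻¹ ∂₂⁻¹`. -/
noncomputable def res (L : P k) : k := P.entry L ⟨-1, -1, -1, -1⟩

/-- The part `L₊` of `L` with the nonnegative powers of `∂₂`. -/
noncomputable def plus (L : P k) : P k where
  coeff n := if 0 ≤ n then L.coeff n else 0
  bdd := by
    obtain ⟨a, ha⟩ := L.bdd
    exact ⟨a, fun n hn => by rw [ha n hn, ite_self]⟩

/-- The part `L₋` of `L` with the negative powers of `∂₂`. -/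
noncomputable def minus (L : P k) : P k := L - plus L

/-- The phase space `P²`. -/
abbrev P2 (k : Type*) [Field k] : Type _ := Fin 2 → P k

/-- The subvariety `P'` of pairs of commuting operators. -/
def PPrime (k : Type*) [Field k] : Set (P2 k) := {L | ∀ i j, ⁅L i, L j⁆ = 0}

/-- A vector `X` is tangent to `P'` at the point `L` of `P'`: the operators `Lᵢ + ε Xᵢ` commute
up to `ε²`. -/
def IsTangent (L X : P2 k) : Prop := ∀ i j, ⁅X i, L j⁆ + ⁅L i, X j⁆ = 0

/-- The pairing `⟨L, M⟩ = ∑ᵢ res (Lᵢ Mᵢ)` on `P²`. -/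
noncomputable def pair (L M : P2 k) : k := ∑ i, res (L i * M i)

/-- The bracket `[X, Y]_R = [X₊, Y₊] - [X₋, Y₋]` on `P²`, taken componentwise. -/
noncomputable def bracketR (X Y : P2 k) : P2 k :=
  fun i => ⁅plus (X i), plus (Y i)⁆ - ⁅minus (X i), minus (Y i)⁆

/-- The value at `L` of a monomial in the coefficients of `L₁, L₂`. -/
noncomputable def monomialValue (μ : Fin 2 × Expo →₀ ℕ) (L : P2 k) : k :=
  μ.prod fun v e => P.entry (L v.1) v.2 ^ e

/-- The space `𝓕(P²)` of functionals: functions on `P²` that are polynomials, of bounded degree,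
in any number (possibly infinite) of coefficients of `L₁, L₂`. Each such polynomial is a formal
linear combination of monomials in the coefficients, only finitely many of which are nonzero at
any given point. -/
def Functionals (k : Type*) [Field k] : Set (P2 k → k) :=
  {F | ∃ (c : (Fin 2 × Expo →₀ ℕ) → k) (D : ℕ), (∀ μ, c μ ≠ 0 → μ.degree ≤ D) ∧
    ∀ L, (Function.support fun μ => c μ * monomialValue μ L).Finite ∧
      F L = ∑ᶠ μ, c μ * monomialValue μ L}

/-- `F` has the derivative `v` at `L` in the direction `M`, that is, `F (L + ε M)` is a polynomial
in `ε` and its derivative at `ε = 0` is `v`. -/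
def HasDirDeriv (F : P2 k → k) (L M : P2 k) (v : k) : Prop :=
  ∃ p : Polynomial k, (∀ ε : k, F (L + ε • M) = p.eval ε) ∧ p.derivative.eval 0 = v

/-- `U` is the gradient of `F` at `L`: `⟨M, U⟩` is the derivative of `F` in the direction `M`, for
all `M`. -/
def IsGradient (F : P2 k → k) (L U : P2 k) : Prop := ∀ M, HasDirDeriv F L M (pair M U)

/-- The gradient of `F` at `L`. -/
noncomputable def grad (F : P2 k → k) (L : P2 k) : P2 k := Classical.epsilon (IsGradient F L)

/-- The Poisson bracket `{F, G}_R (L) = ⟨L, [∇F(L), ∇G(L)]_R⟩`. -/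
noncomputable def poissonR (F G : P2 k → k) : P2 k → k :=
  fun L => pair L (bracketR (grad F L) (grad G L))

/-- `H_{a,b}(L) = res (L₁ᵃ L₂ᵇ)`. -/
noncomputable def H₂ (a b : ℕ) (L : P2 k) : k := res (L 0 ^ a * L 1 ^ b)

/-- `H_m = (1/m) ∑_{a+b=m} binom(m, a) H_{a,b}`. -/
noncomputable def H (m : ℕ) (L : P2 k) : k :=
  (1 / (m : k)) * ∑ p ∈ Finset.HasAntidiagonal.antidiagonal m, (m.choose p.1 : k) * H₂ p.1 p.2 L

/-- The right-hand side `[((L₁ + L₂)^{m-1})₊, Lᵢ]` of the Lax equations. -/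
noncomputable def lax (m : ℕ) (L : P2 k) : P2 k :=
  fun i => ⁅plus ((L 0 + L 1) ^ (m - 1)), L i⁆

section Time

variable {S : Type*}

/-- The partial derivative of a formal power series in the times `tₛ` with respect to `tₛ`. -/
noncomputable def timeDeriv {R : Type*} [Semiring R] (s : S) (f : MvPowerSeries S R) :
    MvPowerSeries S R :=
  fun n => (n s + 1) • MvPowerSeries.coeff (n + Finsupp.single s 1) f

/-- The part `L₊` of an operator that depends on the times. -/
noncomputable def plusT (f : MvPowerSeries S (P k)) : MvPowerSeries S (P k) :=
  fun n => plus (MvPowerSeries.coeff n f)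

open Classical in
/-- The value `∑_{j ≤ n} ε^j Lⱼ` at `t = ε` of the truncation of a formal curve `L(t) = ∑ tʲ Lⱼ` in
`P²`. -/
noncomputable def truncAt (L : Fin 2 → MvPowerSeries S (P k)) (n : S →₀ ℕ) (ε : S → k) : P2 k :=
  fun i => ∑ j ∈ Finset.Icc 0 n, (j.prod fun s e => ε s ^ e) • MvPowerSeries.coeff j (L i)

/-- The formal power series `f(t)` over `k` is the value `F(L(t))` of `F` on the formal curve
`L(t)` in `P²`: the coefficient of `f` at `tⁿ` is that of `F` on the truncation of `L(t)`, which is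
a polynomial in the times. -/
def IsValue (F : P2 k → k) (L : Fin 2 → MvPowerSeries S (P k)) (f : MvPowerSeries S k) : Prop :=
  ∀ n : S →₀ ℕ, ∃ p : MvPolynomial S k, (∀ ε : S → k, F (truncAt L n ε) = MvPolynomial.eval ε p) ∧
    MvPowerSeries.coeff n f = MvPolynomial.coeff n p

/-- The formal curve `L(t)` in `P²` satisfies the Hamiltonian system `∂F/∂tₛ = {F, G}_R` for all
functionals `F`. -/
def IsHamiltonSolution (G : P2 k → k) (s : S) (L : Fin 2 → MvPowerSeries S (P k)) : Prop :=
  ∀ F ∈ Functionals k, ∃ f g : MvPowerSeries S k,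
    IsValue F L f ∧ IsValue (poissonR F G) L g ∧ timeDeriv s f = g

/-- The formal curve `L(t)` lies in `P'`. -/
def InPPrimeT (L : Fin 2 → MvPowerSeries S (P k)) : Prop := ∀ i j, ⁅L i, L j⁆ = 0

/-- The formal curve `L(t)` satisfies `∂Lᵢ/∂tₛ = [((L₁ + L₂)^{m-1})₊, Lᵢ]` for all `i`. -/
def IsLaxSolution (m : ℕ) (s : S) (L : Fin 2 → MvPowerSeries S (P k)) : Prop :=
  ∀ i, timeDeriv s (L i) = ⁅plusT ((L 0 + L 1) ^ (m - 1)), L i⁆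

end Time

end PDO

/-! The residue is a trace: residues of derivatives vanish, so integration by parts gives
`res_mul_comm`. It is nondegenerate (`res_nondegenerate`), and the operators with only nonnegative
powers of `∂₂`, like those with only negative ones, form an isotropic subspace for the form res(LM).
Taking the plus part is therefore adjoint to taking the minus part. With U the gradient of H_m, this
turns ⟨L, [∇F, U]_R⟩ into ⟨X, ∇F⟩, where X_i = [(U_i)₊, L_i]₋ - [(U_i)₋, L_i]₊ (`pair_bracketR`);
the Hamiltonian system is the flow of X.

The gradient U is the cyclic derivative of (1/m) ∑ binom(m, a) L₁ᵃ L₂ᵇ. On `P'` both of its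
components equal W = (L₁ + L₂)^(m-1), which commutes with L_i. Hence [W₋, L_i] = -[W₊, L_i], and the
two halves of X_i add up to [W₊, L_i] (`vecField_of_commute`). The derivation [W₊, ·] maps the
commutator [L₁, L₂] = 0 to zero, which is tangency, and the residue of a commutator vanishes, which
gives the integrals of motion and the involution.

Gradients exist because a linear functional M ↦ ∑ a_v M_v whose sum is finite for every M is a
residue pairing: finiteness forces the reflected family a to have the support of an operator
(`isSupport_of_finite_inter`), and an operator with coefficients to the right of the powers of ∂
realizes it. Pointwise finiteness of a functional over k extends to points with coordinates in any
commutative k-algebra (`finite_monoAt_ne_zero`): the degree is bounded and k is infinite, so a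
nonzero monomial is detected on a finite grid.

This finiteness also makes functionals computable along formal curves, through truncations that are
polynomial in the times. Testing on single coefficients in one direction, and the chain rule in the
other, show that Hamiltonian solutions are exactly the formal integral curves of X
(`isHamiltonSolution_iff`). Since X has Lax form only on `P'`, invariance needs an induction on the
degree in the times: if L₁, L₂ commute in degrees below n, the field has Lax form there, the time
derivatives of [L₁, L₂] vanish there, and so does [L₁, L₂] in degree n. -/

namespace PDO

/-! ### Pseudo-differential operators in one variable: scalars, traces, right-hand coefficients -/

section

namespace RingDeriv

variable {k A : Type*} [Ring A] [Semiring k] [Module k A]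

theorem iter_smul (d : RingDeriv A) (hd : ∀ (c : k) (a : A), d (c • a) = c • d a) (n : ℕ) (c : k)
    (a : A) : d^[n] (c • a) = c • d^[n] a := by
  induction n with
  | zero => rfl
  | succ n ih => rw [Function.iterate_succ_apply', Function.iterate_succ_apply', ih, hd]

end RingDeriv

namespace PseudoDiff

section Smul

variable {k A : Type*} [Ring A] [Semiring k] [Module k A] {d : RingDeriv A}

theorem smul_mul_of_scalarTower (hA : ∀ (c : k) (a b : A), c • a * b = c • (a * b)) (c : k)
    (f g : PseudoDiff A d) : c • f * g = c • (f * g) := by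
  ext n
  obtain ⟨a, ha⟩ := f.bdd
  obtain ⟨b, hb⟩ := g.bdd
  have hc : ∀ i, a < i → (c • f).coeff i = 0 := fun i hi => by
    rw [coeff_smul, ha i hi, smul_zero]
  obtain ⟨M, hM⟩ : ∃ M : ℤ, M = |a| + |b| + |n| := ⟨_, rfl⟩
  have a1 := le_abs_self a
  have a2 := abs_nonneg a
  have b1 := le_abs_self b
  have b2 := abs_nonneg b
  have n1 := neg_abs_le n
  have n2 := abs_nonneg n
  rw [coeff_smul, coeff_mul_eq_sum (M := M) hc hb, coeff_mul_eq_sum (M := M) ha hb]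
  · simp only [Finset.smul_sum]
    refine Finset.sum_congr rfl fun i _ => Finset.sum_congr rfl fun j _ => ?_
    unfold mulTerm
    split_ifs
    · rw [coeff_smul, hA, smul_comm]
    · rw [smul_zero]
  all_goals omega

theorem mul_smul_of_smulComm (hA : ∀ (c : k) (a b : A), a * c • b = c • (a * b))
    (hd : ∀ (c : k) (a : A), d (c • a) = c • d a) (c : k)
    (f g : PseudoDiff A d) : f * c • g = c • (f * g) := by
  ext n
  obtain ⟨a, ha⟩ := f.bdd
  obtain ⟨b, hb⟩ := g.bdd
  have hc : ∀ i, b < i → (c • g).coeff i = 0 := fun i hi => by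
    rw [coeff_smul, hb i hi, smul_zero]
  obtain ⟨M, hM⟩ : ∃ M : ℤ, M = |a| + |b| + |n| := ⟨_, rfl⟩
  have a1 := le_abs_self a
  have a2 := abs_nonneg a
  have b1 := le_abs_self b
  have b2 := abs_nonneg b
  have n1 := neg_abs_le n
  have n2 := abs_nonneg n
  rw [coeff_smul, coeff_mul_eq_sum (M := M) ha hc, coeff_mul_eq_sum (M := M) ha hb]
  · simp only [Finset.smul_sum]
    refine Finset.sum_congr rfl fun i _ => Finset.sum_congr rfl fun j _ => ?_
    unfold mulTerm
    split_ifs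
    · rw [coeff_smul, RingDeriv.iter_smul d hd, hA, smul_comm]
    · rw [smul_zero]
  all_goals omega

end Smul

variable {A : Type*} [Ring A] {d : RingDeriv A}

/-- The operator `a ∂ᵐ`. -/
def single (m : ℤ) (a : A) : PseudoDiff A d where
  coeff n := if n = m then a else 0
  bdd := ⟨m, fun _ hn => if_neg (ne_of_gt hn)⟩

theorem coeff_single (m n : ℤ) (a : A) :
    (single m a : PseudoDiff A d).coeff n = if n = m then a else 0 := rfl

theorem coeff_single_mul (m n : ℤ) (a : A) (g : PseudoDiff A d) :
    (single m a * g).coeff n = ∑ᶠ j : ℤ, mulTerm d n m j a (g.coeff j) := by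
  obtain ⟨b, hb⟩ := g.bdd
  have ha : ∀ i, m < i → (single m a : PseudoDiff A d).coeff i = 0 := fun i hi =>
    if_neg (ne_of_gt hi)
  obtain ⟨M, hM⟩ : ∃ M : ℤ, M = |m| + |b| + |n| := ⟨_, rfl⟩
  have a1 := le_abs_self m
  have a2 := abs_nonneg m
  have a3 := neg_abs_le m
  have b1 := le_abs_self b
  have b2 := abs_nonneg b
  have n1 := neg_abs_le n
  have n2 := abs_nonneg n
  rw [coeff_mul_eq_sum (M := M) ha hb (by omega) (by omega) (by omega) (by omega),
    Finset.sum_eq_single m, finsum_eq_sum_of_support_subset (s := Finset.Icc (-M) M)]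
  · simp [coeff_single]
  · intro j hj
    rw [Function.mem_support] at hj
    have h1 : j ≤ b := by
      by_contra h
      exact hj (by rw [hb j (not_le.1 h), mulTerm_zero_right])
    have h2 : n ≤ m + j := by
      by_contra h
      exact hj (mulTerm_of_lt (not_le.1 h) _ _)
    simp only [Finset.coe_Icc, Set.mem_Icc]
    omega
  · intro i _ hi
    refine Finset.sum_eq_zero fun j _ => ?_
    rw [coeff_single, if_neg hi, mulTerm_zero_left]
  · intro h
    exact absurd (Finset.mem_Icc.2 ⟨by omega, by omega⟩) h

/-- A trace on the coefficients that kills derivatives gives a trace on pseudo-differential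
operators. -/
theorem trace_comm {B : Type*} [AddCommGroup B] (τ : A →+ B) (h1 : ∀ a b, τ (a * b) = τ (b * a))
    (h2 : ∀ a, τ (d a) = 0) (f g : PseudoDiff A d) :
    τ ((f * g).coeff (-1)) = τ ((g * f).coeff (-1)) := by
  -- Integration by parts, `n` times: `τ` kills the derivative of a product.
  have parts : ∀ (n : ℕ) (a b : A), τ (a * d^[n] b) = (-1 : ℤ) ^ n • τ (d^[n] a * b) := by
    intro n
    induction n with
    | zero => intro a b; simp
    | succ n ih =>
      intro a b
      have h := h2 (a * d^[n] b)
      rw [RingDeriv.leibniz, map_add, ← Function.iterate_succ_apply' d, ih (d a) b,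
        ← Function.iterate_succ_apply d] at h
      rw [eq_neg_of_add_eq_zero_right h, pow_succ, mul_neg_one, neg_smul]
  have term : ∀ (i j : ℤ) (a b : A), τ (mulTerm d (-1) i j a b) = τ (mulTerm d (-1) j i b a) := by
    intro i j a b
    by_cases h : i + j < -1
    · rw [mulTerm_of_lt h, mulTerm_of_lt (by omega)]
    · unfold mulTerm
      rw [if_pos (by omega), if_pos (by omega), add_comm j i]
      obtain ⟨N, hN⟩ := Int.eq_ofNat_of_zero_le (show 0 ≤ i + j - -1 by omega)
      rw [hN, map_zsmul, map_zsmul, Int.toNat_natCast, parts, h1 _ b, smul_smul]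
      congr 1
      -- Here `i + j + 1 = N`, so upper negation gives binom(i, N) = (-1)^N binom(j, N); the sign
      -- cancels the one from `parts`.
      rw [show i = -((j : ℤ) - N + 1) by omega, Ring.choose_neg]
      rw [show j - (N : ℤ) + 1 + N - 1 = j by ring, Int.negOnePow_def]
      rw [Units.smul_def]
      simp only [smul_eq_mul, zpow_natCast, Units.val_pow_eq_pow_val, Units.val_neg, Units.val_one]
      rw [mul_right_comm, ← mul_pow]
      simp
  obtain ⟨a, ha⟩ := f.bdd
  obtain ⟨b, hb⟩ := g.bdd
  obtain ⟨M, hM⟩ : ∃ M : ℤ, M = |a| + |b| + 1 := ⟨_, rfl⟩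
  have a1 := le_abs_self a
  have a2 := abs_nonneg a
  have b1 := le_abs_self b
  have b2 := abs_nonneg b
  rw [coeff_mul_eq_sum (M := M) ha hb (by omega) (by omega) (by omega) (by omega),
    coeff_mul_eq_sum (M := M) hb ha (by omega) (by omega) (by omega) (by omega), Finset.sum_comm]
  simp only [map_sum, term]

/-- A nondegenerate trace on the coefficients gives a nondegenerate trace on pseudo-differential
operators. -/
theorem eq_zero_of_trace {B : Type*} [AddCommGroup B] (τ : A →+ B)
    (h : ∀ b, (∀ a, τ (a * b) = 0) → b = 0) (g : PseudoDiff A d)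
    (hg : ∀ f : PseudoDiff A d, τ ((f * g).coeff (-1)) = 0) : g = 0 := by
  by_contra h0
  obtain ⟨b, hb⟩ := g.bdd
  have hne : ∃ n, g.coeff n ≠ 0 := by
    by_contra! h1
    exact h0 (ext h1)
  obtain ⟨l, hl, hmax⟩ := Int.exists_greatest_of_bdd (P := fun n => g.coeff n ≠ 0)
    ⟨b, fun n hn => by
      by_contra h1
      exact hn (hb n (not_le.1 h1))⟩ hne
  refine hl (h _ fun a => ?_)
  -- Only the leading coefficient of `g` reaches `∂⁻¹` in this product, with no derivative on it.
  have := hg (single (-1 - l) a)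
  rw [coeff_single_mul, finsum_eq_single _ l] at this
  · simpa [mulTerm] using this
  · intro j hj
    rcases lt_or_gt_of_ne hj with h1 | h1
    · exact mulTerm_of_lt (by omega) _ _
    · have : g.coeff j = 0 := by
        by_contra h2
        have := hmax j h2
        omega
      rw [this, mulTerm_zero_right]

/-- The operator `∑ ∂ˡ bₗ`, for coefficients `bₗ` that vanish for large `l`. -/
noncomputable def ofRight (d : RingDeriv A) (b : ℤ → A) (hb : ∃ N : ℤ, ∀ n, N < n → b n = 0) :
    PseudoDiff A d where
  coeff n := ∑ᶠ s : ℕ, Ring.choose (n + s) s • d^[s] (b (n + s))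
  bdd := by
    obtain ⟨N, hN⟩ := hb
    refine ⟨N, fun n hn => finsum_eq_zero_of_forall_eq_zero fun s => ?_⟩
    rw [hN _ (by omega), RingDeriv.iter_zero, smul_zero]

theorem ofRight_coeff (b : ℤ → A) (hb : ∃ N : ℤ, ∀ n, N < n → b n = 0) {N : ℤ}
    (hN : ∀ n, N < n → b n = 0) (n : ℤ) (m : ℕ) (hm : N < n + m) :
    (ofRight d b hb).coeff n =
      ∑ s ∈ Finset.range m, Ring.choose (n + s) s • d^[s] (b (n + s)) := by
  refine finsum_eq_sum_of_support_subset _ fun s hs => ?_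
  rw [Function.mem_support] at hs
  by_contra h
  refine hs ?_
  rw [Finset.coe_range, Set.mem_Iio, not_lt] at h
  rw [hN _ (by omega), RingDeriv.iter_zero, smul_zero]

theorem ofRight_zero (b : ℤ → A) (hb : ∃ N : ℤ, ∀ n, N < n → b n = 0) (h : ∀ n, b n = 0) :
    ofRight d b hb = 0 := by
  ext n
  refine finsum_eq_zero_of_forall_eq_zero fun s => ?_
  rw [h, RingDeriv.iter_zero, smul_zero]

/-- Moving `a ∂ᵐ` past `∂ˡ b` costs nothing when the coefficient stands on the right, so a single
`b` survives. In terms of left coefficients, the terms with `n` derivatives have total weight ∑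
binom(m, r) binom(n-1-m, s) = binom(n-1, n) by Vandermonde, which vanishes unless `n = 0`. -/
theorem coeff_single_mul_ofRight (b : ℤ → A) (hb : ∃ N : ℤ, ∀ n, N < n → b n = 0) (m : ℤ) (a : A) :
    (single m a * ofRight d b hb).coeff (-1) = a * b (-1 - m) := by
  obtain ⟨N, hN⟩ := id hb
  -- `b (n - 1 - m)` vanishes for every total number `n ≥ K` of derivatives, so all sums can be cut
  -- off at `K`.
  obtain ⟨K, hK⟩ : ∃ K : ℕ, N + m + 2 ≤ K := ⟨(N + m + 2).toNat, by omega⟩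
  have h0 : ∀ j, N < j → (ofRight d b hb).coeff j = 0 := fun j hj => by
    rw [ofRight_coeff b hb hN j 0 (by simpa using hj), Finset.range_zero, Finset.sum_empty]
  have e1 : (single m a * ofRight d b hb).coeff (-1) =
      ∑ r ∈ Finset.range K, mulTerm d (-1) m (r - 1 - m) a ((ofRight d b hb).coeff (r - 1 - m)) := by
    rw [coeff_single_mul]
    rw [finsum_eq_sum_of_support_subset (s := (Finset.range K).image fun r : ℕ => (r : ℤ) - 1 - m)]
    · rw [Finset.sum_image]
      intro x _ y _ h
      simp only at h
      omega
    · intro j hj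
      rw [Function.mem_support] at hj
      have h1 : j ≤ N := by
        by_contra h
        exact hj (by rw [h0 j (not_le.1 h), mulTerm_zero_right])
      have h2 : -1 ≤ m + j := by
        by_contra h
        exact hj (mulTerm_of_lt (not_le.1 h) _ _)
      simp only [Finset.coe_image, Finset.coe_range, Set.mem_image, Set.mem_Iio]
      exact ⟨(m + j + 1).toNat, by omega, by omega⟩
  have e2 : ∀ r ∈ Finset.range K,
      mulTerm d (-1) m (r - 1 - m) a ((ofRight d b hb).coeff (r - 1 - m)) =
      ∑ s ∈ Finset.range (K - r), (Ring.choose m r * Ring.choose ((r + s : ℕ) - 1 - m) s) •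
        (a * d^[r + s] (b ((r + s : ℕ) - 1 - m))) := by
    intro r hr
    rw [Finset.mem_range] at hr
    rw [ofRight_coeff b hb hN _ (K - r) (by omega), mulTerm_sum_right]
    refine Finset.sum_congr rfl fun s _ => ?_
    unfold mulTerm
    rw [if_pos (by omega), show (m + ((r : ℤ) - 1 - m) - -1).toNat = r by omega,
      RingDeriv.iter_zsmul, mul_smul_comm, smul_smul, ← Function.iterate_add_apply,
      show (r : ℤ) - 1 - m + s = (r + s : ℕ) - 1 - m by push_cast; ring]
  rw [e1, Finset.sum_congr rfl e2, Finset.sum_sigma']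
  have e4 : ∑ x ∈ (Finset.range K).sigma fun r => Finset.range (K - r),
      (Ring.choose m x.1 * Ring.choose ((x.1 + x.2 : ℕ) - 1 - m) x.2) •
        (a * d^[x.1 + x.2] (b ((x.1 + x.2 : ℕ) - 1 - m))) =
      ∑ n ∈ Finset.range K, ∑ rs ∈ Finset.HasAntidiagonal.antidiagonal n,
        (Ring.choose m rs.1 * Ring.choose ((n : ℤ) - 1 - m) rs.2) •
        (a * d^[n] (b ((n : ℤ) - 1 - m))) := by
    rw [Finset.sum_sigma']
    refine Finset.sum_bij' (fun x _ => ⟨x.1 + x.2, (x.1, x.2)⟩) (fun y _ => ⟨y.2.1, y.2.2⟩)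
      ?_ ?_ ?_ ?_ ?_
    · rintro ⟨r, s⟩ h
      simp only [Finset.mem_sigma, Finset.mem_range,
        Finset.HasAntidiagonal.mem_antidiagonal, and_true] at h ⊢
      omega
    · rintro ⟨n, r, s⟩ h
      simp only [Finset.mem_sigma, Finset.mem_range,
        Finset.HasAntidiagonal.mem_antidiagonal] at h ⊢
      omega
    · rintro ⟨r, s⟩ _
      rfl
    · rintro ⟨n, r, s⟩ h
      simp only [Finset.mem_sigma, Finset.HasAntidiagonal.mem_antidiagonal] at h
      obtain ⟨_, rfl⟩ := h
      rfl
    · rintro ⟨r, s⟩ _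
      rfl
  have e5 : ∀ n : ℕ, ∑ rs ∈ Finset.HasAntidiagonal.antidiagonal n,
      (Ring.choose m rs.1 * Ring.choose ((n : ℤ) - 1 - m) rs.2) •
        (a * d^[n] (b ((n : ℤ) - 1 - m))) = if n = 0 then a * b (-1 - m) else 0 := by
    intro n
    rw [← Finset.sum_smul, ← Ring.add_choose_eq n (Commute.all m ((n : ℤ) - 1 - m)),
      show m + ((n : ℤ) - 1 - m) = n - 1 by ring]
    rcases n with _ | n
    · simp
    · rw [if_neg (by omega), show (((n + 1 : ℕ) : ℤ) - 1) = (n : ℕ) by push_cast; ring,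
        Ring.choose_natCast, Nat.choose_succ_self, Nat.cast_zero, zero_smul]
  rw [e4, Finset.sum_congr rfl fun n _ => e5 n, Finset.sum_ite_eq']
  rcases Nat.eq_zero_or_pos K with h | h
  · rw [if_neg (by simp [h]), hN _ (by omega), mul_zero]
  · rw [if_pos (by simpa using h)]

end PseudoDiff

end

/-! ### Formal sums of infinite families -/

section

/-- A notion of formal summation of infinite families in a ring, compatible with the ring
operations. -/
structure FormalSum (A : Type*) [Ring A] where
  /-- The family `f` is summable with sum `a`. -/
  HasSum : ∀ {I : Type}, (I → A) → A → Prop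
  zero : ∀ {I : Type}, HasSum (fun _ : I => 0) 0
  unit : ∀ a, HasSum (fun _ : Unit => a) a
  add : ∀ {I : Type} {f g : I → A} {a b : A}, HasSum f a → HasSum g b →
    HasSum (fun i => f i + g i) (a + b)
  zsmul : ∀ {I : Type} {f : I → A} {a : A} (z : ℤ), HasSum f a → HasSum (fun i => z • f i) (z • a)
  mul : ∀ {I J : Type} {f : I → A} {g : J → A} {a b : A}, HasSum f a → HasSum g b →
    HasSum (fun p : I × J => f p.1 * g p.2) (a * b)

namespace FormalSum

theorem sum {A : Type*} [Ring A] (S : FormalSum A) {I κ : Type} (s : Finset κ) {f : κ → I → A}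
    {a : κ → A} (h : ∀ j ∈ s, S.HasSum (f j) (a j)) :
    S.HasSum (fun i => ∑ j ∈ s, f j i) (∑ j ∈ s, a j) := by
  classical
  induction s using Finset.induction_on with
  | empty => simpa using S.zero
  | insert j s hj ih =>
    simp only [Finset.sum_insert hj]
    exact S.add (h j (Finset.mem_insert_self _ _))
      (ih fun i hi => h i (Finset.mem_insert_of_mem hi))

/-- Summation of families with finitely many nonzero terms. -/
noncomputable def discrete (k : Type*) [Ring k] : FormalSum k where
  HasSum f a := (Function.support f).Finite ∧ a = ∑ᶠ i, f i
  zero := by simp [Function.support]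
  unit a := ⟨Set.toFinite _, by rw [finsum_unique]⟩
  add := by
    rintro I f g a b ⟨hf, rfl⟩ ⟨hg, rfl⟩
    exact ⟨(hf.union hg).subset (Function.support_add f g), (finsum_add_distrib hf hg).symm⟩
  zsmul := by
    rintro I f a z ⟨hf, rfl⟩
    refine ⟨hf.subset fun i hi h => hi ?_, smul_finsum' z hf⟩
    simp [h]
  mul := by
    rintro I J f g a b ⟨hf, rfl⟩ ⟨hg, rfl⟩
    have hs : (Function.support fun p : I × J => f p.1 * g p.2) ⊆
        ↑(hf.toFinset ×ˢ hg.toFinset) := by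
      rintro ⟨i, j⟩ h
      rw [Function.mem_support] at h
      simp only [Finset.coe_product, Set.Finite.coe_toFinset, Set.mem_prod, Function.mem_support]
      exact ⟨left_ne_zero_of_mul h, right_ne_zero_of_mul h⟩
    refine ⟨(Finset.finite_toSet _).subset hs, ?_⟩
    rw [finsum_eq_sum_of_support_subset _ hs, Finset.sum_product,
      finsum_eq_sum_of_support_subset f (s := hf.toFinset) (by simp),
      finsum_eq_sum_of_support_subset g (s := hg.toFinset) (by simp), Finset.sum_mul_sum]

/-- Coefficientwise summation of families of Laurent series with uniformly bounded order. -/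
noncomputable def laurent {R : Type*} [CommRing R] (S : FormalSum R) :
    FormalSum (LaurentSeries R) where
  HasSum f a := (∃ N : ℤ, ∀ n < N, a.coeff n = 0 ∧ ∀ i, (f i).coeff n = 0) ∧
    ∀ n : ℤ, S.HasSum (fun i => (f i).coeff n) (a.coeff n)
  zero := ⟨⟨0, by simp⟩, fun n => by simpa using S.zero⟩
  unit a := ⟨⟨a.order, fun n hn => by simp [HahnSeries.coeff_eq_zero_of_lt_order hn]⟩,
    fun n => S.unit _⟩
  add := by
    rintro I f g a b ⟨⟨M, hM⟩, hf⟩ ⟨⟨N, hN⟩, hg⟩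
    refine ⟨⟨min M N, fun n hn => ?_⟩, fun n => by simpa using S.add (hf n) (hg n)⟩
    obtain ⟨h1, h2⟩ := lt_min_iff.1 hn
    simp [hM n h1, hN n h2]
  zsmul := by
    rintro I f a z ⟨⟨M, hM⟩, hf⟩
    have key : ∀ (g : LaurentSeries R) (n : ℤ), (z • g).coeff n = z • g.coeff n :=
      fun g n => HahnSeries.coeff_smul ..
    refine ⟨⟨M, fun n hn => ?_⟩, fun n => ?_⟩
    · simp only [key, hM n hn, smul_zero, implies_true, and_self]
    · simp only [key]
      exact S.zsmul z (hf n)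
  mul := by
    rintro I J f g a b ⟨⟨M, hM⟩, hf⟩ ⟨⟨N, hN⟩, hg⟩
    have key : ∀ (n : ℤ) (u v : LaurentSeries R), (∀ m < M, u.coeff m = 0) →
        (∀ m < N, v.coeff m = 0) →
        (u * v).coeff n = ∑ i ∈ Finset.Icc M (n - N), u.coeff i * v.coeff (n - i) := by
      intro n u v hu hv
      refine laurent_coeff_mul u v n _ fun i h1 h2 => Finset.mem_Icc.2 ⟨?_, ?_⟩
      · by_contra h
        exact h1 (hu i (not_le.1 h))
      · by_contra h
        exact h2 (hv _ (by omega))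
    refine ⟨⟨M + N, fun n hn => ?_⟩, fun n => ?_⟩
    · have he : Finset.Icc M (n - N) = ∅ := Finset.Icc_eq_empty (by omega)
      refine ⟨?_, fun p => ?_⟩
      · rw [key n _ _ (fun m hm => (hM m hm).1) (fun m hm => (hN m hm).1), he, Finset.sum_empty]
      · rw [key n _ _ (fun m hm => (hM m hm).2 _) (fun m hm => (hN m hm).2 _), he,
          Finset.sum_empty]
    · rw [key n _ _ (fun m hm => (hM m hm).1) (fun m hm => (hN m hm).1)]
      have : (fun p : I × J => (f p.1 * g p.2).coeff n) = fun p : I × J =>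
          ∑ i ∈ Finset.Icc M (n - N), (f p.1).coeff i * (g p.2).coeff (n - i) := by
        funext p
        exact key n _ _ (fun m hm => (hM m hm).2 _) (fun m hm => (hN m hm).2 _)
      rw [this]
      exact S.sum _ fun i _ => S.mul (hf i) (hg _)

/-- A derivation is compatible with formal sums. -/
def Compatible {A : Type*} [Ring A] (S : FormalSum A) (d : RingDeriv A) : Prop :=
  ∀ {I : Type} {f : I → A} {a : A}, S.HasSum f a → S.HasSum (fun i => d (f i)) (d a)

theorem Compatible.iterate {A : Type*} [Ring A] {S : FormalSum A} {d : RingDeriv A}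
    (hd : S.Compatible d) (n : ℕ) {I : Type} {f : I → A} {a : A} (h : S.HasSum f a) :
    S.HasSum (fun i => d^[n] (f i)) (d^[n] a) := by
  induction n with
  | zero => exact h
  | succ n ih =>
    simp only [Function.iterate_succ_apply']
    exact hd ih

theorem laurent_compatible_laurentDeriv {R : Type*} [CommRing R] (S : FormalSum R) :
    S.laurent.Compatible (laurentDeriv R) := by
  rintro I f a ⟨⟨M, hM⟩, hf⟩
  have key : ∀ (g : LaurentSeries R) (n : ℤ),
      (laurentDeriv R g).coeff n = (n + 1) • g.coeff (n + 1) := by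
    intro g n
    change (LaurentSeries.derivative R g).coeff n = _
    simp
  refine ⟨⟨M - 1, fun n hn => ?_⟩, fun n => ?_⟩
  · simp [key, hM (n + 1) (by omega)]
  · simp only [key]
    exact S.zsmul _ (hf _)

theorem laurent_compatible_laurentMap {R : Type*} [CommRing R] (S : FormalSum R)
    {e : RingDeriv R} (he : S.Compatible e) : S.laurent.Compatible (laurentMap e) := by
  rintro I f a ⟨⟨M, hM⟩, hf⟩
  have key : ∀ (g : LaurentSeries R) (n : ℤ), (laurentMap e g).coeff n = e (g.coeff n) :=
    fun g n => rfl
  refine ⟨⟨M, fun n hn => ?_⟩, fun n => ?_⟩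
  · simp [key, hM n hn]
  · simp only [key]
    exact he (hf n)

/-- Coefficientwise summation of families of pseudo-differential operators with uniformly bounded
order. -/
noncomputable def pseudo {A : Type*} [Ring A] (S : FormalSum A) {d : RingDeriv A}
    (hd : S.Compatible d) : FormalSum (PseudoDiff A d) where
  HasSum f a := (∃ N : ℤ, ∀ n, N < n → a.coeff n = 0 ∧ ∀ i, (f i).coeff n = 0) ∧
    ∀ n : ℤ, S.HasSum (fun i => (f i).coeff n) (a.coeff n)
  zero := ⟨⟨0, by simp⟩, fun n => by simpa using S.zero⟩
  unit a := by
    obtain ⟨N, hN⟩ := a.bdd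
    exact ⟨⟨N, fun n hn => by simp [hN n hn]⟩, fun n => S.unit _⟩
  add := by
    rintro I f g a b ⟨⟨M, hM⟩, hf⟩ ⟨⟨N, hN⟩, hg⟩
    refine ⟨⟨max M N, fun n hn => ?_⟩, fun n => by simpa using S.add (hf n) (hg n)⟩
    obtain ⟨h1, h2⟩ := max_lt_iff.1 hn
    simp [hM n h1, hN n h2]
  zsmul := by
    rintro I f a z ⟨⟨M, hM⟩, hf⟩
    refine ⟨⟨M, fun n hn => ?_⟩, fun n => ?_⟩
    · have : ∀ g : PseudoDiff A d, (z • g).coeff n = z • g.coeff n := fun g => rfl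
      simp only [this, hM n hn, smul_zero, implies_true, and_self]
    · exact S.zsmul z (hf n)
  mul := by
    rintro I J f g a b ⟨⟨M, hM⟩, hf⟩ ⟨⟨N, hN⟩, hg⟩
    have hM1 := fun m hm => (hM m hm).1
    have hM2 := fun i m hm => (hM m hm).2 i
    have hN1 := fun m hm => (hN m hm).1
    have hN2 := fun i m hm => (hN m hm).2 i
    refine ⟨⟨M + N, fun n hn => ?_⟩, fun n => ?_⟩
    · exact ⟨PseudoDiff.coeff_mul_of_lt hM1 hN1 hn,
        fun p => PseudoDiff.coeff_mul_of_lt (hM2 p.1) (hN2 p.2) hn⟩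
    · obtain ⟨K, hK⟩ : ∃ K : ℤ, K = |M| + |N| + |n| := ⟨_, rfl⟩
      have a1 := le_abs_self M
      have a2 := abs_nonneg M
      have b1 := le_abs_self N
      have b2 := abs_nonneg N
      have n1 := neg_abs_le n
      have n2 := abs_nonneg n
      rw [PseudoDiff.coeff_mul_eq_sum (M := K) hM1 hN1 (by omega) (by omega) (by omega)
        (by omega)]
      have : (fun p : I × J => (f p.1 * g p.2).coeff n) = fun p : I × J =>
          ∑ i ∈ Finset.Icc (-K) K, ∑ j ∈ Finset.Icc (-K) K,
            PseudoDiff.mulTerm d n i j ((f p.1).coeff i) ((g p.2).coeff j) := by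
        funext p
        exact PseudoDiff.coeff_mul_eq_sum (hM2 p.1) (hN2 p.2) (by omega) (by omega) (by omega)
          (by omega)
      rw [this]
      refine S.sum _ fun i _ => S.sum _ fun j _ => ?_
      unfold PseudoDiff.mulTerm
      split_ifs
      · exact S.zsmul _ (S.mul (hf i) (hd.iterate _ (hg j)))
      · exact S.zero

theorem pseudo_compatible_mapDeriv {A : Type*} [Ring A] (S : FormalSum A) {d e : RingDeriv A}
    (hd : S.Compatible d) (he : S.Compatible e) (h : ∀ a, d (e a) = e (d a)) :
    (S.pseudo hd).Compatible (PseudoDiff.mapDeriv d e h) := by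
  rintro I f a ⟨⟨M, hM⟩, hf⟩
  have key : ∀ (g : PseudoDiff A d) (n : ℤ),
      (PseudoDiff.mapDeriv d e h g).coeff n = e (g.coeff n) := fun g n => rfl
  refine ⟨⟨M, fun n hn => ?_⟩, fun n => ?_⟩
  · simp [key, hM n hn]
  · simp only [key]
    exact he (hf n)

end FormalSum

/-! ### The algebra `P`: monomial expansions and the residue form -/

section Operators

variable (k : Type*) [Field k]

theorem compatible_d₁ : (FormalSum.discrete k).laurent.laurent.Compatible (d₁ k) :=
  FormalSum.laurent_compatible_laurentMap _ (FormalSum.laurent_compatible_laurentDeriv _)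

theorem compatible_d₂ : (FormalSum.discrete k).laurent.laurent.Compatible (d₂ k) :=
  FormalSum.laurent_compatible_laurentDeriv _

/-- Formal summation of families of operators in `P`. -/
noncomputable def sumP : FormalSum (P k) :=
  ((FormalSum.discrete k).laurent.laurent.pseudo (compatible_d₁ k)).pseudo
    (FormalSum.pseudo_compatible_mapDeriv _ (compatible_d₁ k) (compatible_d₂ k) _)

variable {k}

theorem K.smul_mul (c : k) (f g : K k) : c • f * g = c • (f * g) := by
  have h1 : ∀ f : K k, c • f = (HahnSeries.C (HahnSeries.C c)) * f := by
    intro f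
    ext m n
    rw [HahnSeries.C_mul_eq_smul, HahnSeries.coeff_smul, HahnSeries.coeff_smul, smul_eq_mul,
      HahnSeries.coeff_smul, smul_eq_mul, HahnSeries.C_mul_eq_smul, HahnSeries.coeff_smul, smul_eq_mul]
  rw [h1, h1, mul_assoc]

theorem K.mul_smul (c : k) (f g : K k) : f * c • g = c • (f * g) := by
  rw [mul_comm, K.smul_mul, mul_comm]

theorem d₁_smul (c : k) (f : K k) : d₁ k (c • f) = c • d₁ k f := by
  ext m n
  change (LaurentSeries.derivative k ((c • f).coeff m)).coeff n =
    c • (LaurentSeries.derivative k (f.coeff m)).coeff n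
  simp

theorem d₂_smul (c : k) (f : K k) : d₂ k (c • f) = c • d₂ k f := by
  ext m n
  change ((LaurentSeries.derivative (LaurentSeries k) (c • f)).coeff m).coeff n =
    c • ((LaurentSeries.derivative (LaurentSeries k) f).coeff m).coeff n
  simp only [LaurentSeries.derivative_apply, LaurentSeries.hasseDeriv_coeff, HahnSeries.coeff_smul]
  exact smul_comm ..

theorem Q.smul_mul (c : k) (f g : Q k) : c • f * g = c • (f * g) :=
  PseudoDiff.smul_mul_of_scalarTower K.smul_mul c f g

theorem Q.mul_smul (c : k) (f g : Q k) : f * c • g = c • (f * g) :=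
  PseudoDiff.mul_smul_of_smulComm K.mul_smul d₁_smul c f g

theorem d₂Q_smul (c : k) (f : Q k) : d₂Q k (c • f) = c • d₂Q k f := by
  ext1 n
  exact d₂_smul c _

/-- Scalars are central because both derivations are `k`-linear. -/
noncomputable instance : Algebra k (P k) :=
  Algebra.ofModule (PseudoDiff.smul_mul_of_scalarTower Q.smul_mul)
    (PseudoDiff.mul_smul_of_smulComm Q.mul_smul d₂Q_smul)

/-- The coefficient of an operator at a monomial, as a linear functional. -/
noncomputable def entryL (e : Expo) : P k →ₗ[k] k where
  toFun L := P.entry L e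
  map_add' _ _ := rfl
  map_smul' _ _ := rfl

theorem P.entry_ext {L M : P k} (h : ∀ e, P.entry L e = P.entry M e) : L = M := by
  ext j₂ j₁ i₂ i₁
  exact h ⟨i₁, i₂, j₁, j₂⟩

/-- The four layers of summability rest on `FormalSum.discrete`, so at a fixed monomial only a
finite sum in `k` remains. -/
theorem hasSum_entry {I : Type} {f : I → P k} {a : P k} (h : (sumP k).HasSum f a) (e : Expo) :
    (Function.support fun i => P.entry (f i) e).Finite ∧
      P.entry a e = ∑ᶠ i, P.entry (f i) e :=
  (((h.2 e.j₂).2 e.j₁).2 e.i₂).2 e.i₁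

/-- The monomial `x₁^i₁ x₂^i₂ ∂₁^j₁ ∂₂^j₂`. -/
noncomputable def P.mono (k : Type*) [Field k] (e : Expo) : P k :=
  PseudoDiff.single e.j₂ (PseudoDiff.single e.j₁ (HahnSeries.single e.i₂ (HahnSeries.single e.i₁ 1)))

open Classical in
theorem P.entry_mono (e e' : Expo) : P.entry (P.mono k e) e' = if e' = e then 1 else 0 := by
  obtain ⟨a, b, c, d⟩ := e
  obtain ⟨a', b', c', d'⟩ := e'
  simp only [P.entry, P.mono, PseudoDiff.coeff_single, Expo.mk.injEq]
  by_cases h1 : d' = d <;> by_cases h2 : c' = c <;> by_cases h3 : b' = b <;>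
    by_cases h4 : a' = a <;> simp [h1, h2, h3, h4, PseudoDiff.coeff_single]

/-- An operator is the formal sum of its monomials. -/
theorem hasSum_mono (L : P k) : (sumP k).HasSum (fun e => P.entry L e • P.mono k e) L := by
  classical
  have key : ∀ j₂ j₁ i₂ i₁ : ℤ, ∀ e : Expo,
      (((((P.entry L e • P.mono k e).coeff j₂).coeff j₁).coeff i₂).coeff i₁) =
      if e = ⟨i₁, i₂, j₁, j₂⟩ then P.entry L e else 0 := by
    intro j₂ j₁ i₂ i₁ e
    have := P.entry_mono (k := k) e ⟨i₁, i₂, j₁, j₂⟩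
    change P.entry L e * P.entry (P.mono k e) ⟨i₁, i₂, j₁, j₂⟩ = _
    rw [this, mul_ite, mul_one, mul_zero]
    simp only [eq_comm]
  refine ⟨?_, fun j₂ => ⟨?_, fun j₁ => ⟨?_, fun i₂ => ⟨?_, fun i₁ => ⟨?_, ?_⟩⟩⟩⟩⟩
  · obtain ⟨N, hN⟩ := L.bdd
    refine ⟨N, fun n hn => ⟨hN n hn, fun e => ?_⟩⟩
    ext j₁ i₂ i₁
    rw [key]
    split_ifs with h
    · rw [h]
      simp only [P.entry, hN n hn]
    · rfl
  · obtain ⟨N, hN⟩ := (L.coeff j₂).bdd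
    refine ⟨N, fun n hn => ⟨hN n hn, fun e => ?_⟩⟩
    ext i₂ i₁
    rw [key]
    split_ifs with h
    · rw [h]
      simp only [P.entry, hN n hn]
    · rfl
  · refine ⟨((L.coeff j₂).coeff j₁).order, fun n hn =>
      ⟨HahnSeries.coeff_eq_zero_of_lt_order hn, fun e => ?_⟩⟩
    ext i₁
    rw [key]
    split_ifs with h
    · rw [h]
      simp only [P.entry, HahnSeries.coeff_eq_zero_of_lt_order hn]
    · rfl
  · refine ⟨(((L.coeff j₂).coeff j₁).coeff i₂).order, fun n hn =>
      ⟨HahnSeries.coeff_eq_zero_of_lt_order hn, fun e => ?_⟩⟩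
    rw [key]
    split_ifs with h
    · rw [h]
      simp only [P.entry, HahnSeries.coeff_eq_zero_of_lt_order hn]
    · rfl
  · refine (Set.finite_singleton (⟨i₁, i₂, j₁, j₂⟩ : Expo)).subset fun e he => ?_
    rw [Function.mem_support, key] at he
    by_contra h
    exact he (if_neg h)
  · simp only [key]
    rw [finsum_eq_single _ (⟨i₁, i₂, j₁, j₂⟩ : Expo) fun e he => if_neg he, if_pos rfl]
    rfl

/-- The residue as a linear functional. -/
noncomputable def resL : P k →ₗ[k] k := entryL ⟨-1, -1, -1, -1⟩

/-- The residue on `k((x₁))((x₂))`. -/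
noncomputable def resK : K k →+ k where
  toFun f := (f.coeff (-1)).coeff (-1)
  map_zero' := rfl
  map_add' _ _ := rfl

/-- The residue on `k((x₁))((x₂))((∂₁⁻¹))`. -/
noncomputable def resQ : Q k →+ k where
  toFun f := resK (f.coeff (-1))
  map_zero' := rfl
  map_add' _ _ := rfl

/-- The trace property is lifted through one `∂` at a time. Here it rests on the commutativity of `K
k` and on the fact that an `x₁`-derivative has no term in `x₁⁻¹`; for `P` it rests on this lemma and
the same fact for `x₂`. -/
theorem resQ_mul_comm (f g : Q k) : resQ (f * g) = resQ (g * f) := by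
  refine PseudoDiff.trace_comm resK (fun a b => by rw [mul_comm]) (fun a => ?_) f g
  change (LaurentSeries.derivative k (a.coeff (-1))).coeff (-1) = 0
  simp

theorem res_mul_comm (L M : P k) : res (L * M) = res (M * L) := by
  refine PseudoDiff.trace_comm resQ resQ_mul_comm (fun a => ?_) L M
  change ((LaurentSeries.derivative (LaurentSeries k) ((a.coeff (-1)))).coeff (-1)).coeff (-1) = 0
  simp

/-- `K k` is a field, so a nonzero `b` can be completed to a product `x₁⁻¹ x₂⁻¹`. -/
theorem resK_nondegenerate (b : K k) (h : ∀ a, resK (a * b) = 0) : b = 0 := by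
  by_contra hb
  have := h (HahnSeries.single (-1) (HahnSeries.single (-1) 1) * b⁻¹)
  rw [mul_assoc, inv_mul_cancel₀ hb, mul_one] at this
  simp [resK] at this

/-- The residue pairing is nondegenerate. -/
theorem res_nondegenerate (U : P k) (h : ∀ M, res (M * U) = 0) : U = 0 :=
  PseudoDiff.eq_zero_of_trace resQ
    (fun b hb => PseudoDiff.eq_zero_of_trace resK resK_nondegenerate b hb) U h

theorem res_mul_eq_zero_of_lt {L M : P k} {a b : ℤ} (ha : ∀ i, a < i → L.coeff i = 0)
    (hb : ∀ j, b < j → M.coeff j = 0) (hab : a + b < -1) : res (L * M) = 0 := by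
  change resQ ((L * M).coeff (-1)) = 0
  rw [PseudoDiff.coeff_mul_of_lt ha hb hab, map_zero]

/-- The product has order at most `-2` in `∂₂`. -/
theorem res_minus_mul_minus (L M : P k) : res (minus L * minus M) = 0 := by
  have : ∀ (L : P k) (i : ℤ), -1 < i → (minus L).coeff i = 0 := by
    intro L i hi
    change L.coeff i - (if 0 ≤ i then L.coeff i else 0) = 0
    rw [if_pos (by omega), sub_self]
  exact res_mul_eq_zero_of_lt (this L) (this M) (by norm_num)

/-- For `i, j ≥ 0` the coefficient at `∂₂⁻¹` carries binom(i, i + j + 1) = 0. -/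
theorem res_plus_mul_plus (L M : P k) : res (plus L * plus M) = 0 := by
  change resQ ((plus L * plus M).coeff (-1)) = 0
  rw [PseudoDiff.coeff_mul, finsum_eq_zero_of_forall_eq_zero, map_zero]
  rintro ⟨i, j⟩
  change PseudoDiff.mulTerm _ _ i j (if 0 ≤ i then L.coeff i else 0)
    (if 0 ≤ j then M.coeff j else 0) = 0
  by_cases hi : 0 ≤ i
  · by_cases hj : 0 ≤ j
    · unfold PseudoDiff.mulTerm
      lift i to ℕ using hi
      rw [if_pos (by omega), Ring.choose_natCast, Nat.choose_eq_zero_of_lt (by omega),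
        Nat.cast_zero, zero_smul]
    · rw [if_neg hj, PseudoDiff.mulTerm_zero_right]
  · rw [if_neg hi, PseudoDiff.mulTerm_zero_left]

end Operators

end

/-! ### Linear functionals on `P` represented by residue pairings -/

section

variable {k : Type*} [Field k]

/-- The sets of exponents that are supports of operators in `P`. -/
def IsSupport (E : Set Expo) : Prop :=
  BddAbove (Expo.j₂ '' E) ∧
  (∀ b, BddAbove (Expo.j₁ '' {e ∈ E | e.j₂ = b})) ∧
  (∀ b a, BddBelow (Expo.i₂ '' {e ∈ E | e.j₂ = b ∧ e.j₁ = a})) ∧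
  ∀ b a c, BddBelow (Expo.i₁ '' {e ∈ E | e.j₂ = b ∧ e.j₁ = a ∧ e.i₂ = c})

/-- The operator is assembled from the inside out, starting with series in `x₁`; each clause of
`IsSupport` is the bound that one layer of `P` requires. -/
theorem IsSupport.exists_entry_eq {u : Expo → k} (h : IsSupport (Function.support u)) :
    ∃ M : P k, ∀ e, P.entry M e = u e := by
  obtain ⟨h1, h2, h3, h4⟩ := h
  have f1 : ∀ b a c : ℤ, ∃ f : LaurentSeries k, ∀ i, f.coeff i = u ⟨i, c, a, b⟩ := by
    intro b a c
    refine ⟨HahnSeries.ofSuppBddBelow (fun i => u ⟨i, c, a, b⟩) ((h4 b a c).mono ?_), fun i => rfl⟩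
    intro i hi
    exact ⟨⟨i, c, a, b⟩, ⟨hi, rfl, rfl, rfl⟩, rfl⟩
  choose f hf using f1
  have g1 : ∀ b a : ℤ, ∃ g : K k, ∀ c, g.coeff c = f b a c := by
    intro b a
    refine ⟨HahnSeries.ofSuppBddBelow (fun c => f b a c) ((h3 b a).mono ?_), fun i => rfl⟩
    intro c hc
    obtain ⟨i, hi⟩ : ∃ i, (f b a c).coeff i ≠ 0 := by
      by_contra! h
      exact hc (HahnSeries.ext (funext h))
    exact ⟨⟨i, c, a, b⟩, ⟨by rwa [Function.mem_support, ← hf], rfl, rfl⟩, rfl⟩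
  choose g hg using g1
  have q1 : ∀ b : ℤ, ∃ q : Q k, ∀ a, q.coeff a = g b a := by
    intro b
    obtain ⟨N, hN⟩ := h2 b
    refine ⟨⟨g b, N, fun a ha => ?_⟩, fun a => rfl⟩
    ext c i
    rw [hg, hf]
    by_contra hu
    have := hN ⟨⟨i, c, a, b⟩, ⟨hu, rfl⟩, rfl⟩
    simp only at this
    omega
  choose q hq using q1
  obtain ⟨N, hN⟩ := h1
  refine ⟨⟨q, N, fun b hb => ?_⟩, fun e => ?_⟩
  · ext a c i
    rw [hq, hg, hf]
    by_contra hu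
    have := hN ⟨⟨i, c, a, b⟩, hu, rfl⟩
    simp only at this
    omega
  · change (((q e.j₂).coeff e.j₁).coeff e.i₂).coeff e.i₁ = _
    rw [hq, hg, hf]

/-- A set of exponents that meets all supports in finite sets is the reflection of a support. -/
theorem isSupport_of_finite_inter {Z : Set Expo} (h : ∀ E ⊆ Z, IsSupport E → E.Finite) :
    IsSupport {e | (⟨-1 - e.i₁, -1 - e.i₂, -1 - e.j₁, -1 - e.j₂⟩ : Expo) ∈ Z} := by
  -- Choose `E ⊆ Y` with one point over each nonpositive value of `f` on `Y`. If such an `E` is a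
  -- support, it is finite by hypothesis, so `f` takes finitely many nonpositive values.
  have key : ∀ (Y : Set Expo) (f : Expo → ℤ), Y ⊆ Z →
      (∀ E ⊆ Y, Set.InjOn f E → (∀ e ∈ E, f e ≤ 0) → IsSupport E) → BddBelow (f '' Y) := by
    intro Y f hY hE
    by_contra hb
    obtain ⟨E, hE1, hE2⟩ := (Set.surjOn_image f {e ∈ Y | f e ≤ 0}).exists_bijOn_subset
    have hfin := h E (fun e he => hY (hE1 he).1)
      (hE E (fun e he => (hE1 he).1) hE2.injOn fun e he => (hE1 he).2)
    have := hfin.image f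
    rw [hE2.image_eq] at this
    obtain ⟨N, hN⟩ := this.bddBelow
    refine hb ⟨min N 0, ?_⟩
    rintro _ ⟨e, he, rfl⟩
    by_cases h0 : f e ≤ 0
    · exact (min_le_left _ _).trans (hN ⟨e, ⟨he, h0⟩, rfl⟩)
    · exact (min_le_right _ _).trans (le_of_lt (not_le.1 h0))
  have sub : ∀ (S : Set Expo) (f : Expo → ℤ), S.Subsingleton →
      BddAbove (f '' S) ∧ BddBelow (f '' S) := fun S f hS =>
    ⟨(hS.finite.image f).bddAbove, (hS.finite.image f).bddBelow⟩
  -- Each clause applies `key` to one exponent with the outer ones fixed. Injectivity on `E` makes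
  -- the slices by the inner exponents subsingletons, so their bounds are automatic. The reflection
  -- `e ↦ -1 - e` exchanges upper and lower bounds, which is why `key` is applied to `j₂`, `j₁` but
  -- to `-i₂`, `-i₁`.
  refine ⟨?_, fun b => ?_, fun b a => ?_, fun b a c => ?_⟩
  · obtain ⟨N, hN⟩ := key Z Expo.j₂ subset_rfl fun E hE hinj h0 => by
      refine ⟨⟨0, ?_⟩, fun b => (sub _ _ ?_).1, fun b a => (sub _ _ ?_).2,
        fun b a c => (sub _ _ ?_).2⟩
      · rintro _ ⟨e, he, rfl⟩
        exact h0 e he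
      all_goals
        intro e he e' he'
        exact hinj he.1 he'.1 (by grind)
    refine ⟨-1 - N, ?_⟩
    rintro _ ⟨e, he, rfl⟩
    have := hN ⟨_, he, rfl⟩
    simp only at this
    omega
  · obtain ⟨N, hN⟩ := key {e ∈ Z | e.j₂ = -1 - b} Expo.j₁ (Set.sep_subset _ _)
      fun E hE hinj h0 => by
      refine ⟨⟨-1 - b, ?_⟩, fun b => ⟨0, ?_⟩, fun b a => (sub _ _ ?_).2,
        fun b a c => (sub _ _ ?_).2⟩
      · rintro _ ⟨e, he, rfl⟩
        exact (hE he).2.le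
      · rintro _ ⟨e, he, rfl⟩
        exact h0 e he.1
      all_goals
        intro e he e' he'
        exact hinj he.1 he'.1 (by grind)
    refine ⟨-1 - N, ?_⟩
    rintro _ ⟨e, ⟨he, rfl⟩, rfl⟩
    have := hN ⟨_, ⟨he, rfl⟩, rfl⟩
    simp only at this
    omega
  · obtain ⟨N, hN⟩ := key {e ∈ Z | e.j₂ = -1 - b ∧ e.j₁ = -1 - a} (fun e => -e.i₂)
      (Set.sep_subset _ _) fun E hE hinj h0 => by
      refine ⟨⟨-1 - b, ?_⟩, fun b => ⟨-1 - a, ?_⟩, fun b a => ⟨0, ?_⟩,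
        fun b a c => (sub _ _ ?_).2⟩
      · rintro _ ⟨e, he, rfl⟩
        exact (hE he).2.1.le
      · rintro _ ⟨e, he, rfl⟩
        exact (hE he.1).2.2.le
      · rintro _ ⟨e, he, rfl⟩
        have := h0 e he.1
        omega
      all_goals
        intro e he e' he'
        exact hinj he.1 he'.1 (by grind)
    refine ⟨-1 + N, ?_⟩
    rintro _ ⟨e, ⟨he, rfl, rfl⟩, rfl⟩
    have := hN ⟨_, ⟨he, rfl, rfl⟩, rfl⟩
    simp only at this
    omega
  · obtain ⟨N, hN⟩ := key {e ∈ Z | e.j₂ = -1 - b ∧ e.j₁ = -1 - a ∧ e.i₂ = -1 - c}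
      (fun e => -e.i₁) (Set.sep_subset _ _) fun E hE hinj h0 => by
      refine ⟨⟨-1 - b, ?_⟩, fun b => ⟨-1 - a, ?_⟩, fun b a => ⟨-1 - c, ?_⟩, fun b a c => ⟨0, ?_⟩⟩
      · rintro _ ⟨e, he, rfl⟩
        exact (hE he).2.1.le
      · rintro _ ⟨e, he, rfl⟩
        exact (hE he.1).2.2.1.le
      · rintro _ ⟨e, he, rfl⟩
        exact (hE he.1).2.2.2.ge
      · rintro _ ⟨e, he, rfl⟩
        have := h0 e he.1
        omega
    refine ⟨-1 + N, ?_⟩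
    rintro _ ⟨e, ⟨he, rfl, rfl, rfl⟩, rfl⟩
    have := hN ⟨_, ⟨he, rfl, rfl, rfl⟩, rfl⟩
    simp only at this
    omega

/-- The operator with prescribed residue pairings with all monomials. -/
theorem exists_res_mono_mul {a : Expo → k} (h : ∀ M : P k, {e | a e * P.entry M e ≠ 0}.Finite) :
    ∃ U : P k, ∀ e, res (P.mono k e * U) = a e := by
  classical
  have hs : IsSupport (Function.support fun e : Expo =>
      a ⟨-1 - e.i₁, -1 - e.i₂, -1 - e.j₁, -1 - e.j₂⟩) := by
    refine isSupport_of_finite_inter (Z := Function.support a) fun E hE hEs => ?_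
    -- The hypothesis is tested on the operator all of whose coefficients on `E` are `1`.
    have hu : Function.support (fun e => if e ∈ E then (1 : k) else 0) = E := by
      ext e
      simp
    obtain ⟨M, hM⟩ := IsSupport.exists_entry_eq (u := fun e => if e ∈ E then (1 : k) else 0)
      (by rwa [hu])
    refine (h M).subset fun e he => ?_
    rw [Set.mem_ofPred_eq, hM, if_pos he, mul_one]
    exact hE he
  obtain ⟨M, hM⟩ := hs.exists_entry_eq
  obtain ⟨N, hN⟩ := M.bdd
  have hz : ∀ n, N < n → PseudoDiff.ofRight (d₁ k) (M.coeff n).coeff (M.coeff n).bdd = 0 :=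
    fun n hn => PseudoDiff.ofRight_zero _ _ fun m => by rw [hN n hn, PseudoDiff.coeff_zero]
  -- The entries of `M` are placed to the right of `∂₁` and `∂₂`, so that pairing with a monomial
  -- reads off the single reflected entry, without Leibniz corrections.
  refine ⟨PseudoDiff.ofRight (d₂Q k)
    (fun n => PseudoDiff.ofRight (d₁ k) (M.coeff n).coeff (M.coeff n).bdd) ⟨N, hz⟩, fun e => ?_⟩
  change resQ ((P.mono k e * _).coeff (-1)) = _
  unfold P.mono
  rw [PseudoDiff.coeff_single_mul_ofRight]
  change resK ((PseudoDiff.single _ _ * _).coeff (-1)) = _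
  rw [PseudoDiff.coeff_single_mul_ofRight]
  change HahnSeries.coeff (HahnSeries.coeff _ _) _ = _
  rw [HahnSeries.coeff_single_mul, HahnSeries.coeff_single_mul, one_mul]
  refine (hM ⟨-1 - e.i₁, -1 - e.i₂, -1 - e.j₁, -1 - e.j₂⟩).trans ?_
  simp

/-- The residue pairing with a fixed operator is given by its values on monomials. -/
theorem res_mul_eq_finsum (M U : P k) :
    {e | P.entry M e * res (P.mono k e * U) ≠ 0}.Finite ∧
      res (M * U) = ∑ᶠ e, P.entry M e * res (P.mono k e * U) := by
  have h := hasSum_entry ((sumP k).mul (hasSum_mono M) ((sumP k).unit U)) ⟨-1, -1, -1, -1⟩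
  have e1 : ∀ p : Expo × Unit,
      P.entry (P.entry M p.1 • P.mono k p.1 * U) ⟨-1, -1, -1, -1⟩ =
      P.entry M p.1 * res (P.mono k p.1 * U) := by
    intro p
    rw [smul_mul_assoc]
    rfl
  simp only [e1] at h
  refine ⟨(h.1.image Prod.fst).subset fun e he => ⟨(e, ()), he, rfl⟩, ?_⟩
  refine h.2.trans ?_
  exact finsum_comp_equiv (Equiv.prodPUnit Expo) (f := fun e =>
    P.entry M e * res (P.mono k e * U))

end

/-! ### Monomials in the coefficients and their derivatives -/

section

/-- The index of a coefficient of a pair of operators. -/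
abbrev Var : Type := Fin 2 × Expo

section Monomials

variable {R R' : Type*} [CommRing R] [CommRing R']

/-- The value of a monomial at a point with coordinates in a ring. -/
def monoAt (μ : Var →₀ ℕ) (x : Var → R) : R := μ.prod fun v e => x v ^ e

/-- The derivative of a monomial at the point `x` in the direction `z`. -/
noncomputable def dmonoAt (μ : Var →₀ ℕ) (x z : Var → R) : R :=
  ∑ v ∈ μ.support, (μ v : R) * monoAt (μ - Finsupp.single v 1) x * z v

theorem map_monoAt (φ : R →+* R') (μ : Var →₀ ℕ) (x : Var → R) :
    φ (monoAt μ x) = monoAt μ fun v => φ (x v) := by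
  simp only [monoAt, map_finsuppProd, map_pow]

theorem map_dmonoAt (φ : R →+* R') (μ : Var →₀ ℕ) (x z : Var → R) :
    φ (dmonoAt μ x z) = dmonoAt μ (fun v => φ (x v)) fun v => φ (z v) := by
  simp only [dmonoAt, map_sum, map_mul, map_natCast, map_monoAt]

theorem RingDeriv.map_prod [DecidableEq Var] (δ : RingDeriv R) (s : Finset Var) (f : Var → R) :
    δ (∏ v ∈ s, f v) = ∑ v ∈ s, (∏ w ∈ s.erase v, f w) * δ (f v) := by
  induction s using Finset.induction_on with
  | empty => simpa using δ.map_one'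
  | insert a s ha ih =>
    rw [Finset.prod_insert ha, RingDeriv.leibniz, ih, Finset.sum_insert ha, Finset.erase_insert ha,
      mul_comm, Finset.mul_sum]
    congr 1
    refine Finset.sum_congr rfl fun v hv => ?_
    have hva : a ≠ v := fun h => ha (h ▸ hv)
    rw [Finset.erase_insert_of_ne hva, Finset.prod_insert fun h => ha (Finset.mem_of_mem_erase h),
      mul_assoc]

theorem RingDeriv.map_pow' (δ : RingDeriv R) (a : R) (n : ℕ) :
    δ (a ^ n) = n * a ^ (n - 1) * δ a := by
  induction n with
  | zero => simpa using δ.map_one'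
  | succ n ih =>
    rw [pow_succ, RingDeriv.leibniz, ih]
    rcases n with _ | n
    · simp
    · rw [Nat.add_sub_cancel, Nat.add_sub_cancel]
      push_cast
      ring

theorem monoAt_sub_single [DecidableEq Var] (μ : Var →₀ ℕ) (x : Var → R) {v : Var}
    (hv : v ∈ μ.support) : monoAt (μ - Finsupp.single v 1) x =
      (∏ w ∈ μ.support.erase v, x w ^ μ w) * x v ^ (μ v - 1) := by
  unfold monoAt
  rw [Finsupp.prod_of_support_subset (s := μ.support) _ Finsupp.support_tsub _ fun _ _ => pow_zero _,
    ← Finset.prod_erase_mul _ _ hv]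
  congr 1
  · refine Finset.prod_congr rfl fun w hw => ?_
    rw [Finsupp.tsub_apply, Finsupp.single_eq_of_ne (Finset.ne_of_mem_erase hw), tsub_zero]
  · rw [Finsupp.tsub_apply, Finsupp.single_eq_same]

theorem RingDeriv.map_monoAt (δ : RingDeriv R) (μ : Var →₀ ℕ) (x : Var → R) :
    δ (monoAt μ x) = dmonoAt μ x fun v => δ (x v) := by
  classical
  unfold monoAt Finsupp.prod
  rw [RingDeriv.map_prod]
  refine Finset.sum_congr rfl fun v hv => ?_
  rw [RingDeriv.map_pow', monoAt_sub_single μ x hv]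
  ring

end Monomials

variable {k : Type*} [Field k]

/-- The coefficients of a pair of operators. -/
noncomputable def coord (L : P2 k) (v : Var) : k := P.entry (L v.1) v.2

theorem coord_add (L M : P2 k) (v : Var) : coord (L + M) v = coord L v + coord M v := rfl

theorem coord_smul (c : k) (L : P2 k) (v : Var) : coord (c • L) v = c * coord L v := rfl

theorem coord_sum {ι : Type*} (s : Finset ι) (L : ι → P2 k) (v : Var) :
    coord (∑ i ∈ s, L i) v = ∑ i ∈ s, coord (L i) v := by
  unfold coord
  rw [Finset.sum_apply]
  exact map_sum (entryL v.2) _ _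

theorem coord_injective : Function.Injective (coord : P2 k → Var → k) := fun _ _ h =>
  funext fun i => P.entry_ext fun e => congrFun h (i, e)

theorem monomialValue_eq (μ : Var →₀ ℕ) (L : P2 k) : monomialValue μ L = monoAt μ (coord L) := rfl

/-! ### Finiteness of functionals at points over `k`-algebras -/

section Points

variable {R R' : Type*} [CommRing R] [Algebra k R] [CommRing R'] [Algebra k R']

variable (k R) in
/-- The points of `P²` with coordinates in `R`: the linear combinations of pairs of operators with
coefficients in `R`. -/
noncomputable def points : Submodule R (Var → R) :=
  Submodule.span R (Set.range fun (L : P2 k) v => algebraMap k R (coord L v))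

theorem coord_mem_points (L : P2 k) : (fun v => algebraMap k R (coord L v)) ∈ points k R :=
  Submodule.subset_span ⟨L, rfl⟩

theorem map_mem_points (φ : R →ₐ[k] R') {x : Var → R} (hx : x ∈ points k R) :
    (fun v => φ (x v)) ∈ points k R' := by
  induction hx using Submodule.span_induction with
  | mem x h =>
    obtain ⟨L, rfl⟩ := h
    simpa using coord_mem_points L
  | zero =>
    simp only [Pi.zero_apply, map_zero]
    exact (points k R').zero_mem
  | add x y _ _ hx hy =>
    simp only [Pi.add_apply, map_add]
    exact (points k R').add_mem hx hy
  | smul c x _ hx =>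
    simp only [Pi.smul_apply, smul_eq_mul, map_mul]
    exact (points k R').smul_mem (φ c) hx

/-- Only finitely many terms of a functional are nonzero at a point with coordinates in a ring. -/
theorem finite_monoAt_ne_zero [CharZero k] {c : (Var →₀ ℕ) → k} {D : ℕ} (hD : ∀ μ, c μ ≠ 0 → μ.degree ≤ D)
    (hc : ∀ L, (Function.support fun μ => c μ * monomialValue μ L).Finite) {x : Var → R}
    (hx : x ∈ points k R) : {μ | c μ ≠ 0 ∧ monoAt μ x ≠ 0}.Finite := by
  classical
  obtain ⟨r, rfl⟩ := Finsupp.mem_span_range_iff_exists_finsupp.1 hx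
  let ι := r.support
  -- The generic linear combination of the finitely many pairs that span `x`; both `x` and ordinary
  -- points of `P²` are specializations of it.
  let y : Var → MvPolynomial ι k := fun v => ∑ i : ι, MvPolynomial.C (coord (i : P2 k) v) *
    MvPolynomial.X i
  have heval : ∀ (t : ι → k) (μ : Var →₀ ℕ), MvPolynomial.eval t (monoAt μ y) =
      monomialValue μ (∑ i : ι, t i • (i : P2 k)) := by
    intro t μ
    rw [map_monoAt, monomialValue_eq]
    congr 1
    funext v
    simp only [y, map_sum, map_mul, MvPolynomial.eval_C, MvPolynomial.eval_X, coord_sum, coord_smul,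
      mul_comm]
  have hval : ∀ μ : Var →₀ ℕ, MvPolynomial.aeval (fun i : ι => r i) (monoAt μ y) =
      monoAt μ (r.sum fun i a => a • fun v => algebraMap k R (coord i v)) := by
    intro μ
    rw [← AlgHom.coe_toRingHom, map_monoAt]
    congr 1
    funext v
    simp only [y, Finsupp.sum, Finset.sum_apply, Pi.smul_apply, smul_eq_mul,
      AlgHom.coe_toRingHom, map_sum, map_mul, MvPolynomial.aeval_X, MvPolynomial.algHom_C]
    rw [← Finset.sum_coe_sort r.support]
    exact Finset.sum_congr rfl fun i _ => mul_comm _ _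
  have hdeg : ∀ μ : Var →₀ ℕ, (monoAt μ y).totalDegree ≤ μ.degree := by
    intro μ
    have h1 : ∀ v, (y v).totalDegree ≤ 1 := fun v =>
      MvPolynomial.totalDegree_finsetSum_le fun i _ =>
        (MvPolynomial.totalDegree_mul _ _).trans (by simp)
    refine (MvPolynomial.totalDegree_finsetProd _ _).trans ?_
    rw [Finsupp.degree_apply]
    exact Finset.sum_le_sum fun v _ => (MvPolynomial.totalDegree_pow _ _).trans
      ((Nat.mul_le_mul_left _ (h1 v)).trans (mul_one _).le)
  -- A nonzero polynomial of degree at most `D` in each variable has a nonzero value on a grid with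
  -- `D + 1` nodes per variable. The nodes `0, …, D` are distinct in characteristic zero, and each
  -- of the finitely many grid points sees finitely many monomials.
  let G : Finset k := (Finset.range (D + 1)).image Nat.cast
  have hG : G.card = D + 1 := by
    rw [Finset.card_image_of_injective _ Nat.cast_injective, Finset.card_range]
  refine ((Fintype.piFinset fun _ : ι => G).finite_toSet.biUnion fun t _ =>
    hc (∑ i : ι, t i • (i : P2 k))).subset ?_
  rintro μ ⟨h1, h2⟩
  have h3 : monoAt μ y ≠ 0 := fun h => h2 (by
    have := hval μ
    rw [h, map_zero] at this
    exact this.symm)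
  have h4 : ∃ t : ι → k, (∀ i, t i ∈ G) ∧ MvPolynomial.eval t (monoAt μ y) ≠ 0 := by
    by_contra! h5
    refine h3 (MvPolynomial.eq_zero_of_eval_zero_at_prod_finset _ (fun _ => G) (fun i => ?_) h5)
    rw [hG, Nat.lt_succ_iff]
    exact (MvPolynomial.degreeOf_le_totalDegree _ _).trans ((hdeg μ).trans (hD μ h1))
  obtain ⟨t, ht, h5⟩ := h4
  rw [heval] at h5
  exact Set.mem_biUnion (x := t) (by simpa using ht) (mul_ne_zero h1 h5)

/-- The line through `x` in the direction `z`. -/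
noncomputable def line (x z : Var → R) (v : Var) : Polynomial R :=
  Polynomial.C (x v) + Polynomial.X * Polynomial.C (z v)

theorem line_mem_points {x z : Var → R} (hx : x ∈ points k R) (hz : z ∈ points k R) :
    line x z ∈ points k (Polynomial R) :=
  (points k (Polynomial R)).add_mem (map_mem_points Polynomial.CAlgHom hx)
    ((points k (Polynomial R)).smul_mem Polynomial.X (map_mem_points Polynomial.CAlgHom hz))

/-- The derivative of polynomials as a derivation. -/
noncomputable def polyDeriv (R : Type*) [Ring R] : RingDeriv (Polynomial R) where
  toFun p := Polynomial.derivative p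
  map_zero' := map_zero _
  map_add' := map_add _
  leibniz' _ _ := Polynomial.derivative_mul

theorem derivative_monoAt_line (μ : Var →₀ ℕ) (x z : Var → R) :
    (Polynomial.derivative (monoAt μ (line x z))).eval 0 = dmonoAt μ x z := by
  change (polyDeriv R (monoAt μ (line x z))).eval 0 = _
  rw [RingDeriv.map_monoAt, ← Polynomial.coe_evalRingHom, map_dmonoAt]
  congr 1 <;> funext v
  · simp [line]
  · change (Polynomial.derivative (line x z v)).eval 0 = _
    simp [line]

/-- The directional derivative is read off from the monomial on the line `x + Xz`, a point over
`R[X]`; finiteness there suffices. -/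
theorem finite_dmonoAt_ne_zero [CharZero k] {c : (Var →₀ ℕ) → k} {D : ℕ} (hD : ∀ μ, c μ ≠ 0 → μ.degree ≤ D)
    (hc : ∀ L, (Function.support fun μ => c μ * monomialValue μ L).Finite) {x z : Var → R}
    (hx : x ∈ points k R) (hz : z ∈ points k R) :
    {μ | c μ ≠ 0 ∧ dmonoAt μ x z ≠ 0}.Finite := by
  refine (finite_monoAt_ne_zero hD hc (line_mem_points hx hz)).subset ?_
  rintro μ ⟨h1, h2⟩
  refine ⟨h1, fun h => h2 ?_⟩
  rw [← derivative_monoAt_line, h, Polynomial.derivative_zero, Polynomial.eval_zero]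

end Points

/-! ### Existence and uniqueness of gradients -/

section Derivative

theorem coord_mem_points' (L : P2 k) : coord L ∈ points k k := coord_mem_points (R := k) L

/-- The directional derivative of a functional. -/
theorem hasDirDeriv_of_rep [CharZero k] {F : P2 k → k} {c : (Var →₀ ℕ) → k} {D : ℕ}
    (hD : ∀ μ, c μ ≠ 0 → μ.degree ≤ D)
    (hc : ∀ L, (Function.support fun μ => c μ * monomialValue μ L).Finite ∧
      F L = ∑ᶠ μ, c μ * monomialValue μ L) (L M : P2 k) :
    HasDirDeriv F L M (∑ᶠ μ, c μ * dmonoAt μ (coord L) (coord M)) := by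
  have hl : line (coord L) (coord M) ∈ points k (Polynomial k) :=
    line_mem_points (coord_mem_points' L) (coord_mem_points' M)
  have hfin := finite_monoAt_ne_zero hD (fun L => (hc L).1) hl
  refine ⟨∑ μ ∈ hfin.toFinset, Polynomial.C (c μ) * monoAt μ (line (coord L) (coord M)),
    fun ε => ?_, ?_⟩
  · have key : ∀ μ, monomialValue μ (L + ε • M) =
        (monoAt μ (line (coord L) (coord M))).eval ε := by
      intro μ
      rw [← Polynomial.coe_evalRingHom, map_monoAt, monomialValue_eq]
      congr 1
      funext v
      simp only [line, coord_add, coord_smul, Polynomial.coe_evalRingHom, Polynomial.eval_add,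
        Polynomial.eval_mul, Polynomial.eval_C, Polynomial.eval_X]
    rw [(hc _).2, finsum_eq_sum_of_support_subset (s := hfin.toFinset), Polynomial.eval_finsetSum]
    · simp only [key, Polynomial.eval_mul, Polynomial.eval_C]
    · intro μ hμ
      rw [Function.mem_support, key] at hμ
      rw [Set.Finite.coe_toFinset]
      exact ⟨left_ne_zero_of_mul hμ, fun h => right_ne_zero_of_mul hμ (by rw [h, Polynomial.eval_zero])⟩
  · rw [Polynomial.derivative_sum, Polynomial.eval_finsetSum,
      finsum_eq_sum_of_support_subset (s := hfin.toFinset)]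
    · simp only [Polynomial.derivative_C_mul, Polynomial.eval_mul, Polynomial.eval_C,
        derivative_monoAt_line]
    · intro μ hμ
      rw [Function.mem_support, ← derivative_monoAt_line] at hμ
      rw [Set.Finite.coe_toFinset]
      exact ⟨left_ne_zero_of_mul hμ, fun h => right_ne_zero_of_mul hμ (by
        rw [h, Polynomial.derivative_zero, Polynomial.eval_zero])⟩

/-- In characteristic zero the field is infinite, so the values determine the polynomial. -/
theorem HasDirDeriv.unique [CharZero k] {F : P2 k → k} {L M : P2 k} {v w : k} (h1 : HasDirDeriv F L M v)
    (h2 : HasDirDeriv F L M w) : v = w := by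
  obtain ⟨p, hp, rfl⟩ := h1
  obtain ⟨q, hq, rfl⟩ := h2
  rw [Polynomial.funext fun ε => (hp ε).symm.trans (hq ε)]

theorem IsGradient.unique [CharZero k] {F : P2 k → k} {L U V : P2 k} (h1 : IsGradient F L U)
    (h2 : IsGradient F L V) : U = V := by
  have hp : ∀ M, pair M U = pair M V := fun M => (h1 M).unique (h2 M)
  funext i
  refine sub_eq_zero.1 (res_nondegenerate _ fun M => ?_)
  have h := hp (Pi.single i M)
  have key : ∀ W : P2 k, pair (Pi.single i M) W = res (M * W i) := by
    intro W
    unfold pair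
    rw [Finset.sum_eq_single i]
    · rw [Pi.single_eq_same]
    · intro j _ hj
      rw [Pi.single_eq_of_ne hj, zero_mul]
      rfl
    · simp
  rw [key, key] at h
  rw [mul_sub]
  exact (map_sub (resL (k := k)) _ _).trans (sub_eq_zero.2 h)

/-- A functional has a gradient at every point. -/
theorem exists_isGradient [CharZero k] {F : P2 k → k} (hF : F ∈ Functionals k) (L : P2 k) :
    ∃ U, IsGradient F L U := by
  classical
  obtain ⟨c, D, hD, hc⟩ := hF
  -- The contribution of the monomial `μ` to the partial derivative with respect to `v` at `L`.
  let b : (Var →₀ ℕ) → Var → k := fun μ v =>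
    c μ * ((μ v : k) * monoAt (μ - Finsupp.single v 1) (coord L))
  have hb0 : ∀ μ v, v ∉ μ.support → b μ v = 0 := by
    intro μ v hv
    simp [b, Finsupp.notMem_support_iff.1 hv]
  -- A coordinate `w` of `μ` that vanishes identically on the line has L_w = M_w = 0. It differs
  -- from `v`, since M_v ≠ 0, so it still divides the monomial left after differentiating by `v` and
  -- makes `b μ v` zero. Thus only the finitely many monomials that are nonzero on the line matter.
  have hline : ∀ M : P2 k, ∀ μ v, b μ v * coord M v ≠ 0 →
      c μ ≠ 0 ∧ monoAt μ (line (coord L) (coord M)) ≠ 0 := by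
    intro M μ v h
    have hb := left_ne_zero_of_mul h
    have hv : v ∈ μ.support := by
      by_contra hv
      exact hb (hb0 μ v hv)
    refine ⟨left_ne_zero_of_mul hb, Finset.prod_ne_zero_iff.2 fun w hw => pow_ne_zero _ ?_⟩
    intro h0
    have hLw : coord L w = 0 := by
      simpa [line] using congrArg (Polynomial.eval 0) h0
    have hMw : coord M w = 0 := by
      simpa [line, hLw] using congrArg (Polynomial.eval 1) h0
    have hwv : w ≠ v := fun e => right_ne_zero_of_mul h (e ▸ hMw)
    refine right_ne_zero_of_mul (right_ne_zero_of_mul hb) ?_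
    rw [monoAt_sub_single μ _ hv, Finset.prod_eq_zero (Finset.mem_erase.2 ⟨hwv, hw⟩), zero_mul]
    rw [hLw, zero_pow (Finsupp.mem_support_iff.1 hw)]
  have hfin : ∀ M : P2 k, {μ | c μ ≠ 0 ∧ monoAt μ (line (coord L) (coord M)) ≠ 0}.Finite :=
    fun M => finite_monoAt_ne_zero hD (fun L => (hc L).1)
      (line_mem_points (coord_mem_points' L) (coord_mem_points' M))
  let a : Var → k := fun v => ∑ᶠ μ, b μ v
  have ha : ∀ (M : P2 k) (v : Var),
      a v * coord M v = ∑ μ ∈ (hfin M).toFinset, b μ v * coord M v := by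
    intro M v
    by_cases h0 : coord M v = 0
    · simp [h0]
    · simp only [a]
      rw [finsum_eq_sum_of_support_subset (s := (hfin M).toFinset), Finset.sum_mul]
      intro μ hμ
      rw [Set.Finite.coe_toFinset]
      exact hline M μ v (mul_ne_zero hμ h0)
  have hsupp : ∀ M : P2 k, (fun v => a v * coord M v).support ⊆
      ((hfin M).toFinset.biUnion fun μ => μ.support : Finset Var) := by
    intro M v hv
    rw [Function.mem_support, ha] at hv
    obtain ⟨μ, hμ, h⟩ := Finset.exists_ne_zero_of_sum_ne_zero hv
    rw [Finset.mem_coe, Finset.mem_biUnion]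
    refine ⟨μ, hμ, ?_⟩
    by_contra h1
    exact h (by rw [hb0 μ v h1, zero_mul])
  -- For each fixed direction only finitely many products a_v M_v are nonzero, which is exactly what
  -- representability by an operator needs; directions with a single component separate the two
  -- values of `i`.
  have hU : ∀ i : Fin 2, ∃ U : P k, ∀ e, res (P.mono k e * U) = a (i, e) := by
    intro i
    refine exists_res_mono_mul fun M => ?_
    refine (((Finset.finite_toSet _).subset (hsupp (Pi.single i M))).preimage
      (f := fun e : Expo => ((i, e) : Var)) (fun e _ e' _ h => (Prod.mk.inj h).2)).subset ?_
    intro e he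
    simpa [coord] using he
  choose U hU using hU
  refine ⟨U, fun M => ?_⟩
  have h := hasDirDeriv_of_rep hD hc L M
  have e1 : ∑ᶠ μ, c μ * dmonoAt μ (coord L) (coord M) = pair M U := by
    have hd : ∀ μ, c μ * dmonoAt μ (coord L) (coord M) =
        ∑ᶠ v, b μ v * coord M v := by
      intro μ
      rw [finsum_eq_sum_of_support_subset (s := μ.support), dmonoAt, Finset.mul_sum]
      · exact Finset.sum_congr rfl fun v _ => by simp only [b]; ring
      · intro v hv
        by_contra h1
        exact hv (by simp [hb0 μ v h1])
    calc ∑ᶠ μ, c μ * dmonoAt μ (coord L) (coord M)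
        = ∑ μ ∈ (hfin M).toFinset, ∑ v ∈ (hfin M).toFinset.biUnion fun μ => μ.support,
            b μ v * coord M v := by
          simp only [hd]
          rw [finsum_eq_sum_of_support_subset (s := (hfin M).toFinset)]
          · refine Finset.sum_congr rfl fun μ hμ => ?_
            refine finsum_eq_sum_of_support_subset _ fun v hv => ?_
            rw [Finset.mem_coe, Finset.mem_biUnion]
            refine ⟨μ, hμ, ?_⟩
            by_contra h1
            exact hv (by simp [hb0 μ v h1])
          · intro μ hμ
            rw [Set.Finite.coe_toFinset]
            by_contra h1
            refine hμ (finsum_eq_zero_of_forall_eq_zero fun v => ?_)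
            by_contra h2
            exact h1 (hline M μ v h2)
      _ = ∑ᶠ v, a v * coord M v := by
          rw [Finset.sum_comm, finsum_eq_sum_of_support_subset _ (hsupp M)]
          simp only [ha]
      _ = ∑ i, ∑ᶠ e, a (i, e) * coord M (i, e) := by
          rw [finsum_curry _ ((Finset.finite_toSet _).subset (hsupp M)), finsum_eq_sum_of_fintype]
      _ = pair M U := by
          refine Finset.sum_congr rfl fun i _ => ?_
          rw [(res_mul_eq_finsum (M i) (U i)).2]
          exact finsum_congr fun e => by rw [hU, mul_comm]; rfl
  rwa [e1] at h

theorem existsUnique_isGradient [CharZero k] {F : P2 k → k} (hF : F ∈ Functionals k) (L : P2 k) :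
    ∃! U, IsGradient F L U := by
  obtain ⟨U, hU⟩ := exists_isGradient hF L
  exact ⟨U, hU, fun V hV => hV.unique hU⟩

theorem isGradient_grad [CharZero k] {F : P2 k → k} (hF : F ∈ Functionals k) (L : P2 k) :
    IsGradient F L (grad F L) :=
  Classical.epsilon_spec (exists_isGradient hF L)

theorem IsGradient.grad_eq [CharZero k] {F : P2 k → k} {L U : P2 k} (h : IsGradient F L U) : grad F L = U :=
  (Classical.epsilon_spec (p := IsGradient F L) ⟨U, h⟩).unique h

end Derivative

end

/-! ### The gradient and the Hamiltonian vector field of `H_m` -/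

section

section HamiltonianPolynomial

variable {A : Type*} [Ring A]

/-- The noncommutative polynomial `∑ binom(m, a) x₀ᵃ x₁ᵇ`. -/
def binomSum (m : ℕ) (x : Fin 2 → A) : A :=
  ∑ p ∈ Finset.HasAntidiagonal.antidiagonal m, m.choose p.1 • (x 0 ^ p.1 * x 1 ^ p.2)

/-- The cyclic derivative of `binomSum`. -/
def binomGrad (m : ℕ) (x : Fin 2 → A) : Fin 2 → A :=
  ![∑ p ∈ Finset.HasAntidiagonal.antidiagonal m, m.choose p.1 •
      ∑ s ∈ Finset.range p.1, x 0 ^ (p.1 - 1 - s) * x 1 ^ p.2 * x 0 ^ s,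
    ∑ p ∈ Finset.HasAntidiagonal.antidiagonal m, m.choose p.1 •
      ∑ s ∈ Finset.range p.2, x 1 ^ (p.2 - 1 - s) * x 0 ^ p.1 * x 1 ^ s]

theorem binomGrad_zero (m : ℕ) (x : Fin 2 → A) : binomGrad m x 0 =
    ∑ p ∈ Finset.HasAntidiagonal.antidiagonal m, m.choose p.1 •
      ∑ s ∈ Finset.range p.1, x 0 ^ (p.1 - 1 - s) * x 1 ^ p.2 * x 0 ^ s := rfl

theorem binomGrad_one (m : ℕ) (x : Fin 2 → A) : binomGrad m x 1 =
    ∑ p ∈ Finset.HasAntidiagonal.antidiagonal m, m.choose p.1 •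
      ∑ s ∈ Finset.range p.2, x 1 ^ (p.2 - 1 - s) * x 0 ^ p.1 * x 1 ^ s := rfl

theorem map_binomSum {B : Type*} [Ring B] (φ : A →+* B) (m : ℕ) (x : Fin 2 → A) :
    φ (binomSum m x) = binomSum m fun i => φ (x i) := by
  simp only [binomSum, map_sum, map_nsmul, map_mul, map_pow]

theorem map_binomGrad {B : Type*} [Ring B] (φ : A →+* B) (m : ℕ) (x : Fin 2 → A) (i : Fin 2) :
    φ (binomGrad m x i) = binomGrad m (fun i => φ (x i)) i := by
  fin_cases i
  · simp only [Fin.zero_eta, binomGrad_zero, map_sum, map_nsmul, map_mul, map_pow]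
  · simp only [Fin.mk_one, binomGrad_one, map_sum, map_nsmul, map_mul, map_pow]

/-- For commuting variables the cyclic derivative is the ordinary partial derivative of (x₀ + x₁)^m.
Termwise this is a binom(m, a) = m binom(m-1, a-1), and its mirror image for the second variable. -/
theorem binomGrad_of_commute {m : ℕ} (hm : m ≠ 0) {x : Fin 2 → A} (h : Commute (x 0) (x 1))
    (i : Fin 2) : binomGrad m x i = m • (x 0 + x 1) ^ (m - 1) := by
  obtain ⟨n, rfl⟩ := Nat.exists_eq_succ_of_ne_zero hm
  have h0 : ∀ (y z : A), Commute y z → ∀ a b : ℕ,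
      ∑ s ∈ Finset.range a, y ^ (a - 1 - s) * z ^ b * y ^ s = a • (y ^ (a - 1) * z ^ b) := by
    intro y z hyz a b
    rw [← Finset.card_range a, ← Finset.sum_const, Finset.card_range]
    refine Finset.sum_congr rfl fun s hs => ?_
    rw [Finset.mem_range] at hs
    rw [mul_assoc, ((hyz.pow_pow s b).eq).symm, ← mul_assoc, ← pow_add]
    congr 2
    omega
  rw [Nat.succ_sub_one, h.add_pow', Finset.smul_sum]
  fin_cases i
  · rw [Fin.zero_eta, binomGrad_zero, Finset.Nat.antidiagonal_succ, Finset.sum_cons,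
      Finset.sum_map]
    simp only [Finset.range_zero, Finset.sum_empty, smul_zero, zero_add]
    refine Finset.sum_congr rfl fun p _ => ?_
    simp only [Function.Embedding.coe_prodMap, Function.Embedding.coeFn_mk,
      Function.Embedding.refl_apply, Prod.map_fst, Prod.map_snd]
    rw [h0 _ _ h, smul_smul, smul_smul, Nat.succ_sub_one]
    congr 1
    exact (Nat.add_one_mul_choose_eq n p.1).symm
  · rw [Fin.mk_one, binomGrad_one, Finset.Nat.antidiagonal_succ', Finset.sum_cons,
      Finset.sum_map]
    simp only [Finset.range_zero, Finset.sum_empty, smul_zero, zero_add]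
    refine Finset.sum_congr rfl fun p hp => ?_
    rw [Finset.HasAntidiagonal.mem_antidiagonal] at hp
    simp only [Function.Embedding.coe_prodMap, Function.Embedding.coeFn_mk,
      Function.Embedding.refl_apply, Prod.map_fst, Prod.map_snd]
    rw [h0 _ _ h.symm, smul_smul, smul_smul, Nat.succ_sub_one, (h.pow_pow _ _).eq]
    congr 1
    have := Nat.choose_mul_succ_eq n p.1
    rw [show n + 1 - p.1 = p.2 + 1 by omega] at this
    rw [Nat.succ_eq_add_one, Nat.succ_eq_add_one, ← this, mul_comm]

theorem RingDeriv.map_pow (δ : RingDeriv A) (a : A) (n : ℕ) :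
    δ (a ^ n) = ∑ s ∈ Finset.range n, a ^ s * δ a * a ^ (n - 1 - s) := by
  induction n with
  | zero => simpa using δ.map_one'
  | succ n ih =>
    rw [pow_succ, RingDeriv.leibniz, ih, Finset.sum_range_succ, Finset.sum_mul]
    congr 1
    · refine Finset.sum_congr rfl fun s hs => ?_
      rw [Finset.mem_range] at hs
      rw [mul_assoc, ← pow_succ]
      congr 2
      omega
    · simp

/-- The derivative of the trace of `binomSum` is given by its cyclic derivative. -/
theorem trace_deriv_binomSum {B : Type*} [AddCommGroup B] (τ : A →+ B)
    (hτ : ∀ a b, τ (a * b) = τ (b * a)) (δ : RingDeriv A) (m : ℕ) (x : Fin 2 → A) :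
    τ (δ (binomSum m x)) = ∑ i, τ (δ (x i) * binomGrad m x i) := by
  rw [Fin.sum_univ_two, binomGrad_zero, binomGrad_one, binomSum]
  simp only [Finset.mul_sum, mul_smul_comm, map_sum, map_nsmul]
  rw [← Finset.sum_add_distrib]
  refine Finset.sum_congr rfl fun p _ => ?_
  rw [RingDeriv.leibniz, map_add, smul_add, RingDeriv.map_pow, RingDeriv.map_pow, Finset.sum_mul,
    Finset.mul_sum, map_sum, map_sum]
  congr 2
  · refine Finset.sum_congr rfl fun s _ => ?_
    rw [mul_assoc, mul_assoc, hτ]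
    simp only [mul_assoc]
  · refine Finset.sum_congr rfl fun s _ => ?_
    rw [← mul_assoc, ← mul_assoc, mul_assoc, hτ]
    simp only [mul_assoc]

/-- Two derivations that agree on `x₀, x₁` agree on `binomSum`. -/
theorem RingDeriv.binomSum_congr (δ δ' : RingDeriv A) (m : ℕ) {x : Fin 2 → A}
    (h : ∀ i, δ (x i) = δ' (x i)) : δ (binomSum m x) = δ' (binomSum m x) := by
  simp only [binomSum, map_sum, map_nsmul, RingDeriv.leibniz, RingDeriv.map_pow, h]

/-- The inner derivation `[a, ·]`. -/
def innerDeriv (a : A) : RingDeriv A where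
  toFun b := ⁅a, b⁆
  map_zero' := by
    simp only [Ring.lie_def, mul_zero, zero_mul, sub_zero]
  map_add' b c := by
    simp only [Ring.lie_def]
    noncomm_ring
  leibniz' b c := by
    simp only [Ring.lie_def]
    noncomm_ring

end HamiltonianPolynomial

section VectorField

variable (k : Type*) [Field k] {A : Type*} [Ring A] [Algebra k A]

/-- The gradient of `H_m`, as a noncommutative polynomial. -/
def gradH (m : ℕ) (x : Fin 2 → A) (i : Fin 2) : A := (1 / (m : k)) • binomGrad m x i

/-- The Hamiltonian vector field of `H_m`, for a splitting of the ring given by the projection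
`π`. -/
def vecField (π : A →+ A) (m : ℕ) (x : Fin 2 → A) (i : Fin 2) : A :=
  (⁅π (gradH k m x i), x i⁆ - π ⁅π (gradH k m x i), x i⁆) -
    π ⁅gradH k m x i - π (gradH k m x i), x i⁆

variable {k}

/-- Naturality allows one formula to serve for operators and for polynomials and power series in the
times, and to be compared under evaluation and expansion. -/
theorem map_vecField {B : Type*} [Ring B] [Algebra k B] (φ : A →+* B)
    (hφ : ∀ (c : k) a, φ (c • a) = c • φ a) {π : A →+ A} {π' : B →+ B}
    (hπ : ∀ a, φ (π a) = π' (φ a)) (m : ℕ) (x : Fin 2 → A) (i : Fin 2) :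
    φ (vecField k π m x i) = vecField k π' m (fun i => φ (x i)) i := by
  simp only [vecField, gradH, map_sub, Ring.lie_def, map_mul, hπ, hφ, map_binomGrad]

theorem gradH_of_commute [CharZero k] {m : ℕ} (hm : m ≠ 0) {x : Fin 2 → A}
    (h : Commute (x 0) (x 1)) (i : Fin 2) : gradH k m x i = (x 0 + x 1) ^ (m - 1) := by
  rw [gradH, binomGrad_of_commute hm h, ← Nat.cast_smul_eq_nsmul k, smul_smul,
    one_div_mul_cancel (Nat.cast_ne_zero.2 hm), one_smul]

theorem commute_sum_pow {x : Fin 2 → A} (h : Commute (x 0) (x 1)) (n : ℕ) (i : Fin 2) :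
    Commute ((x 0 + x 1) ^ n) (x i) := by
  refine Commute.pow_left ?_ n
  fin_cases i
  · exact (Commute.refl _).add_left h.symm
  · exact h.add_left (Commute.refl _)

/-- At commuting pairs, the Hamiltonian vector field has Lax form. -/
theorem vecField_of_commute [CharZero k] (π : A →+ A) {m : ℕ} (hm : m ≠ 0) {x : Fin 2 → A}
    (h : Commute (x 0) (x 1)) (i : Fin 2) :
    vecField k π m x i = ⁅π ((x 0 + x 1) ^ (m - 1)), x i⁆ := by
  have key : ⁅(x 0 + x 1) ^ (m - 1) - π ((x 0 + x 1) ^ (m - 1)), x i⁆ =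
      -⁅π ((x 0 + x 1) ^ (m - 1)), x i⁆ := by
    have := (commute_sum_pow h (m - 1) i).eq
    simp only [Ring.lie_def, sub_mul, mul_sub, this]
    abel
  rw [vecField, gradH_of_commute hm h, key, map_neg]
  abel

end VectorField

variable {k : Type*} [Field k]

/-- The projection `L ↦ L₊`. -/
noncomputable def plusHom (k : Type*) [Field k] : P k →+ P k where
  toFun := plus
  map_zero' := by
    ext1 n
    change (if 0 ≤ n then (0 : Q k) else 0) = 0
    rw [ite_self]
  map_add' L M := by
    ext1 n
    change (if 0 ≤ n then L.coeff n + M.coeff n else 0) =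
      (if 0 ≤ n then L.coeff n else 0) + (if 0 ≤ n then M.coeff n else 0)
    split_ifs <;> simp

theorem plusHom_smul (c : k) (L : P k) : plusHom k (c • L) = c • plusHom k L := by
  ext1 n
  change (if 0 ≤ n then c • L.coeff n else 0) = c • (if 0 ≤ n then L.coeff n else 0)
  split_ifs <;> simp

theorem resL_apply (L : P k) : resL L = res L := rfl

theorem H_eq (m : ℕ) (L : P2 k) : H m L = res ((1 / (m : k)) • binomSum m L) := by
  rw [← resL_apply, map_smul, binomSum, map_sum, H, smul_eq_mul]
  congr 1
  refine Finset.sum_congr rfl fun p _ => ?_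
  rw [map_nsmul, nsmul_eq_mul]
  rfl

/-- The line `L + XM` is a pair over `P[X]` with `X` central. The residue of the constant term is a
trace on `P[X]`, and `trace_deriv_binomSum` for the derivation d/dX yields the linear coefficient in
terms of the cyclic derivative. -/
theorem isGradient_H (m : ℕ) (L : P2 k) : IsGradient (H m) L (gradH k m L) := by
  intro M
  let q : Fin 2 → Polynomial (P k) := fun i => Polynomial.C (L i) + Polynomial.X * Polynomial.C (M i)
  let f := binomSum m q
  -- Although `P` is noncommutative, evaluation at a scalar is a ring homomorphism, as scalars are
  -- central.
  let ev : k → Polynomial (P k) →+* P k := fun ε =>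
    Polynomial.eval₂RingHom' (RingHom.id _) (algebraMap k (P k) ε)
      fun a => (Algebra.commutes ε a).symm
  have hq : ∀ (ε : k) i, ev ε (q i) = (L + ε • M) i := by
    intro ε i
    change Polynomial.eval₂ _ _ _ = _
    have h1 : Polynomial.X * Polynomial.C (M i) = Polynomial.C (M i) * Polynomial.X :=
      Polynomial.X_mul_C _
    simp only [q, h1]
    rw [Polynomial.eval₂_add, Polynomial.eval₂_C, Polynomial.eval₂_mul_X, Polynomial.eval₂_C,
      ← Algebra.commutes, ← Algebra.smul_def]
    rfl
  have hf : ∀ ε, binomSum m (L + ε • M) =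
      ∑ n ∈ Finset.range (f.natDegree + 1), (ε ^ n : k) • (f.coeff n : P k) := by
    intro ε
    have h1 : binomSum m (L + ε • M) = ev ε f := by
      rw [map_binomSum]
      congr 1
      funext i
      exact (hq ε i).symm
    rw [h1]
    change Polynomial.eval₂ _ _ _ = _
    rw [Polynomial.eval₂_eq_sum_range]
    refine Finset.sum_congr rfl fun n _ => ?_
    rw [← map_pow, ← Algebra.commutes, ← Algebra.smul_def]
    rfl
  let p : Polynomial k := ∑ n ∈ Finset.range (f.natDegree + 1),
    Polynomial.monomial n ((1 / (m : k)) * res (f.coeff n))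
  refine ⟨p, fun ε => ?_, ?_⟩
  · rw [H_eq, hf]
    rw [← resL_apply]
    simp only [p, map_smul, map_sum, resL_apply, Polynomial.eval_finsetSum, Polynomial.eval_monomial,
      smul_eq_mul, Finset.mul_sum]
    exact Finset.sum_congr rfl fun n _ => by ring
  · have h1 : Polynomial.eval 0 (Polynomial.derivative p) = (1 / (m : k)) * res (f.coeff 1) := by
      rw [← Polynomial.coeff_zero_eq_eval_zero, Polynomial.coeff_derivative]
      simp only [p, Polynomial.finsetSum_coeff, Polynomial.coeff_monomial, Finset.sum_ite_eq',
        zero_add, Nat.cast_zero, mul_one, Finset.mem_range]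
      split_ifs with h
      · rfl
      · rw [Polynomial.coeff_eq_zero_of_natDegree_lt (by omega)]
        simp [res, P.entry]
    rw [h1]
    let τ : Polynomial (P k) →+ k :=
      { toFun := fun g => res (g.coeff 0)
        map_zero' := rfl
        map_add' := fun _ _ => rfl }
    have h2 := trace_deriv_binomSum τ (fun a b => by
      change res ((a * b).coeff 0) = res ((b * a).coeff 0)
      rw [Polynomial.mul_coeff_zero, Polynomial.mul_coeff_zero, res_mul_comm])
      (polyDeriv (P k)) m q
    have h3 : τ (polyDeriv (P k) (binomSum m q)) = res (f.coeff 1) := by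
      change res ((Polynomial.derivative f).coeff 0) = _
      rw [Polynomial.coeff_derivative]
      simp
    rw [← h3, h2, Finset.mul_sum]
    refine Finset.sum_congr rfl fun i _ => ?_
    change _ * res (((Polynomial.derivative (q i)) * _).coeff 0) = resL (k := k) _
    rw [gradH, mul_smul_comm, map_smul, smul_eq_mul, Polynomial.mul_coeff_zero]
    have h4 : (Polynomial.derivative (q i)).coeff 0 = M i := by
      simp [q]
    have h5 : (binomGrad m q i).coeff 0 = binomGrad m L i := by
      rw [← Polynomial.constantCoeff_apply]
      rw [map_binomGrad]
      congr 1
      funext j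
      simp [q]
    rw [h4, h5]
    rfl

end

/-! ### Constructing functionals, and the membership of `H_m` -/

section

variable {k : Type*} [Field k]

section Functionals

theorem monoAt_add {R : Type*} [CommRing R] (μ ν : Var →₀ ℕ) (x : Var → R) :
    monoAt (μ + ν) x = monoAt μ x * monoAt ν x :=
  Finsupp.prod_add_index' (fun _ => pow_zero _) fun _ _ _ => pow_add _ _ _

/-- An operator-valued function that is a formal sum of monomials of degree at most `D` with
operator coefficients. -/
def IsOperatorPolynomial (D : ℕ) (Φ : P2 k → P k) : Prop :=
  ∃ (I : Type) (μ : I → Var →₀ ℕ) (T : I → P k), (∀ i, (μ i).degree ≤ D) ∧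
    ∀ L, (sumP k).HasSum (fun i => monomialValue (μ i) L • T i) (Φ L)

theorem IsOperatorPolynomial.one : IsOperatorPolynomial 0 fun _ : P2 k => 1 :=
  ⟨Unit, fun _ => 0, fun _ => 1, fun _ => by simp, fun L => by
    simpa [monomialValue] using (sumP k).unit 1⟩

theorem IsOperatorPolynomial.proj (i : Fin 2) : IsOperatorPolynomial 1 fun L : P2 k => L i :=
  ⟨Expo, fun e => Finsupp.single (i, e) 1, fun e => P.mono k e, fun e => by simp, fun L => by
    simpa [monomialValue] using hasSum_mono (L i)⟩

theorem IsOperatorPolynomial.mul {D D' : ℕ} {Φ Ψ : P2 k → P k} (h : IsOperatorPolynomial D Φ)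
    (h' : IsOperatorPolynomial D' Ψ) : IsOperatorPolynomial (D + D') fun L => Φ L * Ψ L := by
  obtain ⟨I, μ, T, hμ, hT⟩ := h
  obtain ⟨J, ν, T', hν, hT'⟩ := h'
  refine ⟨I × J, fun p => μ p.1 + ν p.2, fun p => T p.1 * T' p.2, fun p => ?_, fun L => ?_⟩
  · rw [map_add]
    exact add_le_add (hμ _) (hν _)
  · have := (sumP k).mul (hT L) (hT' L)
    simpa only [monomialValue_eq, monoAt_add, smul_mul_smul_comm] using this

theorem IsOperatorPolynomial.pow {D : ℕ} {Φ : P2 k → P k} (h : IsOperatorPolynomial D Φ) (n : ℕ) :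
    IsOperatorPolynomial (n * D) fun L => Φ L ^ n := by
  induction n with
  | zero => simpa using IsOperatorPolynomial.one
  | succ n ih =>
    simp only [pow_succ, Nat.succ_mul]
    exact ih.mul h

/-- The point of `P²` whose coefficients are `1` on a finite set and `0` elsewhere. -/
theorem exists_coord_eq_one (s : Finset Var) : ∃ L : P2 k, ∀ v ∈ s, coord L v = 1 := by
  classical
  refine ⟨∑ w ∈ s, Pi.single w.1 (P.mono k w.2), fun v hv => ?_⟩
  rw [coord_sum, Finset.sum_eq_single v]
  · simp [coord, P.entry_mono]
  · rintro ⟨i, e⟩ _ h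
    obtain ⟨j, e'⟩ := v
    by_cases hij : i = j
    · subst hij
      have : e' ≠ e := fun h' => h (by rw [h'])
      simp [coord, P.entry_mono, this]
    · simp only [coord]
      rw [Pi.single_eq_of_ne (Ne.symm hij)]
      rfl
  · exact fun h => absurd hv h

/-- A pointwise finite formal combination of monomials of bounded degree is a functional. -/
theorem mem_functionals_of_family {I : Type} {c : I → k} {μ : I → Var →₀ ℕ} {D : ℕ}
    (hμ : ∀ i, (μ i).degree ≤ D) {F : P2 k → k}
    (hF : ∀ L, (Function.support fun i => c i * monomialValue (μ i) L).Finite ∧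
      F L = ∑ᶠ i, c i * monomialValue (μ i) L) : F ∈ Functionals k := by
  classical
  -- At a point where all variables of `ν` equal `1`, every index over `ν` with nonzero coefficient
  -- contributes a nonzero term, so pointwise finiteness bounds the fibre.
  have hfib : ∀ ν, {i | c i ≠ 0 ∧ μ i = ν}.Finite := by
    intro ν
    obtain ⟨L, hL⟩ := exists_coord_eq_one (k := k) ν.support
    refine (hF L).1.subset ?_
    rintro i ⟨hi, rfl⟩
    refine mul_ne_zero hi (Finset.prod_ne_zero_iff.2 fun v hv => pow_ne_zero _ ?_)
    exact (hL v hv).trans_ne one_ne_zero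
  let c' : (Var →₀ ℕ) → k := fun ν => ∑ i ∈ (hfib ν).toFinset, c i
  have hc' : ∀ (L : P2 k) (ν : Var →₀ ℕ), c' ν * monomialValue ν L =
      ∑ i ∈ (hF L).1.toFinset with μ i = ν, c i * monomialValue (μ i) L := by
    intro L ν
    simp only [c', Finset.sum_mul]
    by_cases h0 : monomialValue ν L = 0
    · rw [Finset.sum_eq_zero fun i _ => by rw [h0, mul_zero], Finset.sum_eq_zero]
      intro i hi
      rw [(Finset.mem_filter.1 hi).2, h0, mul_zero]
    · refine Finset.sum_congr ?_ fun i hi => ?_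
      · ext i
        simp only [Set.Finite.mem_toFinset, Set.mem_ofPred_eq, Finset.mem_filter,
          Function.mem_support]
        constructor
        · rintro ⟨h1, rfl⟩
          exact ⟨mul_ne_zero h1 h0, rfl⟩
        · rintro ⟨h1, rfl⟩
          exact ⟨left_ne_zero_of_mul h1, rfl⟩
      · rw [(Finset.mem_filter.1 hi).2]
  refine ⟨c', D, fun ν hν => ?_, fun L => ?_⟩
  · obtain ⟨i, hi, _⟩ := Finset.exists_ne_zero_of_sum_ne_zero hν
    rw [Set.Finite.mem_toFinset] at hi
    rw [← hi.2]
    exact hμ i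
  · have hs : (Function.support fun ν => c' ν * monomialValue ν L) ⊆
        ((hF L).1.toFinset.image μ : Finset _) := by
      intro ν hν
      rw [Function.mem_support, hc'] at hν
      obtain ⟨i, hi, _⟩ := Finset.exists_ne_zero_of_sum_ne_zero hν
      rw [Finset.mem_filter] at hi
      rw [Finset.mem_coe, Finset.mem_image]
      exact ⟨i, hi⟩
    refine ⟨(Finset.finite_toSet _).subset hs, ?_⟩
    refine ((hF L).2.trans
      (finsum_eq_sum_of_support_subset (s := (hF L).1.toFinset) _ (by simp))).trans ?_
    rw [finsum_eq_sum_of_support_subset _ hs]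
    simp only [hc']
    exact (Finset.sum_fiberwise_of_maps_to (fun i hi => Finset.mem_image_of_mem μ hi) _).symm

theorem IsOperatorPolynomial.res_mem {D : ℕ} {Φ : P2 k → P k} (h : IsOperatorPolynomial D Φ) :
    (fun L => res (Φ L)) ∈ Functionals k := by
  obtain ⟨I, μ, T, hμ, hT⟩ := h
  refine mem_functionals_of_family (c := fun i => res (T i)) hμ fun L => ?_
  have := hasSum_entry (hT L) ⟨-1, -1, -1, -1⟩
  have e : ∀ i, P.entry (monomialValue (μ i) L • T i) ⟨-1, -1, -1, -1⟩ =
      res (T i) * monomialValue (μ i) L := fun i => mul_comm _ _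
  simp only [e] at this
  exact this

theorem functionals_smul {F : P2 k → k} (hF : F ∈ Functionals k) (a : k) :
    (fun L => a * F L) ∈ Functionals k := by
  obtain ⟨c, D, hD, hc⟩ := hF
  refine ⟨fun μ => a * c μ, D, fun μ hμ => hD μ (right_ne_zero_of_mul hμ), fun L => ?_⟩
  simp only [mul_assoc]
  exact ⟨(hc L).1.subset fun μ hμ => right_ne_zero_of_mul hμ,
    by rw [(hc L).2]; exact smul_finsum' a (hc L).1⟩

theorem functionals_add {F G : P2 k → k} (hF : F ∈ Functionals k) (hG : G ∈ Functionals k) :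
    (fun L => F L + G L) ∈ Functionals k := by
  obtain ⟨c, D, hD, hc⟩ := hF
  obtain ⟨c', D', hD', hc'⟩ := hG
  refine ⟨fun μ => c μ + c' μ, max D D', fun μ hμ => ?_, fun L => ?_⟩
  · by_cases h : c μ = 0
    · exact (hD' μ fun h' => hμ (by simp [h, h'])).trans (le_max_right _ _)
    · exact (hD μ h).trans (le_max_left _ _)
  · simp only [add_mul]
    exact ⟨((hc L).1.union (hc' L).1).subset (Function.support_add _ _),
      by rw [(hc L).2, (hc' L).2, finsum_add_distrib (hc L).1 (hc' L).1]⟩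

theorem functionals_sum {ι : Type*} (s : Finset ι) {F : ι → P2 k → k}
    (hF : ∀ i ∈ s, F i ∈ Functionals k) : (fun L => ∑ i ∈ s, F i L) ∈ Functionals k := by
  classical
  induction s using Finset.induction_on with
  | empty => exact ⟨0, 0, fun μ h => absurd rfl h, fun L => by simp [Function.support]⟩
  | insert i s hi ih =>
    simp only [Finset.sum_insert hi]
    exact functionals_add (hF i (Finset.mem_insert_self _ _))
      (ih fun j hj => hF j (Finset.mem_insert_of_mem hj))

/-- Each `Lᵢ` is the formal sum of its monomials, and products of formal sums are formal sums of the
products; taking the residue leaves a pointwise finite sum of bounded degree. -/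
theorem H_mem_functionals (m : ℕ) : (H m : P2 k → k) ∈ Functionals k :=
  functionals_smul (functionals_sum _ fun p _ => functionals_smul
    (((IsOperatorPolynomial.proj 0).pow p.1).mul ((IsOperatorPolynomial.proj 1).pow p.2)).res_mem
    _) _

theorem coord_mem_functionals (v : Var) : (fun L : P2 k => coord L v) ∈ Functionals k := by
  refine mem_functionals_of_family (I := Unit) (c := fun _ => 1)
    (μ := fun _ => Finsupp.single v 1) (D := 1) (fun _ => by simp) fun L => ⟨Set.toFinite _, ?_⟩
  rw [finsum_unique]
  simp [monomialValue, coord]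

theorem hasDirDeriv_coord (v : Var) (L M : P2 k) :
    HasDirDeriv (fun L => coord L v) L M (coord M v) :=
  ⟨Polynomial.C (coord L v) + Polynomial.C (coord M v) * Polynomial.X,
    fun ε => by simpa [coord_add, coord_smul] using mul_comm _ _, by simp⟩

end Functionals

/-! ### Poisson brackets with `H_m` and the Lax form on `P'` -/

section Poisson

theorem res_mul_lie (L A B : P k) : res (L * ⁅A, B⁆) = res (A * ⁅B, L⁆) := by
  simp only [Ring.lie_def, mul_sub, ← resL_apply, map_sub]
  simp only [resL_apply]
  rw [res_mul_comm L (A * B), mul_assoc, ← mul_assoc L, res_mul_comm (L * B)]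

theorem plus_add_minus (L : P k) : plus L + minus L = L := add_sub_cancel _ _

theorem res_add (L M : P k) : res (L + M) = res L + res M := map_add resL L M

theorem res_sub (L M : P k) : res (L - M) = res L - res M := map_sub resL L M

/-- Both halves of `P` are isotropic, so on either side only the pairing of `plus A` with `minus Z`
remains. -/
theorem res_mul_minus (A Z : P k) : res (A * minus Z) = res (plus A * Z) := by
  nth_rw 1 [← plus_add_minus A]
  nth_rw 2 [← plus_add_minus Z]
  rw [add_mul, mul_add, res_add, res_add, res_minus_mul_minus, res_plus_mul_plus, add_zero,
    zero_add]

theorem res_mul_plus (A Z : P k) : res (A * plus Z) = res (minus A * Z) := by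
  nth_rw 1 [← plus_add_minus A]
  nth_rw 2 [← plus_add_minus Z]
  rw [add_mul, mul_add, res_add, res_add, res_minus_mul_minus, res_plus_mul_plus, add_zero,
    zero_add]

/-- The Hamiltonian vector field of `H_m`. -/
noncomputable def hamField (m : ℕ) (L : P2 k) : P2 k := vecField k (plusHom k) m L

/-- Cyclicity moves the bracket from the components of `A` to `L`; adjointness of the projections
then removes the projections from `A`. -/
theorem pair_bracketR (m : ℕ) (L A : P2 k) :
    pair L (bracketR A (gradH k m L)) = pair (hamField m L) A := by
  refine Finset.sum_congr rfl fun i => fun _ => ?_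
  have e : hamField m L i = minus ⁅plus (gradH k m L i), L i⁆ - plus ⁅minus (gradH k m L i), L i⁆ :=
    rfl
  rw [e, res_mul_comm _ (A i), mul_sub, res_sub, res_mul_minus, res_mul_plus, bracketR, mul_sub,
    res_sub, res_mul_lie, res_mul_lie (L i)]

theorem poissonR_H [CharZero k] (F : P2 k → k) (m : ℕ) (L : P2 k) :
    poissonR F (H m) L = pair (hamField m L) (grad F L) := by
  rw [poissonR, (isGradient_H m L).grad_eq, pair_bracketR]

theorem hasDirDeriv_hamField [CharZero k] {F : P2 k → k} (hF : F ∈ Functionals k) (m : ℕ) (L : P2 k) :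
    HasDirDeriv F L (hamField m L) (poissonR F (H m) L) := by
  rw [poissonR_H]
  exact isGradient_grad hF L _

theorem commute_of_mem {L : P2 k} (hL : L ∈ PPrime k) : Commute (L 0) (L 1) := by
  have := hL 0 1
  rwa [Ring.lie_def, sub_eq_zero] at this

theorem hamField_eq_lax [CharZero k] {m : ℕ} (hm : m ≠ 0) {L : P2 k} (hL : L ∈ PPrime k) :
    hamField m L = lax m L :=
  funext fun i => vecField_of_commute (plusHom k) hm (commute_of_mem hL) i

/-- Uniqueness of the velocity needs only the single coefficients as test functionals. -/
theorem forall_hasDirDeriv_iff [CharZero k] {m : ℕ} (hm : m ≠ 0) {L : P2 k} (hL : L ∈ PPrime k) (X : P2 k) :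
    (∀ F ∈ Functionals k, HasDirDeriv F L X (poissonR F (H m) L)) ↔ X = lax m L := by
  rw [← hamField_eq_lax hm hL]
  constructor
  · intro h
    refine coord_injective (funext fun v => ?_)
    have h1 := (h _ (coord_mem_functionals v)).unique (hasDirDeriv_coord v L X)
    have h2 := (hasDirDeriv_hamField (coord_mem_functionals v) m L).unique
      (hasDirDeriv_coord v L (hamField m L))
    exact h1.symm.trans h2
  · rintro rfl F hF
    exact hasDirDeriv_hamField hF m L

/-- By the Jacobi identity the linearized commutator is [W₊, [L_i, L_j]], for either sign of the
splitting, and [L_i, L_j] = 0. -/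
theorem isTangent_lax (m : ℕ) {L : P2 k} (hL : L ∈ PPrime k) : IsTangent L (lax m L) := by
  intro i j
  have h : L i * L j = L j * L i := by
    have := hL i j
    rwa [Ring.lie_def, sub_eq_zero] at this
  have key : ∀ w a b : P k, ⁅⁅w, a⁆, b⁆ + ⁅a, ⁅w, b⁆⁆ = w * (a * b - b * a) - (a * b - b * a) * w := by
    intro w a b
    simp only [Ring.lie_def]
    noncomm_ring
  rw [lax, lax, key, h, sub_self, mul_zero, zero_mul, sub_zero]

/-- On `P'` the i-th term is res(W'₊ [L_i, W]) by cyclicity, with W = (L₁ + L₂)^(m-1) and W' = (L₁ +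
L₂)^(m'-1); W commutes with L_i. -/
theorem poissonR_H_H [CharZero k] {m m' : ℕ} (hm : m ≠ 0) (hm' : m' ≠ 0) {L : P2 k} (hL : L ∈ PPrime k) :
    poissonR (H m) (H m') L = 0 := by
  have hc := commute_of_mem hL
  rw [poissonR_H, (isGradient_H m L).grad_eq, hamField_eq_lax hm' hL]
  refine Finset.sum_eq_zero fun i _ => ?_
  rw [lax, gradH_of_commute hm hc, res_mul_comm, res_mul_lie, Ring.lie_def, (commute_sum_pow hc (m - 1) i).eq, sub_self, mul_zero]
  rfl

end Poisson

end

/-! ### Power series in the times and their truncations -/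

section

section Series

variable {S A : Type*} [Ring A]

theorem coeff_timeDeriv (s : S) (f : MvPowerSeries S A) (n : S →₀ ℕ) :
    MvPowerSeries.coeff n (timeDeriv s f) =
      (n s + 1) • MvPowerSeries.coeff (n + Finsupp.single s 1) f := rfl

theorem sum_antidiagonal_add_single [DecidableEq S] (s : S) (n : S →₀ ℕ)
    (φ : (S →₀ ℕ) → (S →₀ ℕ) → A) :
    ∑ p ∈ Finset.HasAntidiagonal.antidiagonal (n + Finsupp.single s 1), (p.1 : S →₀ ℕ) s • φ p.1 p.2 =
      ∑ p ∈ Finset.HasAntidiagonal.antidiagonal n,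
        ((p.1 : S →₀ ℕ) s + 1) • φ (p.1 + Finsupp.single s 1) p.2 := by
  symm
  refine Finset.sum_of_injOn (fun p => (p.1 + Finsupp.single s 1, p.2)) ?_ ?_ ?_ ?_
  · rintro ⟨a, b⟩ _ ⟨a', b'⟩ _ h
    simpa using h
  · rintro ⟨a, b⟩ h
    simp only [Finset.mem_coe, Finset.HasAntidiagonal.mem_antidiagonal] at h ⊢
    rw [← h, add_right_comm]
  · rintro ⟨a, b⟩ h h'
    by_cases ha : a s = 0
    · simp [ha]
    · have hle : Finsupp.single s 1 ≤ a := by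
        rw [Finsupp.single_le_iff]
        omega
      refine absurd ⟨(a - Finsupp.single s 1, b), ?_, ?_⟩ h'
      · simp only [Finset.mem_coe, Finset.HasAntidiagonal.mem_antidiagonal] at h ⊢
        refine add_right_cancel (b := Finsupp.single s 1) ?_
        rw [add_right_comm, tsub_add_cancel_of_le hle, h]
      · simp only [tsub_add_cancel_of_le hle]
  · rintro ⟨a, b⟩ _
    simp

/-- The time derivative as a derivation. -/
noncomputable def timeDerivation (A : Type*) [Ring A] (s : S) : RingDeriv (MvPowerSeries S A) where
  toFun := timeDeriv s
  map_zero' := by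
    ext n
    rw [coeff_timeDeriv, map_zero, smul_zero]
    rfl
  map_add' f g := by
    ext n
    rw [coeff_timeDeriv, map_add, smul_add]
    rfl
  leibniz' f g := by
    classical
    ext n
    change MvPowerSeries.coeff n (timeDeriv s (f * g)) =
      MvPowerSeries.coeff n (timeDeriv s f * g + f * timeDeriv s g)
    have h1 : MvPowerSeries.coeff n (timeDeriv s (f * g)) =
        ∑ p ∈ Finset.HasAntidiagonal.antidiagonal (n + Finsupp.single s 1),
          ((p.1 : S →₀ ℕ) s • (MvPowerSeries.coeff p.1 f * MvPowerSeries.coeff p.2 g) +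
            (p.2 : S →₀ ℕ) s • (MvPowerSeries.coeff p.1 f * MvPowerSeries.coeff p.2 g)) := by
      rw [coeff_timeDeriv, MvPowerSeries.coeff_mul, Finset.smul_sum]
      refine Finset.sum_congr rfl fun p hp => ?_
      rw [Finset.HasAntidiagonal.mem_antidiagonal] at hp
      rw [← add_smul, ← Finsupp.add_apply, hp, Finsupp.add_apply, Finsupp.single_eq_same]
    have h2 : ∑ p ∈ Finset.HasAntidiagonal.antidiagonal (n + Finsupp.single s 1),
        (p.2 : S →₀ ℕ) s • (MvPowerSeries.coeff p.1 f * MvPowerSeries.coeff p.2 g) =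
        ∑ p ∈ Finset.HasAntidiagonal.antidiagonal (n + Finsupp.single s 1),
          (p.1 : S →₀ ℕ) s • (MvPowerSeries.coeff p.2 f * MvPowerSeries.coeff p.1 g) :=
      Finsupp.sum_antidiagonal_swap (n + Finsupp.single s 1) fun a b =>
        b s • (MvPowerSeries.coeff a f * MvPowerSeries.coeff b g)
    have h3 : ∑ p ∈ Finset.HasAntidiagonal.antidiagonal n, ((p.1 : S →₀ ℕ) s + 1) •
          (MvPowerSeries.coeff p.2 f * MvPowerSeries.coeff (p.1 + Finsupp.single s 1) g) =
        ∑ p ∈ Finset.HasAntidiagonal.antidiagonal n, ((p.2 : S →₀ ℕ) s + 1) •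
          (MvPowerSeries.coeff p.1 f * MvPowerSeries.coeff (p.2 + Finsupp.single s 1) g) :=
      (Finsupp.sum_antidiagonal_swap n fun a b => (b s + 1) •
        (MvPowerSeries.coeff a f * MvPowerSeries.coeff (b + Finsupp.single s 1) g)).symm
    rw [h1, Finset.sum_add_distrib, h2,
      sum_antidiagonal_add_single s n fun a b => MvPowerSeries.coeff a f * MvPowerSeries.coeff b g,
      sum_antidiagonal_add_single s n fun a b => MvPowerSeries.coeff b f * MvPowerSeries.coeff a g,
      h3, map_add, MvPowerSeries.coeff_mul, MvPowerSeries.coeff_mul]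
    simp only [coeff_timeDeriv, smul_mul_assoc, mul_smul_comm]

/-- A coefficient of a power series vanishes if the corresponding coefficient of a time derivative
does. -/
theorem coeff_eq_zero_of_timeDeriv (k : Type*) [Field k] [CharZero k] [Algebra k A]
    {f : MvPowerSeries S A} {s : S} {n : S →₀ ℕ} (hn : n s ≠ 0)
    (h : MvPowerSeries.coeff (n - Finsupp.single s 1) (timeDeriv s f) = 0) :
    MvPowerSeries.coeff n f = 0 := by
  have hle : Finsupp.single s 1 ≤ n := by
    rw [Finsupp.single_le_iff]
    omega
  rw [coeff_timeDeriv, tsub_add_cancel_of_le hle, ← Nat.cast_smul_eq_nsmul k] at h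
  exact (smul_eq_zero.1 h).resolve_left (Nat.cast_ne_zero.2 (Nat.succ_ne_zero _))

/-- Congruence of power series: equality of the coefficients in a lower set of exponents. -/
def lowerCon (A : Type*) [Ring A] (D : LowerSet (S →₀ ℕ)) : RingCon (MvPowerSeries S A) where
  r f g := ∀ n ∈ D, MvPowerSeries.coeff n f = MvPowerSeries.coeff n g
  iseqv := ⟨fun _ _ _ => rfl, fun h n hn => (h n hn).symm, fun h h' n hn =>
    (h n hn).trans (h' n hn)⟩
  add' h h' n hn := by
    rw [map_add, map_add, h n hn, h' n hn]
  mul' h h' n hn := by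
    classical
    rw [MvPowerSeries.coeff_mul, MvPowerSeries.coeff_mul]
    refine Finset.sum_congr rfl fun p hp => ?_
    rw [Finset.HasAntidiagonal.mem_antidiagonal] at hp
    rw [h p.1 (D.lower (le_self_add.trans hp.le) hn),
      h' p.2 (D.lower (le_add_self.trans hp.le) hn)]

/-- The coefficientwise extension of an additive map to power series. -/
def mapT {B : Type*} [Ring B] (π : A →+ B) : MvPowerSeries S A →+ MvPowerSeries S B where
  toFun f := fun n => π (MvPowerSeries.coeff n f)
  map_zero' := by
    funext n
    exact map_zero π
  map_add' f g := by
    funext n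
    exact map_add π _ _

theorem coeff_mapT {B : Type*} [Ring B] (π : A →+ B) (f : MvPowerSeries S A) (n : S →₀ ℕ) :
    MvPowerSeries.coeff n (mapT π f) = π (MvPowerSeries.coeff n f) := rfl

theorem timeDeriv_mapT {B : Type*} [Ring B] (π : A →+ B) (s : S) (f : MvPowerSeries S A) :
    timeDeriv s (mapT π f) = mapT π (timeDeriv s f) := by
  ext n
  rw [coeff_timeDeriv, coeff_mapT, coeff_mapT, coeff_timeDeriv, map_nsmul]

theorem lowerCon_mapT {B : Type*} [Ring B] (π : A →+ B) {D : LowerSet (S →₀ ℕ)}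
    {f g : MvPowerSeries S A} (h : lowerCon A D f g) : lowerCon B D (mapT π f) (mapT π g) :=
  fun n hn => congrArg π (h n hn)

variable {k : Type*} [Field k] [Algebra k A]

theorem coeff_smulT (c : k) (f : MvPowerSeries S A) (n : S →₀ ℕ) :
    MvPowerSeries.coeff n (c • f) = c • MvPowerSeries.coeff n f := rfl

theorem lowerCon_smul {D : LowerSet (S →₀ ℕ)} (c : k) {f g : MvPowerSeries S A}
    (h : lowerCon A D f g) : lowerCon A D (c • f) (c • g) :=
  fun n hn => congrArg (c • ·) (h n hn)

theorem lowerCon_lie {D : LowerSet (S →₀ ℕ)} {f g f' g' : MvPowerSeries S A}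
    (h : lowerCon A D f g) (h' : lowerCon A D f' g') : lowerCon A D ⁅f, f'⁆ ⁅g, g'⁆ := by
  simp only [Ring.lie_def]
  exact (lowerCon A D).sub ((lowerCon A D).mul h h') ((lowerCon A D).mul h' h)

/-- Apart from the scalar, the gradient is a noncommutative polynomial, hence compatible with the
quotient by the congruence. -/
theorem lowerCon_gradH {D : LowerSet (S →₀ ℕ)} (m : ℕ) {x y : Fin 2 → MvPowerSeries S A}
    (h : ∀ i, lowerCon A D (x i) (y i)) (i : Fin 2) :
    lowerCon A D (gradH k m x i) (gradH k m y i) := by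
  refine lowerCon_smul _ ((lowerCon A D).eq.1 ?_)
  change (lowerCon A D).mk' _ = (lowerCon A D).mk' _
  rw [map_binomGrad, map_binomGrad]
  congr 1
  funext j
  exact (lowerCon A D).eq.2 (h j)

theorem lowerCon_vecField {D : LowerSet (S →₀ ℕ)} (π : A →+ A) (m : ℕ)
    {x y : Fin 2 → MvPowerSeries S A} (h : ∀ i, lowerCon A D (x i) (y i)) (i : Fin 2) :
    lowerCon A D (vecField k (mapT π) m x i) (vecField k (mapT π) m y i) := by
  have hg := lowerCon_gradH (k := k) m h i
  have hp := lowerCon_lie (lowerCon_mapT π hg) (h i)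
  exact (lowerCon A D).sub ((lowerCon A D).sub hp (lowerCon_mapT π hp))
    (lowerCon_mapT π (lowerCon_lie ((lowerCon A D).sub hg (lowerCon_mapT π hg)) (h i)))

/-- Modulo terms at which the components of a pair commute, its Hamiltonian vector field has Lax
form. -/
theorem lowerCon_vecField_of_commute [CharZero k] {D : LowerSet (S →₀ ℕ)} (π : A →+ A) {m : ℕ}
    (hm : m ≠ 0) {x : Fin 2 → MvPowerSeries S A} (h : lowerCon A D (x 0 * x 1) (x 1 * x 0))
    (i : Fin 2) :
    lowerCon A D (vecField k (mapT π) m x i) ⁅mapT π ((x 0 + x 1) ^ (m - 1)), x i⁆ := by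
  let φ := (lowerCon A D).mk'
  let W := (x 0 + x 1) ^ (m - 1)
  have hc : Commute (φ (x 0)) (φ (x 1)) := by
    have := (lowerCon A D).eq.2 h
    exact ((map_mul φ _ _).symm.trans this).trans (map_mul φ _ _)
  have hg : lowerCon A D (gradH k m x i) W := by
    have h1 : φ (binomGrad m x i) = φ (m • W) := by
      rw [map_binomGrad, binomGrad_of_commute hm hc, map_nsmul, map_pow, map_add]
    have h2 := lowerCon_smul (1 / (m : k)) ((lowerCon A D).eq.1 h1)
    rw [← Nat.cast_smul_eq_nsmul k, smul_smul, one_div_mul_cancel (Nat.cast_ne_zero.2 hm),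
      one_smul] at h2
    exact h2
  -- In the quotient `W` commutes with `x i`, so the brackets of its two halves with `x i` are
  -- opposite.
  have hW : lowerCon A D ⁅W - mapT π W, x i⁆ (-⁅mapT π W, x i⁆) := by
    refine (lowerCon A D).eq.1 ?_
    change φ _ = φ _
    have h1 : φ W * φ (x i) = φ (x i) * φ W := by
      have := commute_sum_pow (x := fun i => φ (x i)) hc (m - 1) i
      simpa only [W, map_pow, map_add] using this.eq
    simp only [Ring.lie_def, map_sub, map_neg, map_mul, sub_mul, mul_sub, h1]
    abel
  have hp := lowerCon_lie (lowerCon_mapT π hg) ((lowerCon A D).refl (x i))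
  have h3 := lowerCon_mapT π ((lowerCon A D).trans
    (lowerCon_lie ((lowerCon A D).sub hg (lowerCon_mapT π hg)) ((lowerCon A D).refl (x i))) hW)
  have h4 := (lowerCon A D).sub ((lowerCon A D).sub hp (lowerCon_mapT π hp)) h3
  rwa [map_neg, sub_neg_eq_add, sub_add_cancel] at h4

end Series

/-! ### Polynomials in the times with operator coefficients -/

section TimePolynomials

variable {S A : Type*} [Ring A]

/-- The power series of a polynomial in the times. -/
noncomputable def toSeries (S A : Type*) [Ring A] :
    AddMonoidAlgebra A (S →₀ ℕ) →+* MvPowerSeries S A where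
  toFun f := fun n => f.coeff n
  map_zero' := rfl
  map_one' := by
    classical
    ext n
    rw [MvPowerSeries.coeff_one]
    change (1 : AddMonoidAlgebra A (S →₀ ℕ)).coeff n = _
    rw [AddMonoidAlgebra.one_def, AddMonoidAlgebra.coeff_single, Finsupp.single_apply]
    simp only [eq_comm]
  map_add' _ _ := rfl
  map_mul' f g := by
    classical
    ext n
    exact (AddMonoidAlgebra.coeff_mul_antidiag f g n _
      Finset.HasAntidiagonal.mem_antidiagonal).trans (MvPowerSeries.coeff_mul n _ _).symm

theorem coeff_toSeries (f : AddMonoidAlgebra A (S →₀ ℕ)) (n : S →₀ ℕ) :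
    MvPowerSeries.coeff n (toSeries S A f) = f.coeff n := rfl

/-- The coefficientwise extension of an additive map to polynomials in the times. -/
noncomputable def mapW (S : Type*) (π : A →+ A) :
    AddMonoidAlgebra A (S →₀ ℕ) →+ AddMonoidAlgebra A (S →₀ ℕ) where
  toFun := AddMonoidAlgebra.map π
  map_zero' := by
    ext n
    exact map_zero π
  map_add' f g := by
    ext n
    exact map_add π _ _

/-- The truncation of a power series. -/
noncomputable def trunc [DecidableEq S] (n : S →₀ ℕ) (f : MvPowerSeries S A) :
    AddMonoidAlgebra A (S →₀ ℕ) :=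
  ∑ j ∈ Finset.Icc 0 n, AddMonoidAlgebra.single j (MvPowerSeries.coeff j f)

theorem coeff_trunc [DecidableEq S] (n j : S →₀ ℕ) (f : MvPowerSeries S A) :
    (trunc n f).coeff j = if j ≤ n then MvPowerSeries.coeff j f else 0 := by
  rw [trunc, AddMonoidAlgebra.coeff_sum, Finsupp.finsetSum_apply]
  simp only [AddMonoidAlgebra.coeff_single, Finsupp.single_apply, Finset.sum_ite_eq',
    Finset.mem_Icc, zero_le, true_and]

theorem lowerCon_trunc [DecidableEq S] (n : S →₀ ℕ) (f : MvPowerSeries S A) :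
    lowerCon A (LowerSet.Iic n) (toSeries S A (trunc n f)) f := by
  intro j hj
  rw [coeff_toSeries, coeff_trunc, if_pos (LowerSet.mem_Iic_iff.1 hj)]

variable {k : Type*} [Field k] [Algebra k A]

variable (A) in
/-- The value of a polynomial in the times at given times. -/
noncomputable def evalW (ε : S → k) : AddMonoidAlgebra A (S →₀ ℕ) →+* A :=
  AddMonoidAlgebra.liftNCRingHom (RingHom.id A)
    { toFun := fun n => algebraMap k A (n.toAdd.prod fun s e => ε s ^ e)
      map_one' := by simp
      map_mul' := fun a b => by
        rw [toAdd_mul, Finsupp.prod_add_index' (fun _ => pow_zero _) fun _ _ _ => pow_add _ _ _,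
          map_mul] }
    fun a n => (Algebra.commutes _ a).symm

theorem evalW_single (ε : S → k) (n : S →₀ ℕ) (a : A) :
    evalW A ε (AddMonoidAlgebra.single n a) = (n.prod fun s e => ε s ^ e) • a := by
  refine (AddMonoidAlgebra.liftNC_single _ _ _ _).trans ?_
  rw [Algebra.smul_def, Algebra.commutes]
  rfl

theorem evalW_smul (ε : S → k) (c : k) (f : AddMonoidAlgebra A (S →₀ ℕ)) :
    evalW A ε (c • f) = c • evalW A ε f := by
  induction f using AddMonoidAlgebra.induction_linear with
  | zero => simp
  | add x y hx hy => rw [smul_add, map_add, hx, hy, map_add, smul_add]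
  | single n a => rw [AddMonoidAlgebra.smul_single, evalW_single, evalW_single, smul_comm]

theorem evalW_mapW (ε : S → k) {π : A →+ A} (hπ : ∀ (c : k) a, π (c • a) = c • π a)
    (f : AddMonoidAlgebra A (S →₀ ℕ)) : evalW A ε (mapW S π f) = π (evalW A ε f) := by
  induction f using AddMonoidAlgebra.induction_linear with
  | zero => simp
  | add x y hx hy => rw [map_add, map_add, hx, hy, map_add, map_add]
  | single n a =>
    have : mapW S π (AddMonoidAlgebra.single n a) = AddMonoidAlgebra.single n (π a) :=
      AddMonoidAlgebra.map_single ..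
    rw [this, evalW_single, evalW_single, hπ]

/-- The scalar polynomial obtained by applying a linear functional to the coefficients. -/
noncomputable def scalarPoly (ℓ : A →ₗ[k] k) (f : AddMonoidAlgebra A (S →₀ ℕ)) :
    MvPolynomial S k :=
  AddMonoidAlgebra.map ℓ.toAddMonoidHom f

theorem coeff_scalarPoly (ℓ : A →ₗ[k] k) (f : AddMonoidAlgebra A (S →₀ ℕ)) (n : S →₀ ℕ) :
    MvPolynomial.coeff n (scalarPoly ℓ f) = ℓ (f.coeff n) := rfl

theorem eval_scalarPoly (ε : S → k) (ℓ : A →ₗ[k] k) (f : AddMonoidAlgebra A (S →₀ ℕ)) :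
    MvPolynomial.eval ε (scalarPoly ℓ f) = ℓ (evalW A ε f) := by
  have hadd : ∀ x y : AddMonoidAlgebra A (S →₀ ℕ),
      scalarPoly ℓ (x + y) = scalarPoly ℓ x + scalarPoly ℓ y := by
    intro x y
    ext n
    exact map_add ℓ _ _
  induction f using AddMonoidAlgebra.induction_linear with
  | zero =>
    have : scalarPoly ℓ (0 : AddMonoidAlgebra A (S →₀ ℕ)) = 0 := by
      ext n
      exact map_zero ℓ
    rw [this, map_zero, map_zero, map_zero]
  | add x y hx hy => rw [hadd, map_add, map_add, map_add, hx, hy]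
  | single n a =>
    have : scalarPoly ℓ (AddMonoidAlgebra.single n a) = MvPolynomial.monomial n (ℓ a) :=
      AddMonoidAlgebra.map_single ..
    rw [this, evalW_single, MvPolynomial.eval_monomial, map_smul, smul_eq_mul, mul_comm]

end TimePolynomials

end

/-! ### Formal solutions: the flow, invariance of `P'`, conservation of `H_m` -/

section

variable {k : Type*} [Field k] {S : Type*}

theorem IsValue.unique [CharZero k] {F : P2 k → k} {L : Fin 2 → MvPowerSeries S (P k)}
    {f g : MvPowerSeries S k} (hf : IsValue F L f) (hg : IsValue F L g) : f = g := by
  ext n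
  obtain ⟨p, hp, hfp⟩ := hf n
  obtain ⟨q, hq, hgq⟩ := hg n
  rw [hfp, hgq, MvPolynomial.funext fun ε => (hp ε).symm.trans (hq ε)]

theorem evalW_trunc [DecidableEq S] (L : Fin 2 → MvPowerSeries S (P k)) (n : S →₀ ℕ) (ε : S → k)
    (i : Fin 2) : evalW (P k) ε (trunc n (L i)) = truncAt L n ε i := by
  unfold trunc truncAt
  rw [map_sum]
  refine Finset.sum_congr ?_ fun j _ => evalW_single ε j _
  congr!

/-- The coefficients of a pair of polynomials in the times. -/
noncomputable def coordW (q : Fin 2 → AddMonoidAlgebra (P k) (S →₀ ℕ)) (v : Var) :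
    MvPolynomial S k :=
  scalarPoly (entryL v.2) (q v.1)

theorem eval_coordW (q : Fin 2 → AddMonoidAlgebra (P k) (S →₀ ℕ)) (v : Var) (ε : S → k) :
    MvPolynomial.eval ε (coordW q v) = coord (fun i => evalW (P k) ε (q i)) v :=
  eval_scalarPoly ε _ _

/-- A pair of polynomials in the times is a finite combination of points of `P²` with coefficients
in k[t]; this brings functionals along truncated curves under the finiteness lemmas. -/
theorem coordW_mem_points (q : Fin 2 → AddMonoidAlgebra (P k) (S →₀ ℕ)) :
    coordW q ∈ points k (MvPolynomial S k) := by
  classical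
  have : coordW q = ∑ j ∈ (q 0).coeff.support ∪ (q 1).coeff.support,
      MvPolynomial.monomial j (1 : k) •
        fun v => algebraMap k (MvPolynomial S k) (coord (fun i => (q i).coeff j) v) := by
    funext v
    obtain ⟨i, e⟩ := v
    ext m
    simp only [Finset.sum_apply, Pi.smul_apply, smul_eq_mul, MvPolynomial.algebraMap_eq,
      MvPolynomial.coeff_sum, mul_comm (MvPolynomial.monomial _ _), MvPolynomial.coeff_C_mul,
      MvPolynomial.coeff_monomial, mul_ite, mul_one, mul_zero, Finset.sum_ite_eq']
    split_ifs with h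
    · rfl
    · have hm : (q i).coeff m = 0 := by
        by_contra h'
        refine h (Finset.mem_union.2 ?_)
        fin_cases i
        · exact Or.inl (Finsupp.mem_support_iff.2 h')
        · exact Or.inr (Finsupp.mem_support_iff.2 h')
      change entryL e ((q i).coeff m) = 0
      rw [hm, map_zero]
  rw [this]
  exact Submodule.sum_mem _ fun j _ => Submodule.smul_mem _ _ (coord_mem_points _)

/-- The coefficients of a formal curve in `P²`. -/
noncomputable def coordT (L : Fin 2 → MvPowerSeries S (P k)) (v : Var) : MvPowerSeries S k :=
  mapT (entryL v.2).toAddMonoidHom (L v.1)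

theorem coe_coordW (q : Fin 2 → AddMonoidAlgebra (P k) (S →₀ ℕ)) (v : Var) :
    (coordW q v : MvPowerSeries S k) = coordT (fun i => toSeries S (P k) (q i)) v := rfl

theorem coordT_injective : Function.Injective
    (coordT : (Fin 2 → MvPowerSeries S (P k)) → Var → MvPowerSeries S k) := by
  intro L M h
  funext i
  ext1 n
  exact P.entry_ext fun e => congrArg (MvPowerSeries.coeff n) (congrFun h (i, e))

/-- The Hamiltonian vector field of `H_m` along a formal curve. -/
noncomputable def hamFieldT (m : ℕ) (L : Fin 2 → MvPowerSeries S (P k)) :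
    Fin 2 → MvPowerSeries S (P k) :=
  vecField k (mapT (plusHom k)) m L

/-- The Hamiltonian vector field of `H_m` along a pair of polynomials in the times. -/
noncomputable def hamFieldW (m : ℕ) (q : Fin 2 → AddMonoidAlgebra (P k) (S →₀ ℕ)) :
    Fin 2 → AddMonoidAlgebra (P k) (S →₀ ℕ) :=
  vecField k (mapW S (plusHom k)) m q

theorem evalW_hamFieldW (m : ℕ) (q : Fin 2 → AddMonoidAlgebra (P k) (S →₀ ℕ)) (ε : S → k)
    (i : Fin 2) : evalW (P k) ε (hamFieldW m q i) = hamField m (fun i => evalW (P k) ε (q i)) i :=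
  map_vecField (evalW (P k) ε) (evalW_smul ε) (evalW_mapW ε plusHom_smul) m q i

theorem toSeries_hamFieldW (m : ℕ) (q : Fin 2 → AddMonoidAlgebra (P k) (S →₀ ℕ)) (i : Fin 2) :
    toSeries S (P k) (hamFieldW m q i) = hamFieldT m (fun i => toSeries S (P k) (q i)) i :=
  map_vecField (toSeries S (P k)) (fun _ _ => rfl) (fun _ => rfl) m q i

theorem lowerCon_coordW_trunc [DecidableEq S] (L : Fin 2 → MvPowerSeries S (P k)) (n : S →₀ ℕ)
    (v : Var) : lowerCon k (LowerSet.Iic n) (coordW (fun i => trunc n (L i)) v) (coordT L v) :=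
  lowerCon_mapT _ (lowerCon_trunc n (L v.1))

/-- The field respects congruence on lower sets of exponents, so the truncation of `L` at `n`
determines it up to exponent `n`. -/
theorem lowerCon_coordW_hamFieldW [DecidableEq S] (m : ℕ) (L : Fin 2 → MvPowerSeries S (P k))
    (n : S →₀ ℕ) (v : Var) : lowerCon k (LowerSet.Iic n)
      (coordW (hamFieldW m fun i => trunc n (L i)) v) (coordT (hamFieldT m L) v) := by
  rw [coe_coordW]
  simp only [toSeries_hamFieldW]
  exact lowerCon_mapT _ (lowerCon_vecField (plusHom k) m (fun i => lowerCon_trunc n (L i)) v.1)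

theorem coeff_dmonoAt_congr {n : S →₀ ℕ} {x z : Var → MvPolynomial S k}
    {X Z : Var → MvPowerSeries S k} (hx : ∀ v, lowerCon k (LowerSet.Iic n) (x v) (X v))
    (hz : ∀ v, lowerCon k (LowerSet.Iic n) (z v) (Z v)) (μ : Var →₀ ℕ) :
    MvPolynomial.coeff n (dmonoAt μ x z) = MvPowerSeries.coeff n (dmonoAt μ X Z) := by
  rw [← MvPolynomial.coeff_coe, ← MvPolynomial.coeToMvPowerSeries.ringHom_apply, map_dmonoAt]
  refine (lowerCon k (LowerSet.Iic n)).eq.1 ?_ n (LowerSet.mem_Iic_iff.2 le_rfl)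
  change (lowerCon k _).mk' _ = (lowerCon k _).mk' _
  rw [map_dmonoAt, map_dmonoAt]
  congr 1 <;> funext v
  · exact (lowerCon k _).eq.2 (hx v)
  · exact (lowerCon k _).eq.2 (hz v)

theorem coeff_monoAt_congr {n : S →₀ ℕ} {x : Var → MvPolynomial S k}
    {X : Var → MvPowerSeries S k} (hx : ∀ v, lowerCon k (LowerSet.Iic n) (x v) (X v))
    (μ : Var →₀ ℕ) :
    MvPolynomial.coeff n (monoAt μ x) = MvPowerSeries.coeff n (monoAt μ X) := by
  rw [← MvPolynomial.coeff_coe, ← MvPolynomial.coeToMvPowerSeries.ringHom_apply, map_monoAt]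
  refine (lowerCon k (LowerSet.Iic n)).eq.1 ?_ n (LowerSet.mem_Iic_iff.2 le_rfl)
  change (lowerCon k _).mk' _ = (lowerCon k _).mk' _
  rw [map_monoAt, map_monoAt]
  congr 1
  funext v
  exact (lowerCon k _).eq.2 (hx v)

/-- The value of a functional along a formal curve. -/
theorem isValue_of_rep [CharZero k] {F : P2 k → k} {c : (Var →₀ ℕ) → k} {D : ℕ}
    (hD : ∀ μ, c μ ≠ 0 → μ.degree ≤ D)
    (hc : ∀ L, (Function.support fun μ => c μ * monomialValue μ L).Finite ∧
      F L = ∑ᶠ μ, c μ * monomialValue μ L) (L : Fin 2 → MvPowerSeries S (P k)) :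
    IsValue F L fun n => ∑ᶠ μ, c μ * MvPowerSeries.coeff n (monoAt μ (coordT L)) := by
  classical
  intro n
  let q : Fin 2 → AddMonoidAlgebra (P k) (S →₀ ℕ) := fun i => trunc n (L i)
  -- One finite set of monomials serves for all values `ε` of the times, so the value on the
  -- truncation is a polynomial.
  have hfin := finite_monoAt_ne_zero hD (fun L => (hc L).1) (coordW_mem_points q)
  have hev : ∀ ε μ, monomialValue μ (truncAt L n ε) =
      MvPolynomial.eval ε (monoAt μ (coordW q)) := by
    intro ε μ
    rw [map_monoAt, monomialValue_eq]
    congr 1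
    funext v
    rw [eval_coordW]
    simp only [q, evalW_trunc]
  refine ⟨∑ μ ∈ hfin.toFinset, MvPolynomial.C (c μ) * monoAt μ (coordW q), fun ε => ?_, ?_⟩
  · rw [(hc _).2, finsum_eq_sum_of_support_subset (s := hfin.toFinset), map_sum]
    · simp only [map_mul, MvPolynomial.eval_C, hev]
    · intro μ hμ
      rw [Function.mem_support, hev] at hμ
      rw [Set.Finite.coe_toFinset]
      exact ⟨left_ne_zero_of_mul hμ, fun h => right_ne_zero_of_mul hμ (by rw [h, map_zero])⟩
  · change ∑ᶠ μ, c μ * MvPowerSeries.coeff n (monoAt μ (coordT L)) = _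
    have hco : ∀ μ, MvPowerSeries.coeff n (monoAt μ (coordT L)) =
        MvPolynomial.coeff n (monoAt μ (coordW q)) := fun μ =>
      (coeff_monoAt_congr (lowerCon_coordW_trunc L n) μ).symm
    rw [finsum_eq_sum_of_support_subset (s := hfin.toFinset), MvPolynomial.coeff_sum]
    · simp only [MvPolynomial.coeff_C_mul, hco]
    · intro μ hμ
      rw [Function.mem_support, hco] at hμ
      rw [Set.Finite.coe_toFinset]
      exact ⟨left_ne_zero_of_mul hμ, fun h => right_ne_zero_of_mul hμ (by
        rw [h, MvPolynomial.coeff_zero])⟩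

/-- The value of a Poisson bracket with `H_m` along a formal curve. -/
theorem isValue_poissonR_of_rep [CharZero k] {F : P2 k → k} {c : (Var →₀ ℕ) → k} {D : ℕ}
    (hD : ∀ μ, c μ ≠ 0 → μ.degree ≤ D)
    (hc : ∀ L, (Function.support fun μ => c μ * monomialValue μ L).Finite ∧
      F L = ∑ᶠ μ, c μ * monomialValue μ L) (m : ℕ) (L : Fin 2 → MvPowerSeries S (P k)) :
    IsValue (poissonR F (H m)) L fun n => ∑ᶠ μ, c μ *
      MvPowerSeries.coeff n (dmonoAt μ (coordT L) (coordT (hamFieldT m L))) := by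
  classical
  intro n
  let q : Fin 2 → AddMonoidAlgebra (P k) (S →₀ ℕ) := fun i => trunc n (L i)
  have hfin := finite_dmonoAt_ne_zero hD (fun L => (hc L).1) (coordW_mem_points q)
    (coordW_mem_points (hamFieldW m q))
  have hq : ∀ ε, (fun i => evalW (P k) ε (q i)) = truncAt L n ε := fun ε =>
    funext fun i => evalW_trunc L n ε i
  have hev : ∀ ε μ, dmonoAt μ (coord (truncAt L n ε)) (coord (hamField m (truncAt L n ε))) =
      MvPolynomial.eval ε (dmonoAt μ (coordW q) (coordW (hamFieldW m q))) := by
    intro ε μ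
    rw [map_dmonoAt]
    congr 1 <;> funext v <;> rw [eval_coordW]
    · rw [hq]
    · simp only [evalW_hamFieldW, hq]
  refine ⟨∑ μ ∈ hfin.toFinset, MvPolynomial.C (c μ) *
    dmonoAt μ (coordW q) (coordW (hamFieldW m q)), fun ε => ?_, ?_⟩
  -- The bracket and the termwise derivative are both derivatives of `F` along the Hamiltonian
  -- field, hence equal.
  · rw [(hasDirDeriv_hamField ⟨c, D, hD, hc⟩ m (truncAt L n ε)).unique
      (hasDirDeriv_of_rep hD hc (truncAt L n ε) (hamField m (truncAt L n ε))),
      finsum_eq_sum_of_support_subset (s := hfin.toFinset), map_sum]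
    · simp only [map_mul, MvPolynomial.eval_C, hev]
    · intro μ hμ
      rw [Function.mem_support, hev] at hμ
      rw [Set.Finite.coe_toFinset]
      exact ⟨left_ne_zero_of_mul hμ, fun h => right_ne_zero_of_mul hμ (by rw [h, map_zero])⟩
  · change ∑ᶠ μ, c μ * MvPowerSeries.coeff n
      (dmonoAt μ (coordT L) (coordT (hamFieldT m L))) = _
    have hco : ∀ μ, MvPowerSeries.coeff n (dmonoAt μ (coordT L) (coordT (hamFieldT m L))) =
        MvPolynomial.coeff n (dmonoAt μ (coordW q) (coordW (hamFieldW m q))) := fun μ =>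
      (coeff_dmonoAt_congr (lowerCon_coordW_trunc L n) (lowerCon_coordW_hamFieldW m L n) μ).symm
    rw [finsum_eq_sum_of_support_subset (s := hfin.toFinset), MvPolynomial.coeff_sum]
    · simp only [MvPolynomial.coeff_C_mul, hco]
    · intro μ hμ
      rw [Function.mem_support, hco] at hμ
      rw [Set.Finite.coe_toFinset]
      exact ⟨left_ne_zero_of_mul hμ, fun h => right_ne_zero_of_mul hμ (by
        rw [h, MvPolynomial.coeff_zero])⟩

theorem isValue_coord (v : Var) (L : Fin 2 → MvPowerSeries S (P k)) :
    IsValue (fun L => coord L v) L (coordT L v) := by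
  classical
  intro n
  refine ⟨coordW (fun i => trunc n (L i)) v, fun ε => ?_, ?_⟩
  · rw [eval_coordW]
    simp only [evalW_trunc]
  · exact (lowerCon_coordW_trunc L n v n (LowerSet.mem_Iic_iff.2 le_rfl)).symm

theorem isValue_poissonR_coord [CharZero k] (v : Var) (m : ℕ)
    (L : Fin 2 → MvPowerSeries S (P k)) :
    IsValue (poissonR (fun L => coord L v) (H m)) L (coordT (hamFieldT m L) v) := by
  classical
  intro n
  refine ⟨coordW (hamFieldW m fun i => trunc n (L i)) v, fun ε => ?_, ?_⟩
  · rw [eval_coordW, (hasDirDeriv_hamField (coord_mem_functionals v) m (truncAt L n ε)).unique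
      (hasDirDeriv_coord v _ _)]
    simp only [evalW_hamFieldW, evalW_trunc]
  · exact (lowerCon_coordW_hamFieldW m L n v n (LowerSet.mem_Iic_iff.2 le_rfl)).symm

/-- Formal solutions of the Hamiltonian system of `H_m` are the integral curves of its Hamiltonian
vector field. -/
theorem isHamiltonSolution_iff [CharZero k] (m : ℕ) (s : S) (L : Fin 2 → MvPowerSeries S (P k)) :
    IsHamiltonSolution (H m) s L ↔ ∀ i, timeDeriv s (L i) = hamFieldT m L i := by
  constructor
  · intro h
    refine congrFun (coordT_injective (funext fun v => ?_))
    obtain ⟨f, g, hf, hg, hfg⟩ := h _ (coord_mem_functionals v)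
    rw [hf.unique (isValue_coord v L), hg.unique (isValue_poissonR_coord v m L)] at hfg
    rw [← hfg]
    exact (timeDeriv_mapT _ s (L v.1)).symm
  · rintro h F ⟨c, D, hD, hc⟩
    refine ⟨_, _, isValue_of_rep hD hc L, isValue_poissonR_of_rep hD hc m L, ?_⟩
    ext n
    change (n s + 1) • (∑ᶠ μ, c μ * MvPowerSeries.coeff (n + Finsupp.single s 1)
      (monoAt μ (coordT L))) = ∑ᶠ μ, c μ * MvPowerSeries.coeff n
      (dmonoAt μ (coordT L) (coordT (hamFieldT m L)))
    rw [smul_finsum]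
    refine finsum_congr fun μ => ?_
    -- The chain rule, applied to one monomial at a time.
    have h1 : timeDeriv s (monoAt μ (coordT L)) =
        dmonoAt μ (coordT L) (coordT (hamFieldT m L)) := by
      refine ((timeDerivation k s).map_monoAt μ (coordT L)).trans ?_
      congr 1
      funext v
      refine (timeDeriv_mapT _ s (L v.1)).trans ?_
      rw [h]
      rfl
    rw [← h1, coeff_timeDeriv, mul_smul_comm]

theorem plusT_eq (f : MvPowerSeries S (P k)) : plusT f = mapT (plusHom k) f := rfl

theorem InPPrimeT.commute {L : Fin 2 → MvPowerSeries S (P k)} (h : InPPrimeT L) :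
    Commute (L 0) (L 1) := by
  have := h 0 1
  rwa [Ring.lie_def, sub_eq_zero] at this

theorem isHamiltonSolution_iff_isLaxSolution [CharZero k] {m : ℕ} (hm : m ≠ 0) (s : S)
    {L : Fin 2 → MvPowerSeries S (P k)} (hL : InPPrimeT L) :
    IsHamiltonSolution (H m) s L ↔ IsLaxSolution m s L := by
  rw [isHamiltonSolution_iff]
  refine forall_congr' fun i => ?_
  rw [hamFieldT, vecField_of_commute _ hm hL.commute, plusT_eq]

theorem inPPrimeT_of_commute {L : Fin 2 → MvPowerSeries S (P k)} (h : L 0 * L 1 = L 1 * L 0) :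
    InPPrimeT L := by
  intro i j
  rw [Ring.lie_def, sub_eq_zero]
  fin_cases i <;> fin_cases j
  · rfl
  · exact h
  · exact h.symm
  · rfl

/-- Jacobi identity for [w, [a, b]], expanded into products so that it can be applied to images in a
quotient ring. -/
theorem lie_derivation_identity {R : Type*} [Ring R] (w a b : R) :
    (w * a - a * w) * b + a * (w * b - b * w) - ((w * b - b * w) * a + b * (w * a - a * w)) =
      w * (a * b - b * a) - (a * b - b * a) * w := by
  noncomm_ring

/-- The exponents of degree less than `n`. -/
def degreeLT (S : Type*) (n : ℕ) : LowerSet (S →₀ ℕ) where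
  carrier := {j | j.degree < n}
  lower' := fun _ _ h h' => lt_of_le_of_lt (Finsupp.degree_mono h) h'

/-- Formal solutions of Hamiltonian systems that start in `P'` stay in `P'`. -/
theorem inPPrimeT_of_isHamiltonSolution [CharZero k] {m : S → ℕ} (hm : ∀ s, m s ≠ 0)
    {L : Fin 2 → MvPowerSeries S (P k)} (h : ∀ s, IsHamiltonSolution (H (m s)) s L)
    (h0 : (fun i => MvPowerSeries.coeff 0 (L i)) ∈ PPrime k) : InPPrimeT L := by
  classical
  have key : ∀ n : ℕ, lowerCon (P k) (degreeLT S n) (L 0 * L 1) (L 1 * L 0) := by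
    intro n
    induction n with
    | zero => exact fun j hj => absurd hj (Nat.not_lt_zero _)
    | succ n ih =>
      intro j hj
      by_cases hj0 : j = 0
      · subst hj0
        have := h0 0 1
        rw [Ring.lie_def, sub_eq_zero] at this
        simp only [MvPowerSeries.coeff_zero_eq_constantCoeff_apply, map_mul] at this ⊢
        exact this
      -- A nonzero exponent involves some time t_s; differentiating by t_s lowers the degree by one
      -- and brings the coefficient into the range of the induction hypothesis.
      · obtain ⟨s, hs⟩ := Finsupp.ne_iff.1 hj0
        let C := lowerCon (P k) (degreeLT S n)
        let φ := C.mk'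
        let W := mapT (plusHom k) ((L 0 + L 1) ^ (m s - 1))
        have hL : ∀ i, φ (timeDeriv s (L i)) = φ W * φ (L i) - φ (L i) * φ W := by
          intro i
          rw [(isHamiltonSolution_iff (m s) s L).1 (h s) i, ← map_mul, ← map_mul, ← map_sub,
            ← Ring.lie_def]
          exact C.eq.2 (lowerCon_vecField_of_commute (plusHom k) (hm s) ih i)
        have hc : φ (L 0) * φ (L 1) = φ (L 1) * φ (L 0) := by
          rw [← map_mul, ← map_mul]
          exact C.eq.2 ih
        -- In degrees below `n` the field has Lax form, so the derivative of the commutator is its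
        -- bracket with `W`, and the commutator is zero there.
        have hD : φ (timeDeriv s (L 0 * L 1 - L 1 * L 0)) = 0 := by
          have e : timeDeriv s (L 0 * L 1 - L 1 * L 0) =
              timeDeriv s (L 0) * L 1 + L 0 * timeDeriv s (L 1) -
              (timeDeriv s (L 1) * L 0 + L 1 * timeDeriv s (L 0)) := by
            change timeDerivation (P k) s _ = _
            rw [map_sub, RingDeriv.leibniz, RingDeriv.leibniz]
            rfl
          rw [e]
          simp only [map_sub, map_add, map_mul, hL]
          rw [lie_derivation_identity, hc, sub_self, mul_zero, zero_mul, sub_zero]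
        have hz : lowerCon (P k) (degreeLT S n) (timeDeriv s (L 0 * L 1 - L 1 * L 0)) 0 :=
          C.eq.1 (hD.trans (map_zero φ).symm)
        refine sub_eq_zero.1 ?_
        rw [← map_sub]
        -- Characteristic zero: the positive exponent of t_s in `j` can be divided out.
        refine coeff_eq_zero_of_timeDeriv k (s := s) hs (hz _ ?_)
        have hle : Finsupp.single s 1 ≤ j := by
          rw [Finsupp.single_le_iff]
          exact Nat.one_le_iff_ne_zero.2 hs
        have hdeg := congrArg Finsupp.degree (tsub_add_cancel_of_le hle)
        rw [map_add, Finsupp.degree_single] at hdeg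
        have hj' : j.degree < n + 1 := hj
        change (j - Finsupp.single s 1).degree < n
        omega
  refine inPPrimeT_of_commute ?_
  ext1 n
  exact key (n.degree + 1) n (Nat.lt_succ_self _)

theorem coeff_mul_comm_res (f g : MvPowerSeries S (P k)) (n : S →₀ ℕ) :
    res (MvPowerSeries.coeff n (f * g)) = res (MvPowerSeries.coeff n (g * f)) := by
  classical
  rw [MvPowerSeries.coeff_mul, MvPowerSeries.coeff_mul, ← resL_apply, ← resL_apply, map_sum,
    map_sum]
  simp only [resL_apply]
  rw [Finsupp.sum_antidiagonal_swap n fun a b =>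
    res (MvPowerSeries.coeff a f * MvPowerSeries.coeff b g)]
  exact Finset.sum_congr rfl fun p _ => res_mul_comm _ _

/-- The value of `H_m` along a formal curve. -/
theorem isValue_H (m : ℕ) (L : Fin 2 → MvPowerSeries S (P k)) :
    IsValue (H m) L (mapT resL.toAddMonoidHom ((1 / (m : k)) • binomSum m L)) := by
  classical
  intro n
  let q : Fin 2 → AddMonoidAlgebra (P k) (S →₀ ℕ) := fun i => trunc n (L i)
  refine ⟨scalarPoly resL ((1 / (m : k)) • binomSum m q), fun ε => ?_, ?_⟩
  · rw [eval_scalarPoly, evalW_smul, map_binomSum, H_eq, resL_apply]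
    simp only [q, evalW_trunc]
  · rw [coeff_scalarPoly, coeff_mapT, coeff_smulT, AddMonoidAlgebra.coeff_smul, Finsupp.smul_apply]
    have : lowerCon (P k) (LowerSet.Iic n) (toSeries S (P k) (binomSum m q)) (binomSum m L) := by
      refine (lowerCon (P k) _).eq.1 ?_
      change (lowerCon (P k) _).mk' _ = (lowerCon (P k) _).mk' _
      rw [map_binomSum, map_binomSum, map_binomSum]
      congr 1
      funext i
      exact (lowerCon (P k) _).eq.2 (lowerCon_trunc n (L i))
    rw [← this n (LowerSet.mem_Iic_iff.2 le_rfl)]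
    rfl

/-- The `H_m` are constant along solutions of the Lax equations. -/
theorem timeDeriv_H_eq_zero {m : ℕ} {s : S} {L : Fin 2 → MvPowerSeries S (P k)}
    (h : IsLaxSolution m s L) (m' : ℕ) :
    timeDeriv s (mapT resL.toAddMonoidHom ((1 / (m' : k)) • binomSum m' L)) = 0 := by
  let W := plusT ((L 0 + L 1) ^ (m - 1))
  have h1 : timeDeriv s (binomSum m' L) = ⁅W, binomSum m' L⁆ :=
    -- ∂/∂t_s and [W, ·] are derivations that agree on `L 0` and `L 1`, hence on every
    -- noncommutative polynomial in them; the residue of a commutator then vanishes coefficientwise.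
    RingDeriv.binomSum_congr (timeDerivation (P k) s) (innerDeriv W) m' h
  have h2 : timeDeriv s ((1 / (m' : k)) • binomSum m' L) =
      (1 / (m' : k)) • timeDeriv s (binomSum m' L) := by
    ext1 n
    rw [coeff_timeDeriv, coeff_smulT, coeff_smulT, coeff_timeDeriv, smul_comm]
  rw [timeDeriv_mapT, h2, h1]
  ext n
  rw [coeff_mapT, coeff_smulT, map_zero, LinearMap.toAddMonoidHom_coe, map_smul, Ring.lie_def, map_sub,
    map_sub, resL_apply, resL_apply, coeff_mul_comm_res, sub_self, smul_zero]

end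

end PDO


theorem proposition9 {k : Type*} [Field k] [CharZero k] :
    -- the functionals `H_m` belong to `𝓕(P²)`, and all functionals have unique gradients
    (∀ F ∈ PDO.Functionals k, ∀ L : PDO.P2 k, ∃! U, PDO.IsGradient F L U) ∧
    (∀ m : ℕ+, (PDO.H m : PDO.P2 k → k) ∈ PDO.Functionals k) ∧
    -- (i), infinitesimally: at a point of `P'` the system is given by exactly one velocity vector,
    -- the right-hand side of the Lax equations, and this vector is tangent to `P'`
    (∀ m : ℕ+, ∀ L ∈ PDO.PPrime k,
      (∀ X : PDO.P2 k,
        (∀ F ∈ PDO.Functionals k, PDO.HasDirDeriv F L X (PDO.poissonR F (PDO.H m) L)) ↔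
          X = PDO.lax m L) ∧
      PDO.IsTangent L (PDO.lax m L)) ∧
    -- (i), for formal solutions in any set `T` of the times `t_m`: solutions that start in `P'`
    -- stay in `P'`
    (∀ (T : Set ℕ+) (L : Fin 2 → MvPowerSeries T (PDO.P k)),
      (∀ s : T, PDO.IsHamiltonSolution (PDO.H (s : ℕ+)) s L) →
      (fun i => MvPowerSeries.coeff 0 (L i)) ∈ PDO.PPrime k → PDO.InPPrimeT L) ∧
    -- (i), for formal curves in `P'`: the system is equivalent to the Lax equations
    (∀ (T : Set ℕ+) (L : Fin 2 → MvPowerSeries T (PDO.P k)), PDO.InPPrimeT L →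
      ∀ s : T, PDO.IsHamiltonSolution (PDO.H (s : ℕ+)) s L ↔ PDO.IsLaxSolution (s : ℕ+) s L) ∧
    -- (ii), integrals of motion: each `H_m` is constant along the solutions that start in `P'`
    (∀ (T : Set ℕ+) (L : Fin 2 → MvPowerSeries T (PDO.P k)),
      (∀ s : T, PDO.IsHamiltonSolution (PDO.H (s : ℕ+)) s L) →
      (fun i => MvPowerSeries.coeff 0 (L i)) ∈ PDO.PPrime k →
      ∀ m : ℕ+, ∃ f : MvPowerSeries T k, PDO.IsValue (PDO.H m) L f ∧
        ∀ s : T, PDO.timeDeriv s f = 0) ∧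
    -- (ii), the functionals `H_m` Poisson-commute on `P'`
    (∀ m m' : ℕ+, ∀ L ∈ PDO.PPrime k, PDO.poissonR (PDO.H m) (PDO.H m') L = 0) := by 
  refine ⟨fun F hF L => PDO.existsUnique_isGradient hF L, fun m => PDO.H_mem_functionals m,
    fun m L hL => ⟨PDO.forall_hasDirDeriv_iff m.ne_zero hL, PDO.isTangent_lax m hL⟩,
    fun T L h h0 => PDO.inPPrimeT_of_isHamiltonSolution (fun s : T => (s : ℕ+).ne_zero) h h0,
    fun T L hL s => PDO.isHamiltonSolution_iff_isLaxSolution (s : ℕ+).ne_zero s hL,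
    fun T L h h0 m => ⟨_, PDO.isValue_H m L, fun s => ?_⟩,
    fun m m' L hL => PDO.poissonR_H_H m.ne_zero m'.ne_zero hL⟩
  have hL := PDO.inPPrimeT_of_isHamiltonSolution (fun s : T => (s : ℕ+).ne_zero) h h0
  exact PDO.timeDeriv_H_eq_zero
    ((PDO.isHamiltonSolution_iff_isLaxSolution (s : ℕ+).ne_zero s hL).1 (h s)) m
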